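/- Let $M$ be a $5$-manifold with a contact hyperkähler $\mathrm{SU}(2)$-structure $(\theta,\omega,\alpha,\beta)$: $\theta$ is a contact form with Reeb field $v$, $H=\ker\theta$, $\omega=d\theta$, and $\alpha,\beta$ are sections of $\Lambda^2H^*$ (i.e. annihilated by $v$) with $\alpha\wedge\alpha=\beta\wedge\beta=\omega\wedge\omega$, $\omega\wedge\alpha=\alpha\wedge\beta=\beta\wedge\omega=0$ and $d_H\alpha=d_H\beta=0$, where $d_H$ is the exterior derivative followed by restriction to $H$. Let $I$ be the almost complex structure on $H$ for which $\alpha+i\beta$ is of type $(2,0)$; as part of the definition (a sign convention on the triple), $g_H(X,Y)=\omega(X,IY)$ is positive definite on $H$. Put $g=\theta^2+g_H$ and orient $H$ by $\mathrm{Vol}_H=\tfrac12\omega^2$; let $*$ be the Hodge star on $\Lambda^\bullet H^*$, $\Lambda^+_H=\mathrm{span}(\omega,\alpha,\beta)$, $\Lambda^-_H$ its orthogonal complement (the anti-self-dual forms), and $\Omega^-_H$ the smooth sections of $\Lambda^-_H$. Let $d_H^-=\tfrac12(d_H-*d_H)$ on $1$-forms on $H$, $d_H^*=-*d_H*$, and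 $\Box_H=d_H^-d_H^*$ on $\Omega^-_H$. Let $f$ be the function with $\mathcal L_v\alpha\wedge\beta=f\,\omega\wedge\omega$ on $H$. Let $\nabla$ be the distinguished adapted connection on $TM$, that is: $\nabla g=0$, $\nabla$ preserves $H$, $\nabla v=0$, the torsion $T$ has no component in $\Lambda^2H^*\otimes H$, the forms $\omega,\alpha,\beta$ are $\nabla$-parallel, and the skew-symmetric part of $T_v=T(v,\cdot)\in\mathrm{End}(H)$ has no component in $\mathfrak{so}^-(H)$. Let $R^H(X,Y,Z,W)=g(R^\nabla(X,Y)Z,W)$ for $X,Y,Z,W\in H$, with $R^\nabla(X,Y)=[\nabla_X,\nabla_Y]-\nabla_{[X,Y]}$; let $\pi_s$ be symmetrization under exchange of the two pairs of arguments, $b(\mathcal R)(X,Y,Z,W)=\tfrac13(\mathcal R(X,Y,Z,W)+\mathcal R(Y,Z,X,W)+\mathcal R(Z,X,Y,W))$, and $C^H=\pi_s(R^H)-b(\pi_s(R^H))$. For a local $g_H$-orthonormal frame $e_1,\dots,e_4$ of $H$ put $r_H(X,Y)=\sum_iC^H(e_i,X,Y,e_i)$, $s_H=\sum_ir_H(e_i,e_i)$,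 and let $$W^H=C^H-\tfrac12\,r_H\odot g_H+\tfrac1{12}\,s_H\,g_H\odot g_H,$$ where $\odot$ is the Kulkarni--Nomizu product $(h\odot k)(X,Y,Z,W)=h(X,W)k(Y,Z)+h(Y,Z)k(X,W)-h(X,Z)k(Y,W)-h(Y,W)k(X,Z)$. Let $(W^H)^-$ be the component of $W^H$ in $\Lambda^-_H\otimes\Lambda^-_H$. Let $\nabla_H\sigma=\sum_ie^i\otimes\nabla_{e_i}\sigma$ and let $\nabla_H^*\tau=-\sum_i(\nabla_{e_i}\tau)(e_i,\cdot)$ be its formal adjoint. Finally let $\varepsilon^k$ be the wedge product with $e^k$ and $\iota^k$ the contraction with $e_k$. Then for every $\sigma\in\Omega^-_H$ $$2\,\Box_H\sigma=\nabla_H^*\nabla_H\sigma+\sum_{k,l,m,n=1}^4(W^H)^-_{klmn}\,\varepsilon^k\iota^l\varepsilon^m\iota^n\sigma+\frac{s_H}{3}\,\sigma-\frac23\,f\,\sigma .$$ -/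

import Mathlib

open scoped Manifold ContDiff

noncomputable section

namespace ContactGeom

section Tensors

variable (M : Type*) [TopologicalSpace M] [ChartedSpace (EuclideanSpace ℝ (Fin 5)) M]

/-- Vector fields on the `5`-manifold `M` (no regularity built in). -/
abbrev VField : Type _ := Π x : M, TangentSpace (𝓡 5) x

/-- Covariant tensor fields of rank `1`. Here and below tensor fields are taken as functions of tangent vectors at each point
(multilinearity and regularity are imposed separately where they are hypotheses). -/
abbrev Tensor1 : Type _ := Π x : M, TangentSpace (𝓡 5) x → ℝ

/-- Covariant tensor fields of rank `2`. -/
abbrev Tensor2 : Type _ := Π x : M, TangentSpace (𝓡 5) x → TangentSpace (𝓡 5) x → ℝ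

/-- Covariant tensor fields of rank `3`. -/
abbrev Tensor3 : Type _ := Π x : M,
  TangentSpace (𝓡 5) x → TangentSpace (𝓡 5) x → TangentSpace (𝓡 5) x → ℝ

/-- Covariant tensor fields of rank `4`. -/
abbrev Tensor4 : Type _ := Π x : M,
  TangentSpace (𝓡 5) x → TangentSpace (𝓡 5) x → TangentSpace (𝓡 5) x →
    TangentSpace (𝓡 5) x → ℝ

/-- Affine connections on `M`: covariant derivatives on the tangent bundle.
Mind the argument order: `cov Y x u` is `(∇_u Y)(x)`. -/
abbrev Connection [IsManifold (𝓡 5) ∞ M] : Type _ :=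
  CovariantDerivative (𝓡 5) (EuclideanSpace ℝ (Fin 5)) (TangentSpace (𝓡 5) : M → Type _)

variable {M}

/-- The smoothness of a vector field, as a section of the tangent bundle. -/
def SmoothField [IsManifold (𝓡 5) ∞ M] (X : VField M) : Prop :=
  ContMDiff (𝓡 5) (𝓡 5).tangent ∞ (fun x => (⟨x, X x⟩ : TangentBundle (𝓡 5) M))

/-- Differentiability of a vector field at a point. -/
def DiffFieldAt [IsManifold (𝓡 5) ∞ M] (X : VField M) (x : M) : Prop :=
  MDifferentiableAt (𝓡 5) (𝓡 5).tangent (fun y => (⟨y, X y⟩ : TangentBundle (𝓡 5) M)) x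

/-- A local extension of the tangent vector `u` at `x` to a vector field, smooth near `x`. The
formulas below are tensorial, so their values do not depend on the extension. -/
def ext [IsManifold (𝓡 5) ∞ M] {x : M} (u : TangentSpace (𝓡 5) x) : VField M :=
  FiberBundle.extend (EuclideanSpace ℝ (Fin 5)) u

/-- The derivative `u h` of the function `h` in the direction of the tangent vector `u`. -/
def dirD (h : M → ℝ) {x : M} (u : TangentSpace (𝓡 5) x) : ℝ := mvfderiv (𝓡 5) h x u

variable [IsManifold (𝓡 5) ∞ M]

/-- The Lie bracket of vector fields. -/
def bracket (X Y : VField M) : VField M := VectorField.mlieBracket (𝓡 5) X Y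

/-- The exterior derivative of a `1`-form:
`dη(U, W) = U η(W) - W η(U) - η([U, W])`. -/
def extD1 (η : Tensor1 M) : Tensor2 M := fun x u w =>
  dirD (fun y => η y (ext w y)) u - dirD (fun y => η y (ext u y)) w
    - η x (bracket (ext u) (ext w) x)

/-- The exterior derivative of a `2`-form:
`dη(U, W, Z) = U η(W, Z) - W η(U, Z) + Z η(U, W) - η([U, W], Z) + η([U, Z], W) - η([W, Z], U)`. -/
def extD2 (η : Tensor2 M) : Tensor3 M := fun x u w z =>
  dirD (fun y => η y (ext w y) (ext z y)) u - dirD (fun y => η y (ext u y) (ext z y)) w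
    + dirD (fun y => η y (ext u y) (ext w y)) z
    - η x (bracket (ext u) (ext w) x) z + η x (bracket (ext u) (ext z) x) w
    - η x (bracket (ext w) (ext z) x) u

/-- The Lie derivative of a covariant `2`-tensor along the vector field `V`:
`(L_V η)(U, W) = V η(U, W) - η([V, U], W) - η(U, [V, W])`. -/
def lieD (V : VField M) (η : Tensor2 M) : Tensor2 M := fun x u w =>
  dirD (fun y => η y (ext u y) (ext w y)) (V x)
    - η x (bracket V (ext u) x) w - η x u (bracket V (ext w) x)

/-- The covariant derivative of a covariant `2`-tensor: `covD2 cov η x u w z = (∇_u η)(w, z)`. -/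
def covD2 (cov : Connection M) (η : Tensor2 M) : Tensor3 M := fun x u w z =>
  dirD (fun y => η y (ext w y) (ext z y)) u - η x (cov (ext w) x u) z - η x w (cov (ext z) x u)

/-- The covariant derivative of a covariant `3`-tensor:
`covD3 cov τ x u a w z = (∇_u τ)(a, w, z)`. -/
def covD3 (cov : Connection M) (τ : Tensor3 M) : Tensor4 M := fun x u a w z =>
  dirD (fun y => τ y (ext a y) (ext w y) (ext z y)) u
    - τ x (cov (ext a) x u) w z - τ x a (cov (ext w) x u) z - τ x a w (cov (ext z) x u)

/-- The curvature `R(u, w) z = ∇_u ∇_w z - ∇_w ∇_u z - ∇_{[u, w]} z`. -/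
def curvature (cov : Connection M) {x : M} (u w z : TangentSpace (𝓡 5) x) :
    TangentSpace (𝓡 5) x :=
  cov (fun y => cov (ext z) y (ext w y)) x u - cov (fun y => cov (ext z) y (ext u y)) x w
    - cov (ext z) x (bracket (ext u) (ext w) x)

/-- The torsion `T(u, w) = ∇_u w - ∇_w u - [u, w]`. -/
def torsion (cov : Connection M) {x : M} (u w : TangentSpace (𝓡 5) x) : TangentSpace (𝓡 5) x :=
  cov (ext w) x u - cov (ext u) x w - bracket (ext u) (ext w) x

end Tensors

section LinearAlgebra

variable {V : Type*}

/-- The wedge product of two `2`-forms, evaluated on four vectors. -/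
def wedge (σ τ : V → V → ℝ) (a b c d : V) : ℝ :=
  σ a b * τ c d - σ a c * τ b d + σ a d * τ b c + σ b c * τ a d - σ b d * τ a c + σ c d * τ a b

/-- The Kulkarni--Nomizu product of two bilinear forms. -/
def kulkarniNomizu (h k : V → V → ℝ) (a b c d : V) : ℝ :=
  h a d * k b c + h b c * k a d - h a c * k b d - h b d * k a c

/-- The symmetric part (under exchange of the two pairs of arguments). -/
def pairSymm (R : V → V → V → V → ℝ) (a b c d : V) : ℝ := (R a b c d + R c d a b) / 2

/-- The Bianchi map. -/
def bianchi (R : V → V → V → V → ℝ) (a b c d : V) : ℝ :=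
  (R a b c d + R b c a d + R c a b d) / 3

end LinearAlgebra

section Structure

variable {M : Type*} [TopologicalSpace M] [ChartedSpace (EuclideanSpace ℝ (Fin 5)) M]
  [IsManifold (𝓡 5) ∞ M]

/-- The Reeb vector field of `θ`: the vector field `v` with `θ(v) = 1` and `dθ(v, ·) = 0`. -/
def reeb (θ : Tensor1 M) : VField M := fun x =>
  Classical.epsilon (fun u => θ x u = 1 ∧ ∀ w, extD1 θ x u w = 0)

/-- The endomorphism `I` of `H = ker θ` for which `α + iβ` is of type `(2,0)`, that is
`(α + iβ)(I u, z) = i (α + iβ)(u, z)` for `z ∈ H`. It is extended by `I v = 0` when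
`α` and `β` vanish on the Reeb field `v`. -/
def cplxStr (θ : Tensor1 M) (α β : Tensor2 M) {x : M} (u : TangentSpace (𝓡 5) x) :
    TangentSpace (𝓡 5) x :=
  Classical.epsilon (fun w => θ x w = 0 ∧
    ∀ z, θ x z = 0 → α x w z = -β x u z ∧ β x w z = α x u z)

end Structure

/-- A contact hyperkähler `SU(2)`-structure `(θ, ω = dθ, α, β)` on a `5`-manifold. -/
structure ContactHyperkahler (M : Type*) [TopologicalSpace M]
    [ChartedSpace (EuclideanSpace ℝ (Fin 5)) M] [IsManifold (𝓡 5) ∞ M] where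
  /-- the contact form -/
  θ : Π x : M, TangentSpace (𝓡 5) x →ₗ[ℝ] ℝ
  /-- the second form of the triple -/
  α : Π x : M, LinearMap.BilinForm ℝ (TangentSpace (𝓡 5) x)
  /-- the third form of the triple -/
  β : Π x : M, LinearMap.BilinForm ℝ (TangentSpace (𝓡 5) x)
  smooth_θ : ∀ X : VField M, SmoothField X →
    ContMDiff (𝓡 5) 𝓘(ℝ, ℝ) ∞ (fun x => θ x (X x))
  smooth_α : ∀ X Y : VField M, SmoothField X → SmoothField Y →
    ContMDiff (𝓡 5) 𝓘(ℝ, ℝ) ∞ (fun x => α x (X x) (Y x))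
  smooth_β : ∀ X Y : VField M, SmoothField X → SmoothField Y →
    ContMDiff (𝓡 5) 𝓘(ℝ, ℝ) ∞ (fun x => β x (X x) (Y x))
  alt_α : ∀ x u, α x u u = 0
  alt_β : ∀ x u, β x u u = 0
  /-- `θ` vanishes nowhere -/
  θ_ne_zero : ∀ x, θ x ≠ 0
  /-- `dθ` is non-degenerate on `H = ker θ` -/
  contact : ∀ x u, θ x u = 0 →
    (∀ w, θ x w = 0 → extD1 (fun y u => θ y u) x u w = 0) → u = 0
  /-- `α` is a section of `Λ²H*`, i.e. annihilated by the Reeb field -/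
  horizontal_α : ∀ x w, α x (reeb (fun y u => θ y u) x) w = 0
  /-- `β` is a section of `Λ²H*`, i.e. annihilated by the Reeb field -/
  horizontal_β : ∀ x w, β x (reeb (fun y u => θ y u) x) w = 0
  /-- `α ∧ α = ω ∧ ω` -/
  α_sq : ∀ x a b c d, wedge (fun u w => α x u w) (fun u w => α x u w) a b c d =
    wedge (extD1 (fun y u => θ y u) x) (extD1 (fun y u => θ y u) x) a b c d
  /-- `β ∧ β = ω ∧ ω` -/
  β_sq : ∀ x a b c d, wedge (fun u w => β x u w) (fun u w => β x u w) a b c d =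
    wedge (extD1 (fun y u => θ y u) x) (extD1 (fun y u => θ y u) x) a b c d
  /-- `ω ∧ α = 0` -/
  ω_wedge_α : ∀ x a b c d,
    wedge (extD1 (fun y u => θ y u) x) (fun u w => α x u w) a b c d = 0
  /-- `α ∧ β = 0` -/
  α_wedge_β : ∀ x a b c d,
    wedge (fun u w => α x u w) (fun u w => β x u w) a b c d = 0
  /-- `β ∧ ω = 0` -/
  β_wedge_ω : ∀ x a b c d,
    wedge (fun u w => β x u w) (extD1 (fun y u => θ y u) x) a b c d = 0
  /-- the orientation convention: `g_H(u, w) = ω(u, I w)` is positive (rather than negative)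
  definite on `H` -/
  pos : ∀ x u, θ x u = 0 → u ≠ 0 →
    0 < extD1 (fun y u => θ y u) x u
      (cplxStr (fun y u => θ y u) (fun y u w => α y u w) (fun y u w => β y u w) u)
  /-- `d_H α = 0` -/
  closed_α : ∀ x u w z, θ x u = 0 → θ x w = 0 → θ x z = 0 →
    extD2 (fun y u w => α y u w) x u w z = 0
  /-- `d_H β = 0` -/
  closed_β : ∀ x u w z, θ x u = 0 → θ x w = 0 → θ x z = 0 →
    extD2 (fun y u w => β y u w) x u w z = 0

namespace ContactHyperkahler

variable {M : Type*} [TopologicalSpace M] [ChartedSpace (EuclideanSpace ℝ (Fin 5)) M]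
  [IsManifold (𝓡 5) ∞ M] (S : ContactHyperkahler M)

/-- `θ` as a tensor field. -/
def th : Tensor1 M := fun x u => S.θ x u

/-- `α` as a tensor field. -/
def al : Tensor2 M := fun x u w => S.α x u w

/-- `β` as a tensor field. -/
def be : Tensor2 M := fun x u w => S.β x u w

/-- `ω = dθ`. -/
def om : Tensor2 M := extD1 S.th

/-- The Reeb vector field. -/
def v : VField M := reeb S.th

/-- The projection `TM → H` along the Reeb field. -/
def πH {x : M} (u : TangentSpace (𝓡 5) x) : TangentSpace (𝓡 5) x := u - S.θ x u • S.v x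

/-- The metric `g_H(u, w) = ω(u, I w)` on `H`, extended by zero on the Reeb field. -/
def gH : Tensor2 M := fun x u w => S.om x u (cplxStr S.th S.al S.be w)

/-- The Riemannian metric `g = θ² + g_H`. -/
def g : Tensor2 M := fun x u w => S.θ x u * S.θ x w + S.gH x u w

/-- A `g_H`-orthonormal basis of `H` at each point, used for contractions only (everything
computed with it below is independent of the choice). -/
def frame (x : M) : Fin 4 → TangentSpace (𝓡 5) x :=
  Classical.epsilon (fun e => (∀ i, S.θ x (e i) = 0) ∧
    ∀ i j, S.gH x (e i) (e j) = if i = j then 1 else 0)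

/-- The volume form `Vol_H = ω ∧ ω / 2` on `H`. -/
def vol : Tensor4 M := fun x a b c d => wedge (S.om x) (S.om x) a b c d / 2

/-- The Hodge star `Λ²H* → Λ²H*` at the point `x`. -/
def star2 (x : M) (B : TangentSpace (𝓡 5) x → TangentSpace (𝓡 5) x → ℝ)
    (u w : TangentSpace (𝓡 5) x) : ℝ :=
  (∑ i, ∑ j, B (S.frame x i) (S.frame x j) * S.vol x (S.frame x i) (S.frame x j) u w) / 2

/-- The anti-self-dual part `(B - *B) / 2` of a `2`-form `B` on `H` at the point `x`. -/
def asdPart (x : M) (B : TangentSpace (𝓡 5) x → TangentSpace (𝓡 5) x → ℝ)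
    (u w : TangentSpace (𝓡 5) x) : ℝ := (B u w - S.star2 x B u w) / 2

/-- The Hodge star `Λ³H* → Λ¹H*`. -/
def star3 (τ : Tensor3 M) : Tensor1 M := fun x u =>
  (∑ i, ∑ j, ∑ k, τ x (S.frame x i) (S.frame x j) (S.frame x k) *
    S.vol x (S.frame x i) (S.frame x j) (S.frame x k) u) / 6

/-- The operator `d_H : Ω¹_H → Ω²_H`. -/
def dH1 (η : Tensor1 M) : Tensor2 M := fun x u w => extD1 η x (S.πH u) (S.πH w)

/-- The operator `d_H : Ω²_H → Ω³_H`. -/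
def dH2 (σ : Tensor2 M) : Tensor3 M := fun x u w z => extD2 σ x (S.πH u) (S.πH w) (S.πH z)

/-- The formal adjoint `d_H^* = - * d_H * : Ω²_H → Ω¹_H`. -/
def dHadj (σ : Tensor2 M) : Tensor1 M := fun x u => -S.star3 (S.dH2 (fun y => S.star2 y (σ y))) x u

/-- The operator `d_H^- : Ω¹_H → Ω⁻_H`. -/
def dHminus (η : Tensor1 M) : Tensor2 M := fun x => S.asdPart x (S.dH1 η x)

/-- The operator `□_H = d_H^- d_H^*` on `Ω⁻_H`. -/
def box (σ : Tensor2 M) : Tensor2 M := S.dHminus (S.dHadj σ)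

/-- `σ ∈ Ω⁻_H`: a smooth anti-self-dual section of `Λ²H*`. -/
structure IsASDForm (σ : Π x : M, LinearMap.BilinForm ℝ (TangentSpace (𝓡 5) x)) : Prop where
  smooth : ∀ X Y : VField M, SmoothField X → SmoothField Y →
    ContMDiff (𝓡 5) 𝓘(ℝ, ℝ) ∞ (fun x => σ x (X x) (Y x))
  alt : ∀ x u, σ x u u = 0
  horizontal : ∀ x w, σ x (S.v x) w = 0
  asd : ∀ x u w, S.star2 x (fun u w => σ x u w) u w = -σ x u w

/-- The function `f = (L_v α).β`, where `σ.τ = (σ ∧ τ) / (ω ∧ ω)` for sections of `Λ²H*`. -/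
def f (x : M) : ℝ :=
  wedge (lieD S.v S.al x) (S.be x)
      (S.frame x 0) (S.frame x 1) (S.frame x 2) (S.frame x 3) /
    wedge (S.om x) (S.om x) (S.frame x 0) (S.frame x 1) (S.frame x 2) (S.frame x 3)

/-- The connection `∇` on `TM` is adapted to `(θ, g)`. -/
structure IsAdapted (cov : Connection M) : Prop where
  /-- `∇ g = 0` -/
  metric : ∀ x u w z, covD2 cov S.g x u w z = 0
  /-- `∇` preserves `H` -/
  preserves : ∀ (Y : VField M) (x : M) (u : TangentSpace (𝓡 5) x), DiffFieldAt Y x →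
    (∀ y, S.θ y (Y y) = 0) → S.θ x (cov Y x u) = 0
  /-- the torsion has no component in `Λ²H* ⊗ H` -/
  torsion_H : ∀ (x : M) (u w : TangentSpace (𝓡 5) x), S.θ x u = 0 → S.θ x w = 0 →
    S.πH (torsion cov u w) = 0
  /-- `∇ v = 0` -/
  reeb_parallel : ∀ (x : M) (u : TangentSpace (𝓡 5) x), cov S.v x u = 0

/-- The distinguished adapted connection: the triple `(ω, α, β)` is parallel, and the
skew-symmetric part of `T_v = T(v, ·)` has no component in `𝔰𝔬⁻(H)`; that is, the corresponding
`2`-form is a section of `Λ⁺_H = span(ω, α, β)`. -/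
structure IsDistinguished (cov : Connection M) : Prop extends S.IsAdapted cov where
  parallel_ω : ∀ x u w z, covD2 cov S.om x u w z = 0
  parallel_α : ∀ x u w z, covD2 cov S.al x u w z = 0
  parallel_β : ∀ x u w z, covD2 cov S.be x u w z = 0
  torsion_v : ∀ x : M, ∃ a b c : ℝ, ∀ u w : TangentSpace (𝓡 5) x, S.θ x u = 0 → S.θ x w = 0 →
    (S.g x (torsion cov (S.v x) u) w - S.g x u (torsion cov (S.v x) w)) / 2 =
      a * S.om x u w + b * S.al x u w + c * S.be x u w

variable (cov : Connection M)

/-- `∇_H σ`, the covariant derivative in the directions of `H`. -/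
def nablaH (σ : Tensor2 M) : Tensor3 M := fun x u w z => covD2 cov σ x (S.πH u) w z

/-- The formal adjoint `∇_H^* τ = - ∑ᵢ (∇_{eᵢ} τ)(eᵢ, ·)`, for sections `τ` of `H* ⊗ Λ²H*`. -/
def nablaHadj (τ : Tensor3 M) : Tensor2 M := fun x w z =>
  -∑ i, covD3 cov τ x (S.frame x i) (S.frame x i) w z

/-- `R^H(u, w, z, t) = g(R(u, w) z, t)`, the curvature tensor restricted to `H`. -/
def RH : Tensor4 M := fun x u w z t =>
  S.g x (curvature cov (S.πH u) (S.πH w) (S.πH z)) (S.πH t)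

/-- The algebraic curvature tensor part `C^H = π_s(R^H) - b(π_s(R^H))`. -/
def CH : Tensor4 M := fun x a b c d =>
  pairSymm (S.RH cov x) a b c d - bianchi (pairSymm (S.RH cov x)) a b c d

/-- The Ricci contraction `r_H(u, w) = ∑ᵢ C^H(eᵢ, u, w, eᵢ)`. -/
def ricH : Tensor2 M := fun x u w => ∑ i, S.CH cov x (S.frame x i) u w (S.frame x i)

/-- The scalar curvature `s_H = tr r_H`. -/
def scalH (x : M) : ℝ := ∑ i, S.ricH cov x (S.frame x i) (S.frame x i)

/-- The Weyl tensor `W^H`, the trace-free part of `C^H`. -/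
def WH : Tensor4 M := fun x a b c d =>
  S.CH cov x a b c d - kulkarniNomizu (S.ricH cov x) (S.gH x) a b c d / 2
    + S.scalH cov x / 12 * kulkarniNomizu (S.gH x) (S.gH x) a b c d

/-- The component `(W^H)⁻` of `W^H` in `Λ⁻_H ⊗ Λ⁻_H`. -/
def WHminus : Tensor4 M := fun x a b c d =>
  S.asdPart x (fun a' b' => S.asdPart x (fun c' d' => S.WH cov x a' b' c' d') c d) a b

/-- The operator `ε^m ι^n` on `2`-forms on `H` (contraction with `e_n` followed by the wedge
product with `e^m`), at the point `x`. -/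
def epsIota (x : M) (m n : Fin 4) (B : TangentSpace (𝓡 5) x → TangentSpace (𝓡 5) x → ℝ)
    (u w : TangentSpace (𝓡 5) x) : ℝ :=
  S.gH x (S.frame x m) u * B (S.frame x n) w - S.gH x (S.frame x m) w * B (S.frame x n) u

/-- The endomorphism `∑ R_{klmn} ε^k ι^l ε^m ι^n` of `2`-forms on `H`, for a `4`-tensor `R`. -/
def curvAction (R : Tensor4 M) (σ : Tensor2 M) : Tensor2 M := fun x u w =>
  ∑ k, ∑ l, ∑ m, ∑ n, R x (S.frame x k) (S.frame x l) (S.frame x m) (S.frame x n) *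
    S.epsIota x k l (S.epsIota x m n (σ x)) u w

end ContactHyperkahler

end ContactGeom

end

/-!
The formula compares two contractions of the second covariant derivative `∇²σ` of an
anti-self-dual form `σ`. Since `ω, α, β` and `g` are parallel, `∇` preserves `Λ⁻_H`
(`IsDistinguished.isAsd_covD2`); since the torsion of two horizontal vectors is a multiple of the
Reeb field `v` (`IsDistinguished.torsion_of_mem`), torsion does not enter horizontal exterior
derivatives. Hence on anti-self-dual forms `d_H^*` is minus the divergence
(`IsDistinguished.dHadj_eq`). As covariant derivatives commute with contractions
(`IsDistinguished.covD1_contraction`), `d_H d_H^* σ` is an alternated contraction of `∇²σ`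
(`IsDistinguished.dH1_dHadj`), while `∇_H^* ∇_H σ` is minus its trace
(`IsDistinguished.nablaHadj_nablaH`).

In a frame `e, Ie, Je, Ke` of `H` an anti-self-dual form has three components, and the projection
of `2 d_H d_H^* σ` to `Λ⁻_H` minus `∇_H^* ∇_H σ` only contains commutators of second derivatives.
The Ricci identity (`ricci_identity`, `IsDistinguished.ricci_frame`) turns these into curvature
terms, and into multiples of `ω(X, Y) ∇_v σ`, which cancel because `ω` is self-dual. The curvature
is anti-self-dual in its second pair of arguments, `ω, α, β` being parallel
(`IsDistinguished.isAsd_curvature`), but it is not symmetric under exchange of pairs: the first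
Bianchi identity has the right-hand side `ω(X, Y) g(T_v Z, W)` plus cyclic permutations
(`IsDistinguished.bianchi_H`). Comparing the curvature with its algebraic part `C^H` therefore
leaves a multiple of one trace of `T_v`, and that trace is `f`, because `ℒ_v α` is obtained from
`α` by the action of `T_v` (`IsDistinguished.f_eq`). That `T_v` preserves `ω`
(`IsDistinguished.om_torsion_v`) removes the other components. What remains is an identity between
matrices, `weitzenbock_matrix`.

Both sides are defined with an arbitrary orthonormal frame of `H`, and the components refer to a
quaternionic one. The two agree because contractions of horizontal tensors do not depend on the
frame (`HyperkahlerSpace.IsFrame.ric_eq`, `HyperkahlerSpace.weylAsd_quat`,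
`HyperkahlerSpace.IsFrame.act_frame`). Derivatives of tensors are computed on global vector fields
that extend given tangent vectors (`gext`, built with bump functions); tensoriality makes the
choice of the extension immaterial.
-/

noncomputable section

namespace ContactGeom

open Bundle Filter Topology VectorField

/-! ### Smooth functions, vector fields and connections -/

section Calculus

variable {M : Type*} [TopologicalSpace M] [ChartedSpace (EuclideanSpace ℝ (Fin 5)) M]

/-- Smooth real functions on `M`. -/
abbrev SmoothFun (h : M → ℝ) : Prop := ContMDiff (𝓡 5) 𝓘(ℝ, ℝ) ∞ h

/-- Differentiability of a real function at a point. -/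
abbrev DiffFunAt (h : M → ℝ) (x : M) : Prop := MDifferentiableAt (𝓡 5) 𝓘(ℝ, ℝ) h x

lemma SmoothFun.diffAt {h : M → ℝ} (hh : SmoothFun h) (x : M) : DiffFunAt h x :=
  hh.contMDiffAt.mdifferentiableAt (by simp)

section Dir
variable {x : M} (u : TangentSpace (𝓡 5) x) {h k : M → ℝ}

lemma dirD_add (hh : DiffFunAt h x) (hk : DiffFunAt k x) :
    dirD (fun y => h y + k y) u = dirD h u + dirD k u := by
  simp [dirD, mvfderiv_fun_add hh hk]

lemma dirD_sub (hh : DiffFunAt h x) (hk : DiffFunAt k x) :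
    dirD (fun y => h y - k y) u = dirD h u - dirD k u := by
  simp [dirD, mvfderiv_fun_sub hh hk]

lemma dirD_neg : dirD (fun y => - h y) u = - dirD h u := by
  simp [dirD, mvfderiv_fun_neg]

lemma dirD_mul (hh : DiffFunAt h x) (hk : DiffFunAt k x) :
    dirD (fun y => h y * k y) u = h x * dirD k u + k x * dirD h u := by
  simp [dirD, mvfderiv_fun_mul hh hk]

lemma dirD_const (c : ℝ) : dirD (fun _ : M => c) u = 0 := by
  simp [dirD, mvfderiv_const]

lemma dirD_congr (hk : h =ᶠ[𝓝 x] k) : dirD h u = dirD k u := by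
  simp only [dirD, mvfderiv]
  rw [hk.mfderiv_eq]
  rfl

lemma dirD_sum {ι : Type} (s : Finset ι) {f : ι → M → ℝ} (hf : ∀ i ∈ s, DiffFunAt (f i) x) :
    dirD (fun y => ∑ i ∈ s, f i y) u = ∑ i ∈ s, dirD (f i) u := by
  classical
  induction s using Finset.induction_on with
  | empty => simp [dirD_const]
  | insert a s ha ih =>
    simp only [Finset.sum_insert ha]
    have h1 : DiffFunAt (fun y => ∑ i ∈ s, f i y) x := by
      have := MDifferentiableAt.sum (I := 𝓡 5) (t := s) (f := f) (z := x)
        (fun i hi => hf i (Finset.mem_insert_of_mem hi))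
      simpa [DiffFunAt, Finset.sum_fn] using this
    rw [dirD_add u (hf a (Finset.mem_insert_self _ _)) h1,
      ih (fun i hi => hf i (Finset.mem_insert_of_mem hi))]

end Dir

lemma dirD_add_vec (h : M → ℝ) {x : M} (u w : TangentSpace (𝓡 5) x) :
    dirD h (u + w) = dirD h u + dirD h w := by simp [dirD]

lemma dirD_smul_vec (h : M → ℝ) {x : M} (c : ℝ) (u : TangentSpace (𝓡 5) x) :
    dirD h (c • u) = c * dirD h u := by simp [dirD]

variable [IsManifold (𝓡 5) ∞ M]

/-- The regularity that the calculus of Lie brackets asks for; over `ℝ`, `minSmoothness ℝ n` is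
`n`. -/
scoped instance : IsManifold (𝓡 5) (minSmoothness ℝ 2) M := by
  rw [minSmoothness_of_isRCLikeNormedField]; infer_instance

scoped instance : IsManifold (𝓡 5) (minSmoothness ℝ 3) M := by
  rw [minSmoothness_of_isRCLikeNormedField]; infer_instance

lemma SmoothField.diffAt {X : VField M} (hX : SmoothField X) (x : M) : DiffFieldAt X x :=
  (hX x).mdifferentiableAt (by simp)

lemma SmoothField.add {X Y : VField M} (hX : SmoothField X) (hY : SmoothField Y) :
    SmoothField (fun y => X y + Y y) := fun x => ContMDiffAt.add_section (hX x) (hY x)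

lemma SmoothField.sub {X Y : VField M} (hX : SmoothField X) (hY : SmoothField Y) :
    SmoothField (fun y => X y - Y y) := fun x => ContMDiffAt.sub_section (hX x) (hY x)

lemma SmoothField.smul {h : M → ℝ} {X : VField M} (hh : SmoothFun h) (hX : SmoothField X) :
    SmoothField (fun y => h y • X y) := fun x => ContMDiffAt.smul_section (hh x) (hX x)

lemma SmoothField.bracket {X Y : VField M} (hX : SmoothField X) (hY : SmoothField Y) :
    SmoothField (bracket X Y) := fun x => by
  have : IsManifold (𝓡 5) ((∞ : ℕ∞ω) + 1) M := by simpa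
  have := ContMDiffAt.mlieBracket_vectorField (m := ⊤) (n := ⊤) (hX x) (hY x) (by simp)
  exact this

lemma smoothFun_dirD {h : M → ℝ} {X : VField M} (hh : SmoothFun h) (hX : SmoothField X) :
    SmoothFun (fun y => dirD h (X y)) := by
  have h1 := (hh.contMDiff_tangentMap (m := ∞) (by simp)).comp hX
  exact (contMDiff_snd_tangentBundle_modelSpace ℝ 𝓘(ℝ, ℝ)).comp h1

lemma SmoothField.cov {cov : Connection M} [CovariantDerivative.ContMDiffCovariantDerivative cov ∞]
    {X Y : VField M} (hX : SmoothField X) (hY : SmoothField Y) :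
    SmoothField (fun y => cov Y y (X y)) := fun x => by
  have := (CovariantDerivative.ContMDiffCovariantDerivative.contMDiff
    (cov := cov) (k := ∞)).contMDiff (σ := Y) (by simpa using hY.contMDiffOn)
  rw [contMDiffOn_univ] at this
  exact (this x).clm_bundle_apply (hX x)

end Calculus

/-! ### Global extensions of tangent vectors -/

section Extend

variable {M : Type*} [TopologicalSpace M] [ChartedSpace (EuclideanSpace ℝ (Fin 5)) M]
  [IsManifold (𝓡 5) ∞ M]

/-- A vector field that is smooth near `x` agrees near `x` with a globally smooth one. -/
lemma exists_smoothField_eventuallyEq [T2Space M] {x : M} {W : VField M}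
    (hW : ∀ᶠ y in 𝓝 x, ContMDiffAt (𝓡 5) (𝓡 5).tangent ∞
      (fun y => (⟨y, W y⟩ : TangentBundle (𝓡 5) M)) y) :
    ∃ W' : VField M, SmoothField W' ∧ ∀ᶠ y in 𝓝 x, W' y = W y := by
  obtain ⟨χ, -, hχ⟩ := (SmoothBumpFunction.nhds_basis_tsupport (I := 𝓡 5) x).mem_iff.1 hW
  refine ⟨fun y => χ y • W y, fun y => ?_, ?_⟩
  · by_cases hy : y ∈ tsupport χ
    · exact ContMDiffAt.smul_section χ.contMDiff.contMDiffAt (hχ hy)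
    · have h0 : ∀ᶠ z in 𝓝 y, χ z • W z = 0 := by
        filter_upwards [(isClosed_tsupport χ).isOpen_compl.mem_nhds hy] with z hz
        rw [image_eq_zero_of_notMem_tsupport hz, zero_smul]
      have := (Bundle.contMDiff_zeroSection ℝ (TangentSpace (𝓡 5) : M → Type _)
        (n := ∞) (IB := 𝓡 5) (F := EuclideanSpace ℝ (Fin 5))).contMDiffAt (x := y)
      refine this.congr_of_eventuallyEq ?_
      filter_upwards [h0] with z hz
      simp only [hz]; rfl
  · filter_upwards [χ.eventuallyEq_one] with y hy
    simp [hy]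

/-- A bump function at `x`. -/
def bumpAt (x : M) : SmoothBumpFunction (𝓡 5) x := Classical.arbitrary _

/-- A globally smooth extension of a tangent vector, linear in the vector: `ext u` multiplied by
a bump function at the base point. -/
def gext {x : M} (u : TangentSpace (𝓡 5) x) : VField M :=
  fun y => (bumpAt x) y • ext u y

lemma gext_eventuallyEq {x : M} (u : TangentSpace (𝓡 5) x) : ∀ᶠ y in 𝓝 x, gext u y = ext u y := by
  filter_upwards [(bumpAt x).eventuallyEq_one] with y hy
  simp [gext, hy]

@[simp] lemma ext_self {x : M} (u : TangentSpace (𝓡 5) x) : ext u x = u :=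
  FiberBundle.extend_apply_self _ u

@[simp] lemma gext_self {x : M} (u : TangentSpace (𝓡 5) x) : gext u x = u := by
  rw [(gext_eventuallyEq u).self_of_nhds, ext_self]

lemma contMDiffAt_ext {x y : M} (u : TangentSpace (𝓡 5) x)
    (hy : y ∈ (chartAt (EuclideanSpace ℝ (Fin 5)) x).source) :
    ContMDiffAt (𝓡 5) (𝓡 5).tangent ∞ (fun y => (⟨y, ext u y⟩ : TangentBundle (𝓡 5) M)) y := by
  set t := trivializationAt (EuclideanSpace ℝ (Fin 5)) (TangentSpace (𝓡 5) : M → Type _) x with ht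
  have hyt : y ∈ t.baseSet := by simpa [ht] using hy
  have hs : ContMDiffOn (𝓡 5) 𝓘(ℝ, EuclideanSpace ℝ (Fin 5)) ∞
      (fun z => (t ⟨z, ext u z⟩).2) t.baseSet :=
    (contMDiffOn_const (c := (t ⟨x, u⟩).2)).congr
      (fun z hz => by
        simp only [ext, FiberBundle.extend]
        rw [← ht, t.apply_mk_symm hz])
  rw [t.contMDiffAt_section_iff hyt]
  exact hs.contMDiffAt (t.open_baseSet.mem_nhds hyt)

lemma smoothField_gext [T2Space M] {x : M} (u : TangentSpace (𝓡 5) x) :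
    SmoothField (gext u) := fun y => by
  set χ := (bumpAt x) with hχ
  by_cases hy : y ∈ tsupport χ
  · exact ContMDiffAt.smul_section χ.contMDiff.contMDiffAt
      (contMDiffAt_ext u (χ.tsupport_subset_chartAt_source hy))
  · have h0 : ∀ᶠ z in 𝓝 y, gext u z = 0 := by
      filter_upwards [(isClosed_tsupport χ).isOpen_compl.mem_nhds hy] with z hz
      rw [gext, ← hχ, image_eq_zero_of_notMem_tsupport hz, zero_smul]
    have := (Bundle.contMDiff_zeroSection ℝ (TangentSpace (𝓡 5) : M → Type _)
      (n := ∞) (IB := 𝓡 5) (F := EuclideanSpace ℝ (Fin 5))).contMDiffAt (x := y)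
    refine this.congr_of_eventuallyEq ?_
    filter_upwards [h0] with z hz
    simp only [hz]; rfl

lemma ext_diffAt {x : M} (u : TangentSpace (𝓡 5) x) : DiffFieldAt (ext u) x :=
  FiberBundle.mdifferentiableAt_extend _ _ u

lemma gext_add [T2Space M] {x : M} (u w : TangentSpace (𝓡 5) x) :
    gext (u + w) = gext u + gext w := by
  funext y
  set χ := bumpAt x with hχ
  by_cases hy : y ∈ tsupport χ
  · set t := trivializationAt (EuclideanSpace ℝ (Fin 5)) (TangentSpace (𝓡 5) : M → Type _) x with ht
    have hx : x ∈ t.baseSet := FiberBundle.mem_baseSet_trivializationAt' x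
    have hyt : y ∈ t.baseSet := by
      simpa [ht] using χ.tsupport_subset_chartAt_source hy
    simp only [gext, ext, FiberBundle.extend, Pi.add_apply]
    rw [← ht, show (t ⟨x, u + w⟩).2 = (t ⟨x, u⟩).2 + (t ⟨x, w⟩).2 from (t.linear ℝ hx).map_add u w]
    simp only [← t.symmₗ_apply (R := ℝ) hyt, map_add, smul_add]
  · simp [gext, ← hχ, image_eq_zero_of_notMem_tsupport hy]

lemma gext_smul [T2Space M] {x : M} (c : ℝ) (u : TangentSpace (𝓡 5) x) :
    gext (c • u) = fun y => c • gext u y := by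
  funext y
  set χ := bumpAt x with hχ
  by_cases hy : y ∈ tsupport χ
  · set t := trivializationAt (EuclideanSpace ℝ (Fin 5)) (TangentSpace (𝓡 5) : M → Type _) x with ht
    have hx : x ∈ t.baseSet := FiberBundle.mem_baseSet_trivializationAt' x
    have hyt : y ∈ t.baseSet := by
      simpa [ht] using χ.tsupport_subset_chartAt_source hy
    simp only [gext, ext, FiberBundle.extend]
    rw [← ht, show (t ⟨x, c • u⟩).2 = c • (t ⟨x, u⟩).2 from (t.linear ℝ hx).map_smul c u]
    simp only [← t.symmₗ_apply (R := ℝ) hyt, map_smul, smul_comm c]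
  · simp [gext, ← hχ, image_eq_zero_of_notMem_tsupport hy]

end Extend

/-! ### Smooth covariant tensors -/

section TensorFields

variable {M : Type*} [TopologicalSpace M] [ChartedSpace (EuclideanSpace ℝ (Fin 5)) M]
  [IsManifold (𝓡 5) ∞ M]

/-- Smooth `1`-forms: pointwise linear, smooth on smooth vector fields. -/
structure IsTensor1 (η : Tensor1 M) : Prop where
  add : ∀ x u w, η x (u + w) = η x u + η x w
  smul : ∀ x (c : ℝ) u, η x (c • u) = c * η x u
  smooth : ∀ X : VField M, SmoothField X → SmoothFun (fun y => η y (X y))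

/-- Smooth covariant `2`-tensors: each slot is a smooth `1`-form once the other one is filled with
a smooth vector field. -/
structure IsTensor2 (η : Tensor2 M) : Prop where
  left : ∀ W : VField M, SmoothField W → IsTensor1 (fun y u => η y u (W y))
  right : ∀ W : VField M, SmoothField W → IsTensor1 (fun y u => η y (W y) u)

/-- Smooth covariant `3`-tensors: each slot is a smooth `1`-form once the other ones are filled
with smooth vector fields. -/
structure IsTensor3 (τ : Tensor3 M) : Prop where
  fst : ∀ W Z : VField M, SmoothField W → SmoothField Z → IsTensor1 (fun y u => τ y u (W y) (Z y))
  snd : ∀ W Z : VField M, SmoothField W → SmoothField Z → IsTensor1 (fun y u => τ y (W y) u (Z y))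
  trd : ∀ W Z : VField M, SmoothField W → SmoothField Z → IsTensor1 (fun y u => τ y (W y) (Z y) u)

namespace IsTensor1

variable {η : Tensor1 M}

lemma zero (hη : IsTensor1 η) (x : M) : η x 0 = 0 := by simpa using hη.smul x 0 0

lemma neg (hη : IsTensor1 η) (x : M) (u : TangentSpace (𝓡 5) x) : η x (-u) = -η x u := by
  simpa using hη.smul x (-1) u

lemma sub (hη : IsTensor1 η) (x : M) (u w : TangentSpace (𝓡 5) x) :
    η x (u - w) = η x u - η x w := by
  rw [sub_eq_add_neg, hη.add, hη.neg, sub_eq_add_neg]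

lemma sum (hη : IsTensor1 η) (x : M) {ι : Type*} (s : Finset ι) (f : ι → TangentSpace (𝓡 5) x) :
    η x (∑ i ∈ s, f i) = ∑ i ∈ s, η x (f i) := by
  classical
  induction s using Finset.induction_on with
  | empty => simp [hη.zero]
  | insert a s ha ih => rw [Finset.sum_insert ha, Finset.sum_insert ha, hη.add, ih]

/-- A smooth `1`-form is differentiable on vector fields that are merely differentiable at a point:
expand the field in a local frame. -/
lemma diffAt (hη : IsTensor1 η) [T2Space M] {x : M} {W : VField M} (hW : DiffFieldAt W x) :
    DiffFunAt (fun y => η y (W y)) x := by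
  let t := trivializationAt (EuclideanSpace ℝ (Fin 5)) (TangentSpace (𝓡 5) : M → Type _) x
  have hx : x ∈ t.baseSet := FiberBundle.mem_baseSet_trivializationAt' x
  let b := Module.Basis.ofVectorSpace ℝ (EuclideanSpace ℝ (Fin 5))
  have hs (i) : ∃ W' : VField M, SmoothField W' ∧ ∀ᶠ y in 𝓝 x, W' y = t.localFrame b i y :=
    exists_smoothField_eventuallyEq (by
      filter_upwards [t.open_baseSet.mem_nhds hx] with y hy
      exact contMDiffAt_localFrame_of_mem ∞ _ b i hy)
  choose S hS hSs using hs
  have hc (i) : DiffFunAt (fun y => t.localFrameCoeff (𝓡 5) b i y (W y)) x :=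
    mdifferentiableAt_localFrameCoeff b hx hW i
  have hsum : DiffFunAt
      (∑ i, fun y => t.localFrameCoeff (𝓡 5) b i y (W y) * η y (S i y)) x :=
    MDifferentiableAt.sum fun i _ => (hc i).mul ((hη.smooth (S i) (hS i)).diffAt x)
  refine hsum.congr_of_eventuallyEq ?_
  filter_upwards [t.eventually_eq_localFrame_sum_coeff_smul (I := 𝓡 5) b hx (s := W),
    eventually_all.2 hSs] with y hy hy'
  rw [hy, hη.sum, Finset.sum_apply]
  exact Finset.sum_congr rfl fun i _ => by rw [hη.smul, hy' i]

lemma tensorialAt_covD (hη : IsTensor1 η) [T2Space M] (cov : Connection M) {x : M}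
    (u : TangentSpace (𝓡 5) x) : TensorialAt (𝓡 5) (EuclideanSpace ℝ (Fin 5))
      (fun W : VField M => dirD (fun y => η y (W y)) u - η x (cov W x u)) x where
  smul {f W} hf hW := by
    have h1 : dirD (fun y => η y ((f • W) y)) u = f x * dirD (fun y => η y (W y)) u
        + η x (W x) * dirD f u := by
      rw [← dirD_mul u hf (hη.diffAt hW)]
      exact congrArg (fun k => dirD k u) (funext fun y => hη.smul y (f y) (W y))
    rw [h1, cov.isCovariantDerivativeOnUniv.leibniz hW hf]
    simp [hη.add, hη.smul, dirD]
    ring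
  add {W W'} hW hW' := by
    have h1 : dirD (fun y => η y ((W + W') y)) u = dirD (fun y => η y (W y)) u
        + dirD (fun y => η y (W' y)) u := by
      rw [← dirD_add u (hη.diffAt hW) (hη.diffAt hW')]
      exact congrArg (fun k => dirD k u) (funext fun y => hη.add y (W y) (W' y))
    rw [h1, cov.isCovariantDerivativeOnUniv.add hW hW']
    simp [hη.add]
    ring

/-- The covariant derivative of a `1`-form does not depend on the extension used. -/
lemma covD_pointwise (hη : IsTensor1 η) [T2Space M] (cov : Connection M) {x : M}
    (u : TangentSpace (𝓡 5) x) {W W' : VField M} (hW : DiffFieldAt W x) (hW' : DiffFieldAt W' x)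
    (h : W x = W' x) :
    dirD (fun y => η y (W y)) u - η x (cov W x u) =
      dirD (fun y => η y (W' y)) u - η x (cov W' x u) :=
  (hη.tensorialAt_covD cov u).pointwise hW hW' h

end IsTensor1

/-- The covariant derivative of a `1`-form: `covD1 cov η x u w = (∇_u η)(w)`. -/
def covD1 (cov : Connection M) (η : Tensor1 M) : Tensor2 M := fun x u w =>
  dirD (fun y => η y (ext w y)) u - η x (cov (ext w) x u)

lemma covD1_eq [T2Space M] (cov : Connection M) {η : Tensor1 M} (hη : IsTensor1 η) {x : M}
    (u : TangentSpace (𝓡 5) x) {W : VField M} (hW : DiffFieldAt W x) :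
    covD1 cov η x u (W x) = dirD (fun y => η y (W y)) u - η x (cov W x u) :=
  hη.covD_pointwise cov u (ext_diffAt _) hW (ext_self _)

lemma cov_congr (cov : Connection M) {x : M} {W W' : VField M} (hW : DiffFieldAt W x)
    (h : ∀ᶠ y in 𝓝 x, W' y = W y) : cov W' x = cov W x := by
  have hW' : DiffFieldAt W' x := by
    refine MDifferentiableAt.congr_of_eventuallyEq hW ?_
    filter_upwards [h] with y hy
    rw [hy]
  exact cov.isCovariantDerivativeOnUniv.congr_of_eventuallyEq hW' hW univ_mem h

lemma cov_ext [T2Space M] (cov : Connection M) {x : M} (w : TangentSpace (𝓡 5) x) :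
    cov (ext w) x = cov (gext w) x :=
  cov_congr cov ((smoothField_gext w).diffAt x)
    ((gext_eventuallyEq w).mono fun _ h => h.symm)

lemma bracket_ext {x : M} (u w : TangentSpace (𝓡 5) x) :
    bracket (ext u) (ext w) x = bracket (gext u) (gext w) x :=
  Filter.EventuallyEq.mlieBracket_vectorField_eq
    ((gext_eventuallyEq u).mono fun _ h => h.symm) ((gext_eventuallyEq w).mono fun _ h => h.symm)

lemma torsion_eq (cov : Connection M) {x : M} (u w : TangentSpace (𝓡 5) x) :
    torsion cov u w = CovariantDerivative.torsion cov x u w := by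
  rw [CovariantDerivative.torsion_apply_eq_extend, FiberBundle.extend_apply_self,
    FiberBundle.extend_apply_self]
  rfl

/-- Torsion may be computed with any differentiable vector fields. -/
lemma bracket_eq (cov : Connection M) {x : M} {X Y : VField M} (hX : DiffFieldAt X x)
    (hY : DiffFieldAt Y x) :
    bracket X Y x = cov Y x (X x) - cov X x (Y x) - torsion cov (X x) (Y x) := by
  rw [torsion_eq, CovariantDerivative.torsion_apply cov hX hY, bracket]
  abel

/-- The exterior derivative is the alternation of the covariant derivative, up to torsion. -/
lemma extD1_eq (cov : Connection M) {x : M} {η : Tensor1 M} (hη : IsTensor1 η)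
    (u w : TangentSpace (𝓡 5) x) :
    extD1 η x u w = covD1 cov η x u w - covD1 cov η x w u + η x (torsion cov u w) := by
  simp only [extD1, covD1, torsion, hη.sub]
  ring

namespace IsTensor2
variable {η : Tensor2 M}

lemma smooth (hη : IsTensor2 η) {X Y : VField M} (hX : SmoothField X) (hY : SmoothField Y) :
    SmoothFun (fun y => η y (X y) (Y y)) := (hη.left Y hY).smooth X hX

variable [T2Space M]

lemma add_left (hη : IsTensor2 η) (x : M) (u u' w : TangentSpace (𝓡 5) x) :
    η x (u + u') w = η x u w + η x u' w := by
  simpa using (hη.left _ (smoothField_gext w)).add x u u'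

lemma add_right (hη : IsTensor2 η) (x : M) (w u u' : TangentSpace (𝓡 5) x) :
    η x w (u + u') = η x w u + η x w u' := by
  simpa using (hη.right _ (smoothField_gext w)).add x u u'

lemma smul_left (hη : IsTensor2 η) (x : M) (c : ℝ) (u w : TangentSpace (𝓡 5) x) :
    η x (c • u) w = c * η x u w := by
  simpa using (hη.left _ (smoothField_gext w)).smul x c u

lemma smul_right (hη : IsTensor2 η) (x : M) (c : ℝ) (w u : TangentSpace (𝓡 5) x) :
    η x w (c • u) = c * η x w u := by
  simpa using (hη.right _ (smoothField_gext w)).smul x c u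

lemma sub_left (hη : IsTensor2 η) (x : M) (u u' w : TangentSpace (𝓡 5) x) :
    η x (u - u') w = η x u w - η x u' w := by
  simpa using (hη.left _ (smoothField_gext w)).sub x u u'

lemma sub_right (hη : IsTensor2 η) (x : M) (w u u' : TangentSpace (𝓡 5) x) :
    η x w (u - u') = η x w u - η x w u' := by
  simpa using (hη.right _ (smoothField_gext w)).sub x u u'

/-- The covariant derivative of a `2`-tensor may be computed with any smooth vector fields. -/
lemma covD2_eq (hη : IsTensor2 η) (cov : Connection M) {x : M} (u : TangentSpace (𝓡 5) x)
    {W Z : VField M} (hW : SmoothField W) (hZ : SmoothField Z) :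
    covD2 cov η x u (W x) (Z x) =
      dirD (fun y => η y (W y) (Z y)) u - η x (cov W x u) (Z x) - η x (W x) (cov Z x u) := by
  have h1 := (hη.left _ (smoothField_gext (Z x))).covD_pointwise cov u
    ((smoothField_gext (W x)).diffAt x) (hW.diffAt x) (gext_self _)
  have h2 := (hη.right _ hW).covD_pointwise cov u
    ((smoothField_gext (Z x)).diffAt x) (hZ.diffAt x) (gext_self _)
  rw [covD2, dirD_congr u (k := fun y => η y (gext (W x) y) (gext (Z x) y)), cov_ext, cov_ext]
  · simp only [gext_self] at h1 h2
    linarith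
  · filter_upwards [gext_eventuallyEq (W x), gext_eventuallyEq (Z x)] with y h h'
    rw [h, h']

end IsTensor2

end TensorFields

/-! ### Covariant derivatives of tensors -/

section SecondOrder

variable {M : Type*} [TopologicalSpace M] [ChartedSpace (EuclideanSpace ℝ (Fin 5)) M]
  [IsManifold (𝓡 5) ∞ M] [T2Space M]

/-- Vector fields act on smooth functions with `[X, Y] h = X (Y h) - Y (X h)`. This follows from
the Jacobi identity for `X`, `Y` and `h Z`, where `Z` does not vanish at the point. -/
lemma dirD_bracket {X Y : VField M} (hX : SmoothField X) (hY : SmoothField Y) {h : M → ℝ}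
    (hh : SmoothFun h) (x : M) :
    dirD h (bracket X Y x) =
      dirD (fun y => dirD h (Y y)) (X x) - dirD (fun y => dirD h (X y)) (Y x) := by
  obtain ⟨z, hz⟩ : ∃ z : TangentSpace (𝓡 5) x, z ≠ 0 :=
    exists_ne (α := EuclideanSpace ℝ (Fin 5)) 0
  set Z := gext z
  have hZ : SmoothField Z := smoothField_gext z
  have key {A : VField M} (hA : SmoothField A) {k : M → ℝ} (hk : SmoothFun k) {B : VField M}
      (hB : SmoothField B) : bracket A (fun y => k y • B y) =
      fun y => dirD k (A y) • B y + k y • bracket A B y := by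
    funext y
    exact mlieBracket_smul_right (hk.diffAt y) (hB.diffAt y)
  have key2 {A B C : VField M} (hB : SmoothField B) (hC : SmoothField C) (y : M) :
      bracket A (fun y => B y + C y) y = bracket A B y + bracket A C y :=
    mlieBracket_add_right (hB.diffAt y) (hC.diffAt y)
  have sb {A B : VField M} (hA : SmoothField A) (hB : SmoothField B) := hA.bracket hB
  have sd {A : VField M} (hA : SmoothField A) : SmoothFun (fun y => dirD h (A y)) :=
    smoothFun_dirD hh hA
  have h2 : minSmoothness ℝ 2 ≤ (∞ : ℕ∞ω) := by
    simpa using ENat.LEInfty.out (m := (2 : ℕ∞ω))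
  have J (W : VField M) (hW : SmoothField W) : bracket X (bracket Y W) x =
      bracket (bracket X Y) W x + bracket Y (bracket X W) x :=
    leibniz_identity_mlieBracket_apply ((hX x).of_le h2) ((hY x).of_le h2) ((hW x).of_le h2)
  have e1 := J (fun y => h y • Z y) (SmoothField.smul hh hZ)
  have e2 := J Z hZ
  rw [key hY hh hZ, key hX hh hZ, key (sb hX hY) hh hZ,
    key2 (SmoothField.smul (sd hY) hZ) (SmoothField.smul hh (sb hY hZ)),
    key2 (SmoothField.smul (sd hX) hZ) (SmoothField.smul hh (sb hX hZ)),
    key hX (sd hY) hZ, key hX hh (sb hY hZ), key hY (sd hX) hZ, key hY hh (sb hX hZ)] at e1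
  beta_reduce at e1
  rw [e2] at e1
  have e3 : (dirD (fun y => dirD h (Y y)) (X x) - dirD (fun y => dirD h (X y)) (Y x)
      - dirD h (bracket X Y x)) • Z x = 0 := by
    rw [← sub_eq_zero.2 e1]
    module
  have hz' : Z x ≠ 0 := by simpa [Z] using hz
  have := (smul_eq_zero.1 e3).resolve_right hz'
  linarith

/-- The curvature, computed with globally smooth extensions. -/
lemma curvature_eq (cov : Connection M) [CovariantDerivative.ContMDiffCovariantDerivative cov ∞]
    {x : M} (u w z : TangentSpace (𝓡 5) x) :
    curvature cov u w z = cov (fun y => cov (gext z) y (gext w y)) x u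
      - cov (fun y => cov (gext z) y (gext u y)) x w
      - cov (gext z) x (bracket (gext u) (gext w) x) := by
  have h (w : TangentSpace (𝓡 5) x) : cov (fun y => cov (ext z) y (ext w y)) x =
      cov (fun y => cov (gext z) y (gext w y)) x := by
    refine cov_congr cov (((smoothField_gext w).cov (smoothField_gext z)).diffAt x) ?_
    filter_upwards [gext_eventuallyEq w, (gext_eventuallyEq z).eventually_nhds] with y hy hy'
    rw [hy, cov_congr cov ((smoothField_gext z).diffAt y) (hy'.mono fun _ h => h.symm)]
  rw [curvature, h, h, cov_ext, bracket_ext]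

section Linear
variable (cov : Connection M)

lemma covD1_add {η : Tensor1 M} (hη : IsTensor1 η) {x : M} (u w w' : TangentSpace (𝓡 5) x) :
    covD1 cov η x u (w + w') = covD1 cov η x u w + covD1 cov η x u w' := by
  have h (w : TangentSpace (𝓡 5) x) := covD1_eq cov hη u ((smoothField_gext w).diffAt x)
  have := h (w + w')
  rw [gext_self] at this
  rw [this, ← gext_self w, ← gext_self w', h, h, gext_self, gext_self, gext_add,
    cov.isCovariantDerivativeOnUniv.add ((smoothField_gext w).diffAt x)
      ((smoothField_gext w').diffAt x)]
  have e : (fun y => η y ((gext w + gext w') y)) =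
      fun y => η y (gext w y) + η y (gext w' y) := funext fun y => hη.add y _ _
  rw [e, dirD_add u ((hη.smooth _ (smoothField_gext w)).diffAt x)
    ((hη.smooth _ (smoothField_gext w')).diffAt x)]
  simp only [add_apply, hη.add]
  ring

lemma covD1_smul {η : Tensor1 M} (hη : IsTensor1 η) {x : M} (c : ℝ)
    (u w : TangentSpace (𝓡 5) x) : covD1 cov η x u (c • w) = c * covD1 cov η x u w := by
  have h (w : TangentSpace (𝓡 5) x) := covD1_eq cov hη u ((smoothField_gext w).diffAt x)
  have := h (c • w)
  rw [gext_self] at this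
  rw [this, ← gext_self w, h, gext_self, gext_smul]
  have e : (fun y => η y (c • gext w y)) = fun y => c * η y (gext w y) :=
    funext fun y => hη.smul y _ _
  have e2 : cov (fun y => c • gext w y) x = c • cov (gext w) x :=
    cov.isCovariantDerivativeOnUniv.smul_const c ((smoothField_gext w).diffAt x)
  rw [e, e2,
    dirD_mul u ((contMDiff_const (c := c)).contMDiffAt.mdifferentiableAt (n := ∞) (by simp))
      ((hη.smooth _ (smoothField_gext w)).diffAt x), dirD_const]
  simp only [smul_apply, hη.smul]
  ring

/-- The covariant derivative of a smooth `2`-tensor is a smooth `3`-tensor. -/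
lemma IsTensor2.covD2 [CovariantDerivative.ContMDiffCovariantDerivative cov ∞]
    {η : Tensor2 M} (hη : IsTensor2 η) : IsTensor3 (covD2 cov η) := by
  have hsm {A W Z : VField M} (hA : SmoothField A) (hW : SmoothField W) (hZ : SmoothField Z) :
      SmoothFun (fun y => ContactGeom.covD2 cov η y (A y) (W y) (Z y)) := by
    have : (fun y => ContactGeom.covD2 cov η y (A y) (W y) (Z y)) = fun y =>
        dirD (fun y => η y (W y) (Z y)) (A y) - η y (cov W y (A y)) (Z y)
          - η y (W y) (cov Z y (A y)) := funext fun y => hη.covD2_eq cov _ hW hZ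
    rw [this]
    exact ((smoothFun_dirD (hη.smooth hW hZ) hA).sub (hη.smooth (hA.cov hW) hZ)).sub
      (hη.smooth hW (hA.cov hZ))
  have e1 {x : M} (u w : TangentSpace (𝓡 5) x) {Z : VField M} (hZ : SmoothField Z) :
      ContactGeom.covD2 cov η x u w (Z x) =
        covD1 cov (fun y w => η y w (Z y)) x u w - η x w (cov Z x u) := by
    have h1 := covD1_eq cov (hη.left Z hZ) u ((smoothField_gext w).diffAt x)
    have h2 := hη.covD2_eq cov u (smoothField_gext w) hZ
    rw [gext_self] at h1 h2
    rw [h1, h2]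
  have e2 {x : M} (u z : TangentSpace (𝓡 5) x) {W : VField M} (hW : SmoothField W) :
      ContactGeom.covD2 cov η x u (W x) z =
        covD1 cov (fun y z => η y (W y) z) x u z - η x (cov W x u) z := by
    have h1 := covD1_eq cov (hη.right W hW) u ((smoothField_gext z).diffAt x)
    have h2 := hη.covD2_eq cov u hW (smoothField_gext z)
    rw [gext_self] at h1 h2
    rw [h1, h2]
    ring
  refine ⟨fun W Z hW hZ => ⟨fun x u w => ?_, fun x c u => ?_, fun X hX => hsm hX hW hZ⟩,
    fun A Z hA hZ => ⟨fun x u w => ?_, fun x c u => ?_, fun X hX => hsm hA hX hZ⟩,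
    fun A W hA hW => ⟨fun x u w => ?_, fun x c u => ?_, fun X hX => hsm hA hW hX⟩⟩
  · simp only [hη.covD2_eq cov _ hW hZ, dirD_add_vec, map_add, hη.add_left, hη.add_right]
    ring
  · simp only [hη.covD2_eq cov _ hW hZ, dirD_smul_vec, map_smul, hη.smul_left, hη.smul_right]
    ring
  · simp only [e1 _ _ hZ, covD1_add cov (hη.left Z hZ), hη.add_left]
    ring
  · simp only [e1 _ _ hZ, covD1_smul cov (hη.left Z hZ), hη.smul_left]
    ring
  · simp only [e2 _ _ hW, covD1_add cov (hη.right W hW), hη.add_right]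
    ring
  · simp only [e2 _ _ hW, covD1_smul cov (hη.right W hW), hη.smul_right]
    ring

end Linear
end SecondOrder

/-! ### Second covariant derivatives, the Ricci identity -/

section ThirdOrder

variable {M : Type*} [TopologicalSpace M] [ChartedSpace (EuclideanSpace ℝ (Fin 5)) M]
  [IsManifold (𝓡 5) ∞ M] [T2Space M]

namespace IsTensor3

variable {τ : Tensor3 M}

lemma add_fst (hτ : IsTensor3 τ) (x : M) (a a' w z : TangentSpace (𝓡 5) x) :
    τ x (a + a') w z = τ x a w z + τ x a' w z := by
  simpa using (hτ.fst _ _ (smoothField_gext w) (smoothField_gext z)).add x a a'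

lemma smul_fst (hτ : IsTensor3 τ) (x : M) (c : ℝ) (a w z : TangentSpace (𝓡 5) x) :
    τ x (c • a) w z = c * τ x a w z := by
  simpa using (hτ.fst _ _ (smoothField_gext w) (smoothField_gext z)).smul x c a

lemma sub_fst (hτ : IsTensor3 τ) (x : M) (a a' w z : TangentSpace (𝓡 5) x) :
    τ x (a - a') w z = τ x a w z - τ x a' w z := by
  simpa using (hτ.fst _ _ (smoothField_gext w) (smoothField_gext z)).sub x a a'

lemma add_snd (hτ : IsTensor3 τ) (x : M) (a w w' z : TangentSpace (𝓡 5) x) :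
    τ x a (w + w') z = τ x a w z + τ x a w' z := by
  simpa using (hτ.snd _ _ (smoothField_gext a) (smoothField_gext z)).add x w w'

lemma smul_snd (hτ : IsTensor3 τ) (x : M) (c : ℝ) (a w z : TangentSpace (𝓡 5) x) :
    τ x a (c • w) z = c * τ x a w z := by
  simpa using (hτ.snd _ _ (smoothField_gext a) (smoothField_gext z)).smul x c w

lemma add_trd (hτ : IsTensor3 τ) (x : M) (a w z z' : TangentSpace (𝓡 5) x) :
    τ x a w (z + z') = τ x a w z + τ x a w z' := by
  simpa using (hτ.trd _ _ (smoothField_gext a) (smoothField_gext w)).add x z z'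

lemma smul_trd (hτ : IsTensor3 τ) (x : M) (c : ℝ) (a w z : TangentSpace (𝓡 5) x) :
    τ x a w (c • z) = c * τ x a w z := by
  simpa using (hτ.trd _ _ (smoothField_gext a) (smoothField_gext w)).smul x c z

/-- The covariant derivative of a `3`-tensor may be computed with any smooth vector fields. -/
lemma covD3_eq (hτ : IsTensor3 τ) (cov : Connection M) {x : M} (u : TangentSpace (𝓡 5) x)
    {A W Z : VField M} (hA : SmoothField A) (hW : SmoothField W) (hZ : SmoothField Z) :
    covD3 cov τ x u (A x) (W x) (Z x) =
      dirD (fun y => τ y (A y) (W y) (Z y)) u - τ x (cov A x u) (W x) (Z x)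
        - τ x (A x) (cov W x u) (Z x) - τ x (A x) (W x) (cov Z x u) := by
  have hg (w : TangentSpace (𝓡 5) x) := smoothField_gext w
  have h1 := (hτ.fst _ _ (hg (W x)) (hg (Z x))).covD_pointwise cov u
    ((hg (A x)).diffAt x) (hA.diffAt x) (gext_self _)
  have h2 := (hτ.snd _ _ hA (hg (Z x))).covD_pointwise cov u
    ((hg (W x)).diffAt x) (hW.diffAt x) (gext_self _)
  have h3 := (hτ.trd _ _ hA hW).covD_pointwise cov u
    ((hg (Z x)).diffAt x) (hZ.diffAt x) (gext_self _)
  rw [covD3, dirD_congr u (k := fun y => τ y (gext (A x) y) (gext (W x) y) (gext (Z x) y)),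
    cov_ext, cov_ext, cov_ext]
  · simp only [gext_self] at h1 h2 h3
    linarith
  · filter_upwards [gext_eventuallyEq (A x), gext_eventuallyEq (W x), gext_eventuallyEq (Z x)]
      with y h h' h''
    rw [h, h', h'']

lemma covD3_fst (hτ : IsTensor3 τ) (cov : Connection M) {x : M} (u a : TangentSpace (𝓡 5) x)
    {W Z : VField M} (hW : SmoothField W) (hZ : SmoothField Z) :
    covD3 cov τ x u a (W x) (Z x) = covD1 cov (fun y a => τ y a (W y) (Z y)) x u a
      - τ x a (cov W x u) (Z x) - τ x a (W x) (cov Z x u) := by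
  have h1 := covD1_eq cov (hτ.fst W Z hW hZ) u ((smoothField_gext a).diffAt x)
  have h2 := hτ.covD3_eq cov u (smoothField_gext a) hW hZ
  rw [gext_self] at h1 h2
  rw [h1, h2]

lemma covD3_snd (hτ : IsTensor3 τ) (cov : Connection M) {x : M} (u w : TangentSpace (𝓡 5) x)
    {A Z : VField M} (hA : SmoothField A) (hZ : SmoothField Z) :
    covD3 cov τ x u (A x) w (Z x) = covD1 cov (fun y w => τ y (A y) w (Z y)) x u w
      - τ x (cov A x u) w (Z x) - τ x (A x) w (cov Z x u) := by
  have h1 := covD1_eq cov (hτ.snd A Z hA hZ) u ((smoothField_gext w).diffAt x)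
  have h2 := hτ.covD3_eq cov u hA (smoothField_gext w) hZ
  rw [gext_self] at h1 h2
  rw [h1, h2]
  ring

lemma covD3_trd (hτ : IsTensor3 τ) (cov : Connection M) {x : M} (u z : TangentSpace (𝓡 5) x)
    {A W : VField M} (hA : SmoothField A) (hW : SmoothField W) :
    covD3 cov τ x u (A x) (W x) z = covD1 cov (fun y z => τ y (A y) (W y) z) x u z
      - τ x (cov A x u) (W x) z - τ x (A x) (cov W x u) z := by
  have h1 := covD1_eq cov (hτ.trd A W hA hW) u ((smoothField_gext z).diffAt x)
  have h2 := hτ.covD3_eq cov u hA hW (smoothField_gext z)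
  rw [gext_self] at h1 h2
  rw [h1, h2]
  ring

variable (cov : Connection M) {x : M}

lemma covD3_add_vec (hτ : IsTensor3 τ) (u u' a w z : TangentSpace (𝓡 5) x) :
    covD3 cov τ x (u + u') a w z = covD3 cov τ x u a w z + covD3 cov τ x u' a w z := by
  simp only [covD3, dirD_add_vec, map_add, hτ.add_fst, hτ.add_snd, hτ.add_trd]
  ring

lemma covD3_smul_vec (hτ : IsTensor3 τ) (c : ℝ) (u a w z : TangentSpace (𝓡 5) x) :
    covD3 cov τ x (c • u) a w z = c * covD3 cov τ x u a w z := by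
  simp only [covD3, dirD_smul_vec, map_smul, hτ.smul_fst, hτ.smul_snd, hτ.smul_trd]
  ring

lemma covD3_add_fst (hτ : IsTensor3 τ) (u a a' w z : TangentSpace (𝓡 5) x) :
    covD3 cov τ x u (a + a') w z = covD3 cov τ x u a w z + covD3 cov τ x u a' w z := by
  have h (a) := hτ.covD3_fst cov u a (smoothField_gext w) (smoothField_gext z)
  simp only [gext_self] at h
  rw [h, h, h, covD1_add cov (hτ.fst _ _ (smoothField_gext w) (smoothField_gext z)),
    hτ.add_fst, hτ.add_fst]
  ring

lemma covD3_smul_fst (hτ : IsTensor3 τ) (c : ℝ) (u a w z : TangentSpace (𝓡 5) x) :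
    covD3 cov τ x u (c • a) w z = c * covD3 cov τ x u a w z := by
  have h (a) := hτ.covD3_fst cov u a (smoothField_gext w) (smoothField_gext z)
  simp only [gext_self] at h
  rw [h, h, covD1_smul cov (hτ.fst _ _ (smoothField_gext w) (smoothField_gext z)),
    hτ.smul_fst, hτ.smul_fst]
  ring

lemma covD3_add_snd (hτ : IsTensor3 τ) (u a w w' z : TangentSpace (𝓡 5) x) :
    covD3 cov τ x u a (w + w') z = covD3 cov τ x u a w z + covD3 cov τ x u a w' z := by
  have h (w) := hτ.covD3_snd cov u w (smoothField_gext a) (smoothField_gext z)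
  simp only [gext_self] at h
  rw [h, h, h, covD1_add cov (hτ.snd _ _ (smoothField_gext a) (smoothField_gext z)),
    hτ.add_snd, hτ.add_snd]
  ring

lemma covD3_smul_snd (hτ : IsTensor3 τ) (c : ℝ) (u a w z : TangentSpace (𝓡 5) x) :
    covD3 cov τ x u a (c • w) z = c * covD3 cov τ x u a w z := by
  have h (w) := hτ.covD3_snd cov u w (smoothField_gext a) (smoothField_gext z)
  simp only [gext_self] at h
  rw [h, h, covD1_smul cov (hτ.snd _ _ (smoothField_gext a) (smoothField_gext z)),
    hτ.smul_snd, hτ.smul_snd]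
  ring

lemma covD3_add_trd (hτ : IsTensor3 τ) (u a w z z' : TangentSpace (𝓡 5) x) :
    covD3 cov τ x u a w (z + z') = covD3 cov τ x u a w z + covD3 cov τ x u a w z' := by
  have h (z) := hτ.covD3_trd cov u z (smoothField_gext a) (smoothField_gext w)
  simp only [gext_self] at h
  rw [h, h, h, covD1_add cov (hτ.trd _ _ (smoothField_gext a) (smoothField_gext w)),
    hτ.add_trd, hτ.add_trd]
  ring

lemma covD3_smul_trd (hτ : IsTensor3 τ) (c : ℝ) (u a w z : TangentSpace (𝓡 5) x) :
    covD3 cov τ x u a w (c • z) = c * covD3 cov τ x u a w z := by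
  have h (z) := hτ.covD3_trd cov u z (smoothField_gext a) (smoothField_gext w)
  simp only [gext_self] at h
  rw [h, h, covD1_smul cov (hτ.trd _ _ (smoothField_gext a) (smoothField_gext w)),
    hτ.smul_trd, hτ.smul_trd]
  ring

end IsTensor3

section Identities

variable (cov : Connection M) {x : M}

/-- The exterior derivative is the alternation of the covariant derivative, up to torsion. -/
lemma extD2_eq {η : Tensor2 M} (hη : IsTensor2 η) (halt : ∀ x u w, η x u w = -η x w u)
    (u w z : TangentSpace (𝓡 5) x) :
    extD2 η x u w z = covD2 cov η x u w z - covD2 cov η x w u z + covD2 cov η x z u w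
      + η x (torsion cov u w) z - η x (torsion cov u z) w + η x (torsion cov w z) u := by
  simp only [extD2, covD2, torsion, hη.sub_left]
  rw [halt x u, halt x w, halt x u]
  ring

/-- The Lie derivative along a parallel field is the covariant derivative, up to torsion. -/
lemma lieD_eq {η : Tensor2 M} (hη : IsTensor2 η) {V : VField M} (hV : SmoothField V)
    (hpar : ∀ u : TangentSpace (𝓡 5) x, cov V x u = 0) (u w : TangentSpace (𝓡 5) x) :
    lieD V η x u w = covD2 cov η x (V x) u w + η x (torsion cov (V x) u) w
      + η x u (torsion cov (V x) w) := by
  have h (u : TangentSpace (𝓡 5) x) := bracket_eq cov (hV.diffAt x) (ext_diffAt u)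
  simp only [lieD, covD2, h, hpar, ext_self, hη.sub_left, hη.sub_right]
  have z1 : η x 0 w = 0 := by simpa using hη.smul_left x 0 0 w
  have z2 : η x u 0 = 0 := by simpa using hη.smul_right x 0 u 0
  rw [z1, z2]
  ring

/-- The Ricci identity for the second covariant derivative of a `2`-tensor, with torsion. -/
lemma ricci_identity [CovariantDerivative.ContMDiffCovariantDerivative cov ∞]
    {η : Tensor2 M} (hη : IsTensor2 η) (u a w z : TangentSpace (𝓡 5) x) :
    covD3 cov (covD2 cov η) x u a w z - covD3 cov (covD2 cov η) x a u w z =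
      -η x (curvature cov u a w) z - η x w (curvature cov u a z)
        - covD2 cov η x (torsion cov u a) w z := by
  have hD := hη.covD2 cov
  have hg {x : M} (w : TangentSpace (𝓡 5) x) := smoothField_gext w
  have key (u a : TangentSpace (𝓡 5) x) : covD3 cov (covD2 cov η) x u a w z =
      dirD (fun y => dirD (fun y => η y (gext w y) (gext z y)) (gext a y)) u
      - (η x (cov (fun y => cov (gext w) y (gext a y)) x u) z)
      - (η x w (cov (fun y => cov (gext z) y (gext a y)) x u))
      - (η x (cov (gext w) x a) (cov (gext z) x u) + η x (cov (gext w) x u) (cov (gext z) x a))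
      - covD2 cov η x (cov (gext a) x u) w z
      - (dirD (fun y => η y (cov (gext w) y (gext a y)) (gext z y)) u
          - η x (cov (fun y => cov (gext w) y (gext a y)) x u) z
          - η x (cov (gext w) x a) (cov (gext z) x u))
      - (dirD (fun y => η y (gext w y) (cov (gext z) y (gext a y))) u
          - η x (cov (gext w) x u) (cov (gext z) x a)
          - η x w (cov (fun y => cov (gext z) y (gext a y)) x u))
      - covD2 cov η x a (cov (gext w) x u) z - covD2 cov η x a w (cov (gext z) x u) := by
    have h1 := hD.covD3_eq cov u (hg a) (hg w) (hg z)
    simp only [gext_self] at h1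
    rw [h1]
    have h2 : (fun y => covD2 cov η y (gext a y) (gext w y) (gext z y)) = fun y =>
        dirD (fun y => η y (gext w y) (gext z y)) (gext a y)
          - η y (cov (gext w) y (gext a y)) (gext z y)
          - η y (gext w y) (cov (gext z) y (gext a y)) :=
      funext fun y => hη.covD2_eq cov _ (hg w) (hg z)
    have s1 := smoothFun_dirD (hη.smooth (hg w) (hg z)) (hg a)
    have s2 := hη.smooth ((hg a).cov (cov := cov) (hg w)) (hg z)
    have s3 := hη.smooth (hg w) ((hg a).cov (cov := cov) (hg z))
    have s12 : SmoothFun (fun y => dirD (fun y => η y (gext w y) (gext z y)) (gext a y) -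
        η y (cov (gext w) y (gext a y)) (gext z y)) := s1.sub s2
    rw [h2, dirD_sub u (s12.diffAt x) (s3.diffAt x),
      dirD_sub u (s1.diffAt x) (s2.diffAt x)]
    ring
  -- the derivatives along `u` of `η(∇_a w, z)` and of `η(w, ∇_a z)`, rewritten with `∇_u η`
  have key2 (u a : TangentSpace (𝓡 5) x) :
      covD2 cov η x u (cov (gext w) x a) z =
        dirD (fun y => η y (cov (gext w) y (gext a y)) (gext z y)) u
          - η x (cov (fun y => cov (gext w) y (gext a y)) x u) z
          - η x (cov (gext w) x a) (cov (gext z) x u) := by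
    have := hη.covD2_eq cov u ((hg a).cov (cov := cov) (hg w)) (hg z)
    simpa only [gext_self] using this
  have key3 (u a : TangentSpace (𝓡 5) x) :
      covD2 cov η x u w (cov (gext z) x a) =
        dirD (fun y => η y (gext w y) (cov (gext z) y (gext a y))) u
          - η x (cov (gext w) x u) (cov (gext z) x a)
          - η x w (cov (fun y => cov (gext z) y (gext a y)) x u) := by
    have := hη.covD2_eq cov u (hg w) ((hg a).cov (cov := cov) (hg z))
    simpa only [gext_self] using this
  rw [key u a, key a u, ← key2, ← key2, ← key3, ← key3, curvature_eq, curvature_eq]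
  have hb := dirD_bracket (hg u) (hg a) (hη.smooth (hg w) (hg z)) x
  have hT := bracket_eq cov ((hg u).diffAt x) ((hg a).diffAt x)
  have hDT := hη.covD2_eq cov (bracket (gext u) (gext a) x) (hg w) (hg z)
  simp only [gext_self] at hb hT hDT
  have e : covD2 cov η x (bracket (gext u) (gext a) x) w z =
      covD2 cov η x (cov (gext a) x u) w z - covD2 cov η x (cov (gext u) x a) w z
        - covD2 cov η x (torsion cov u a) w z := by
    rw [hT, hD.sub_fst, hD.sub_fst]
  simp only [hη.sub_left, hη.sub_right]
  linarith

/-- The curvature annihilates a parallel `2`-tensor. -/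
lemma curvature_parallel [CovariantDerivative.ContMDiffCovariantDerivative cov ∞]
    {η : Tensor2 M} (hη : IsTensor2 η) (hpar : ∀ x u w z, covD2 cov η x u w z = 0)
    (u a w z : TangentSpace (𝓡 5) x) :
    η x (curvature cov u a w) z + η x w (curvature cov u a z) = 0 := by
  have h := ricci_identity cov hη u a w z
  have h0 (u a : TangentSpace (𝓡 5) x) : covD3 cov (covD2 cov η) x u a w z = 0 := by
    simp only [covD3, hpar, dirD_const]
    ring
  rw [h0, h0, hpar] at h
  linarith

end Identities
end ThirdOrder

/-! ### Frames, coframes and exterior derivatives -/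

section Coframe

variable {M : Type*} [TopologicalSpace M] [ChartedSpace (EuclideanSpace ℝ (Fin 5)) M]

lemma contMDiffAt_det {n : ℕ} {x : M} {N : M → Matrix (Fin n) (Fin n) ℝ}
    (hN : ∀ i j, ContMDiffAt (𝓡 5) 𝓘(ℝ, ℝ) ∞ (fun y => N y i j) x) :
    ContMDiffAt (𝓡 5) 𝓘(ℝ, ℝ) ∞ (fun y => (N y).det) x := by
  simp only [Matrix.det_apply']
  exact contMDiffAt_finsetSum fun σ _ =>
    contMDiffAt_const.mul (contMDiffAt_finsetProd fun i _ => hN _ _)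

lemma finrank_tangentSpace (x : M) : Module.finrank ℝ (TangentSpace (𝓡 5) x) = 5 := by
  change Module.finrank ℝ (EuclideanSpace ℝ (Fin 5)) = 5
  simp

scoped instance (x : M) : FiniteDimensional ℝ (TangentSpace (𝓡 5) x) :=
  inferInstanceAs (FiniteDimensional ℝ (EuclideanSpace ℝ (Fin 5)))

variable [IsManifold (𝓡 5) ∞ M] [T2Space M]

/-- A vector field is smooth at a point as soon as its values on a coframe are, by Cramer's rule. -/
lemma contMDiffAt_of_coframe {x : M} {X : VField M} {η : Fin 5 → Tensor1 M}
    (hη : ∀ i, IsTensor1 (η i)) (hind : ∀ u, (∀ i, η i x u = 0) → u = 0)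
    (hX : ∀ i, ContMDiffAt (𝓡 5) 𝓘(ℝ, ℝ) ∞ (fun y => η i y (X y)) x) :
    ContMDiffAt (𝓡 5) (𝓡 5).tangent ∞ (fun y => (⟨y, X y⟩ : TangentBundle (𝓡 5) M)) x := by
  let t := trivializationAt (EuclideanSpace ℝ (Fin 5)) (TangentSpace (𝓡 5) : M → Type _) x
  have hx : x ∈ t.baseSet := FiberBundle.mem_baseSet_trivializationAt' x
  let b := (EuclideanSpace.basisFun (Fin 5) ℝ).toBasis
  have hs (i) : ∃ W' : VField M, SmoothField W' ∧ ∀ᶠ y in 𝓝 x, W' y = t.localFrame b i y :=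
    exists_smoothField_eventuallyEq (by
      filter_upwards [t.open_baseSet.mem_nhds hx] with y hy
      exact contMDiffAt_localFrame_of_mem ∞ _ b i hy)
  choose S hS hSs using hs
  let N : M → Matrix (Fin 5) (Fin 5) ℝ := fun y => Matrix.of fun i j => η i y (S j y)
  let c : M → Fin 5 → ℝ := fun y i => t.localFrameCoeff (𝓡 5) b i y (X y)
  have hN (i j) : ContMDiffAt (𝓡 5) 𝓘(ℝ, ℝ) ∞ (fun y => N y i j) x :=
    ((hη i).smooth (S j) (hS j)).contMDiffAt
  have hdet : (N x).det ≠ 0 := by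
    intro h0
    obtain ⟨a, ha, ha0⟩ := Matrix.exists_mulVec_eq_zero_iff.2 h0
    have h1 : ∑ j, a j • S j x = 0 := by
      refine hind _ fun i => ?_
      rw [(hη i).sum]
      have := congrFun ha0 i
      simp only [Matrix.mulVec, dotProduct, Pi.zero_apply] at this
      rw [← this]
      exact Finset.sum_congr rfl fun j _ => by rw [(hη i).smul, mul_comm]; rfl
    have h2 := (t.basisAt b hx).linearIndependent
    rw [Fintype.linearIndependent_iff] at h2
    refine ha (funext fun j => h2 a ?_ j)
    rw [← h1]
    refine Finset.sum_congr rfl fun j _ => ?_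
    rw [(hSs j).self_of_nhds, t.localFrame_apply_of_mem_baseSet b hx]
  have hmul : ∀ᶠ y in 𝓝 x, (N y).mulVec (c y) = fun i => η i y (X y) := by
    filter_upwards [t.eventually_eq_localFrame_sum_coeff_smul (I := 𝓡 5) b hx (s := X),
      eventually_all.2 hSs] with y hy hy'
    funext i
    conv_rhs => rw [hy, (hη i).sum]
    change ∑ j, N y i j * c y j = _
    refine Finset.sum_congr rfl fun j _ => ?_
    rw [(hη i).smul, mul_comm, ← hy' j]
    rfl
  have hdetc := (contMDiffAt_det hN)
  have hdet' : ∀ᶠ y in 𝓝 x, (N y).det ≠ 0 := hdetc.continuousAt.eventually_ne hdet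
  rw [contMDiffAt_iff_localFrameCoeff b hx]
  intro j
  have hadj : ContMDiffAt (𝓡 5) 𝓘(ℝ, ℝ) ∞
      (fun y => (N y).det⁻¹ * ∑ i, (N y).adjugate j i * η i y (X y)) x := by
    refine (hdetc.inv₀ hdet).mul (contMDiffAt_finsetSum fun i _ => ContMDiffAt.mul ?_ (hX i))
    simp only [Matrix.adjugate_apply]
    refine contMDiffAt_det fun k l => ?_
    by_cases hk : k = i
    · subst hk
      simp only [Matrix.updateRow_self]
      exact contMDiffAt_const
    · simp only [Matrix.updateRow_ne hk]
      exact hN k l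
  refine hadj.congr_of_eventuallyEq ?_
  filter_upwards [hmul, hdet'] with y hy hy'
  have e : (N y).adjugate.mulVec ((N y).mulVec (c y)) = (N y).det • c y := by
    rw [Matrix.mulVec_mulVec, Matrix.adjugate_mul, Matrix.smul_mulVec, Matrix.one_mulVec]
  rw [hy] at e
  have e' := congrFun e j
  simp only [Matrix.mulVec, dotProduct, Pi.smul_apply, smul_eq_mul] at e'
  rw [e', inv_mul_cancel_left₀ hy']
  rfl

end Coframe

section Exterior

variable {M : Type*} [TopologicalSpace M] [ChartedSpace (EuclideanSpace ℝ (Fin 5)) M]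
  [IsManifold (𝓡 5) ∞ M]

lemma extD1_swap {η : Tensor1 M} (hη : IsTensor1 η) (x : M) (u w : TangentSpace (𝓡 5) x) :
    extD1 η x u w = - extD1 η x w u := by
  have : bracket (ext u) (ext w) x = - bracket (ext w) (ext u) x :=
    mlieBracket_swap_apply
  simp only [extD1, this, hη.neg]
  ring

variable [T2Space M]

/-- The exterior derivative may be computed with any smooth vector fields. The connection is only
a means of proof. -/
lemma extD1_apply (cov : Connection M) {η : Tensor1 M} (hη : IsTensor1 η) {X Y : VField M}
    (hX : SmoothField X) (hY : SmoothField Y) (x : M) :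
    extD1 η x (X x) (Y x) = dirD (fun y => η y (Y y)) (X x) - dirD (fun y => η y (X y)) (Y x)
      - η x (bracket X Y x) := by
  rw [extD1_eq cov hη, covD1_eq cov hη _ (hY.diffAt x), covD1_eq cov hη _ (hX.diffAt x),
    bracket_eq cov (hX.diffAt x) (hY.diffAt x), hη.sub, hη.sub]
  ring

/-- The exterior derivative of a smooth `1`-form is a smooth `2`-tensor. -/
lemma IsTensor1.extD1 (cov : Connection M)
    {η : Tensor1 M} (hη : IsTensor1 η) : IsTensor2 (extD1 η) := by
  have hl (W : VField M) (hW : SmoothField W) :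
      IsTensor1 (fun y u => ContactGeom.extD1 η y u (W y)) := by
    refine ⟨fun x u w => ?_, fun x c u => ?_, fun X hX => ?_⟩
    · simp only [extD1_eq cov hη, torsion_eq, map_add, add_apply, hη.add, covD1_add cov hη]
      simp only [covD1, dirD_add_vec, map_add, hη.add]
      ring
    · simp only [extD1_eq cov hη, torsion_eq, map_smul, smul_apply, hη.smul, covD1_smul cov hη]
      simp only [covD1, dirD_smul_vec, map_smul, hη.smul]
      ring
    · simp only [extD1_apply cov hη hX hW]
      exact ((smoothFun_dirD (hη.smooth _ hW) hX).sub (smoothFun_dirD (hη.smooth _ hX) hW)).sub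
        (hη.smooth _ (hX.bracket hW))
  refine ⟨hl, fun W hW => ?_⟩
  have : (fun y u => ContactGeom.extD1 η y (W y) u) =
      fun y u => - ContactGeom.extD1 η y u (W y) := by
    funext y u
    exact extD1_swap hη y _ _
  rw [this]
  refine ⟨fun x u w => ?_, fun x c u => ?_, fun X hX => ((hl W hW).smooth X hX).neg⟩
  · rw [(hl W hW).add]; ring
  · rw [(hl W hW).smul]; ring

end Exterior

/-! ### Pairs of alternating forms and almost complex structures -/

section PairAlgebra

variable {V : Type*} [AddCommGroup V] [Module ℝ V]

/-- Alternating bilinear forms, as functions of two vectors. -/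
structure IsAltForm (a : V → V → ℝ) : Prop where
  add_left : ∀ u u' w, a (u + u') w = a u w + a u' w
  smul_left : ∀ (c : ℝ) u w, a (c • u) w = c * a u w
  swap : ∀ u w, a u w = -a w u

namespace IsAltForm

variable {a b : V → V → ℝ}

lemma add_right (ha : IsAltForm a) (u w w' : V) : a u (w + w') = a u w + a u w' := by
  rw [ha.swap, ha.add_left, ha.swap w, ha.swap w']; ring

lemma smul_right (ha : IsAltForm a) (c : ℝ) (u w : V) : a u (c • w) = c * a u w := by
  rw [ha.swap, ha.smul_left, ha.swap w]; ring

lemma self (ha : IsAltForm a) (u : V) : a u u = 0 := by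
  have := ha.swap u u
  linarith

/-- Expansion of `a` in a frame of the horizontal space, for a form annihilated by `v`. -/
lemma expand (ha : IsAltForm a) {v : V} (hv : ∀ w, a v w = 0) (f : Fin 4 → V) (c : Fin 4 → ℝ)
    (t : ℝ) (z : V) : a (c 0 • f 0 + c 1 • f 1 + c 2 • f 2 + c 3 • f 3 + t • v) z =
      c 0 * a (f 0) z + c 1 * a (f 1) z + c 2 * a (f 2) z + c 3 * a (f 3) z := by
  simp only [ha.add_left, ha.smul_left, hv]
  ring

/-- Two horizontal forms are proportional in the second slot as soon as they are on a frame of the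
horizontal space. -/
lemma ext_frame (ha : IsAltForm a) {v : V} (hav : ∀ w, a v w = 0) {f : Fin 4 → V}
    (hf : ∀ u, ∃ (c : Fin 4 → ℝ) (t : ℝ),
      u = c 0 • f 0 + c 1 • f 1 + c 2 • f 2 + c 3 • f 3 + t • v)
    (hb : IsAltForm b) (hbv : ∀ w, b v w = 0) {u w : V} {k : ℝ}
    (h : ∀ i, a u (f i) = k * b w (f i)) (z : V) : a u z = k * b w z := by
  obtain ⟨c, t, rfl⟩ := hf z
  rw [ha.swap, hb.swap, ha.expand hav, hb.expand hbv]
  simp only [ha.swap _ u, hb.swap _ w, h]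
  ring

/-- A nonzero Pfaffian makes an alternating form non-degenerate on the span of the frame. -/
lemma eq_zero_of_pfaffian_ne_zero (ha : IsAltForm a) {f : Fin 4 → V}
    (h0 : wedge a a (f 0) (f 1) (f 2) (f 3) ≠ 0) {c : Fin 4 → ℝ}
    (h : ∀ i, a (c 0 • f 0 + c 1 • f 1 + c 2 • f 2 + c 3 • f 3) (f i) = 0) : c = 0 := by
  have e (i) : c 0 * a (f 0) (f i) + c 1 * a (f 1) (f i) + c 2 * a (f 2) (f i)
      + c 3 * a (f 3) (f i) = 0 := by
    rw [← h i]; simp only [ha.add_left, ha.smul_left]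
  have e0 := e 0
  have e1 := e 1
  have e2 := e 2
  have e3 := e 3
  rw [ha.self, ha.swap (f 1) (f 0), ha.swap (f 2) (f 0), ha.swap (f 3) (f 0)] at e0
  rw [ha.self, ha.swap (f 2) (f 1), ha.swap (f 3) (f 1)] at e1
  rw [ha.self, ha.swap (f 3) (f 2)] at e2
  rw [ha.self] at e3
  simp only [wedge] at h0
  have key (i) : wedge a a (f 0) (f 1) (f 2) (f 3) * c i = 0 := by
    simp only [wedge]
    fin_cases i <;> simp only [Fin.zero_eta, Fin.mk_one, Fin.reduceFinMk]
    · linear_combination 2 * (a (f 2) (f 3) * e1 - a (f 1) (f 3) * e2 + a (f 1) (f 2) * e3)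
    · linear_combination 2 * (-a (f 2) (f 3) * e0 + a (f 0) (f 3) * e2 - a (f 0) (f 2) * e3)
    · linear_combination 2 * (a (f 1) (f 3) * e0 - a (f 0) (f 3) * e1 + a (f 0) (f 1) * e3)
    · linear_combination 2 * (-a (f 1) (f 2) * e0 + a (f 0) (f 2) * e1 - a (f 0) (f 1) * e2)
  funext i
  exact (mul_eq_zero.1 (key i)).resolve_left h0

/-- A non-degenerate form on a `4`-dimensional space has nonzero Pfaffian: otherwise the rows of
its Hodge-type dual lie in the kernel. -/
lemma pfaffian_ne_zero (ha : IsAltForm a) {f : Fin 4 → V}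
    (hnd : ∀ c : Fin 4 → ℝ, (∀ i, a (c 0 • f 0 + c 1 • f 1 + c 2 • f 2 + c 3 • f 3) (f i) = 0) →
      c = 0) : wedge a a (f 0) (f 1) (f 2) (f 3) ≠ 0 := by
  intro h0
  simp only [wedge] at h0
  have r0 := hnd ![0, a (f 2) (f 3), -a (f 1) (f 3), a (f 1) (f 2)] (fun i => by
    simp only [ha.add_left, ha.smul_left]
    fin_cases i <;> simp [ha.self, ha.swap (f 1) (f 0), ha.swap (f 2) (f 0), ha.swap (f 3) (f 0),
      ha.swap (f 2) (f 1), ha.swap (f 3) (f 1), ha.swap (f 3) (f 2)] <;> linarith)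
  have r1 := hnd ![-a (f 2) (f 3), 0, a (f 0) (f 3), -a (f 0) (f 2)] (fun i => by
    simp only [ha.add_left, ha.smul_left]
    fin_cases i <;> simp [ha.self, ha.swap (f 1) (f 0), ha.swap (f 2) (f 0), ha.swap (f 3) (f 0),
      ha.swap (f 2) (f 1), ha.swap (f 3) (f 1), ha.swap (f 3) (f 2)] <;> linarith)
  have e23 : a (f 2) (f 3) = 0 := by simpa using congrFun r0 1
  have e13 : a (f 1) (f 3) = 0 := by simpa using congrFun r0 2
  have e03 : a (f 0) (f 3) = 0 := by simpa using congrFun r1 2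
  have := hnd ![0, 0, 0, 1] (fun i => by
    simp only [ha.add_left, ha.smul_left]
    fin_cases i <;> simp [ha.self, ha.swap (f 3) (f 0), ha.swap (f 3) (f 1), ha.swap (f 3) (f 2),
      e23, e13, e03])
  simpa using congrFun this 3

/-- Two alternating forms on a `4`-space with `a ∧ a = b ∧ b ≠ 0` and `a ∧ b = 0` are the real and
imaginary parts of a `(2, 0)`-form: the endomorphism `-a⁻¹ b` is written down by means of the
Pfaffian inverse of `a`. -/
lemma exists_cplx (ha : IsAltForm a) (hb : IsAltForm b) {v : V} (hav : ∀ w, a v w = 0)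
    (hbv : ∀ w, b v w = 0) {f : Fin 4 → V}
    (hf : ∀ u, ∃ (c : Fin 4 → ℝ) (t : ℝ),
      u = c 0 • f 0 + c 1 • f 1 + c 2 • f 2 + c 3 • f 3 + t • v)
    (h0 : wedge a a (f 0) (f 1) (f 2) (f 3) ≠ 0)
    (hab : wedge a b (f 0) (f 1) (f 2) (f 3) = 0)
    (hbb : wedge b b (f 0) (f 1) (f 2) (f 3) = wedge a a (f 0) (f 1) (f 2) (f 3)) (u : V) :
    ∃ c : Fin 4 → ℝ, ∀ z, a (c 0 • f 0 + c 1 • f 1 + c 2 • f 2 + c 3 • f 3) z = -b u z ∧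
      b (c 0 • f 0 + c 1 • f 1 + c 2 • f 2 + c 3 • f 3) z = a u z := by
  set P := wedge a a (f 0) (f 1) (f 2) (f 3) / 2 with hP
  have hP0 : P ≠ 0 := by simpa [hP] using h0
  have hPa : P = a (f 0) (f 1) * a (f 2) (f 3) - a (f 0) (f 2) * a (f 1) (f 3)
      + a (f 0) (f 3) * a (f 1) (f 2) := by rw [hP, wedge]; ring
  have hPb : P = b (f 0) (f 1) * b (f 2) (f 3) - b (f 0) (f 2) * b (f 1) (f 3)
      + b (f 0) (f 3) * b (f 1) (f 2) := by rw [hP, ← hbb, wedge]; ring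
  simp only [wedge] at hab
  have main : ∃ c : Fin 4 → ℝ, ∀ i,
      a (c 0 • f 0 + c 1 • f 1 + c 2 • f 2 + c 3 • f 3) (f i) = (-1) * b u (f i) ∧
      b (c 0 • f 0 + c 1 • f 1 + c 2 • f 2 + c 3 • f 3) (f i) = 1 * a u (f i) := by
    refine ⟨![P⁻¹ * (-b u (f 1) * a (f 2) (f 3) + b u (f 2) * a (f 1) (f 3)
        - b u (f 3) * a (f 1) (f 2)),
      P⁻¹ * (b u (f 0) * a (f 2) (f 3) - b u (f 2) * a (f 0) (f 3) + b u (f 3) * a (f 0) (f 2)),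
      P⁻¹ * (-b u (f 0) * a (f 1) (f 3) + b u (f 1) * a (f 0) (f 3) - b u (f 3) * a (f 0) (f 1)),
      P⁻¹ * (b u (f 0) * a (f 1) (f 2) - b u (f 1) * a (f 0) (f 2) + b u (f 2) * a (f 0) (f 1))],
      fun i => ?_⟩
    obtain ⟨d, t, rfl⟩ := hf u
    simp only [ha.expand hav, hb.expand hbv]
    simp only [ha.add_left, ha.smul_left, hb.add_left, hb.smul_left, Matrix.cons_val]
    have key (A B : ℝ) (h : A = P * B) : P⁻¹ * A = B := by
      rw [h, inv_mul_cancel_left₀ hP0]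
    have sa := ha.swap
    have sb := hb.swap
    constructor
    · fin_cases i <;> simp only [Fin.zero_eta, Fin.mk_one, Fin.reduceFinMk, ha.self, hb.self,
        sa (f 1) (f 0), sa (f 2) (f 0), sa (f 3) (f 0), sa (f 2) (f 1), sa (f 3) (f 1),
        sa (f 3) (f 2), sb (f 1) (f 0), sb (f 2) (f 0), sb (f 3) (f 0), sb (f 2) (f 1),
        sb (f 3) (f 1), sb (f 3) (f 2), mul_assoc P⁻¹, ← mul_add P⁻¹] <;>
        refine key _ _ ?_ <;> rw [hPa] <;> ring
    · fin_cases i <;> simp only [Fin.zero_eta, Fin.mk_one, Fin.reduceFinMk, ha.self, hb.self,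
        sa (f 1) (f 0), sa (f 2) (f 0), sa (f 3) (f 0), sa (f 2) (f 1), sa (f 3) (f 1),
        sa (f 3) (f 2), sb (f 1) (f 0), sb (f 2) (f 0), sb (f 3) (f 0), sb (f 2) (f 1),
        sb (f 3) (f 1), sb (f 3) (f 2), mul_assoc P⁻¹, ← mul_add P⁻¹] <;>
        refine key _ _ ?_ <;> rw [hPb]
      · linear_combination (d 1 * b (f 0) (f 1) + d 2 * b (f 0) (f 2) + d 3 * b (f 0) (f 3)) * hab
      · linear_combination (-d 0 * b (f 0) (f 1) + d 2 * b (f 1) (f 2) + d 3 * b (f 1) (f 3)) * hab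
      · linear_combination (-d 0 * b (f 0) (f 2) - d 1 * b (f 1) (f 2) + d 3 * b (f 2) (f 3)) * hab
      · linear_combination (-d 0 * b (f 0) (f 3) - d 1 * b (f 1) (f 3) - d 2 * b (f 2) (f 3)) * hab
  obtain ⟨c, hc⟩ := main
  refine ⟨c, fun z => ⟨?_, ?_⟩⟩
  · rw [ha.ext_frame hav hf hb hbv (fun i => (hc i).1) z]; ring
  · rw [hb.ext_frame hbv hf ha hav (fun i => (hc i).2) z]; ring

end IsAltForm

end PairAlgebra

/-! ### Smoothness of the Reeb field and of the almost complex structures -/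

section Forms

variable {M : Type*} [TopologicalSpace M] [ChartedSpace (EuclideanSpace ℝ (Fin 5)) M]
  [IsManifold (𝓡 5) ∞ M]

lemma isTensor2_of_bilin {σ : Π x : M, LinearMap.BilinForm ℝ (TangentSpace (𝓡 5) x)}
    (h : ∀ X Y : VField M, SmoothField X → SmoothField Y →
      ContMDiff (𝓡 5) 𝓘(ℝ, ℝ) ∞ (fun x => σ x (X x) (Y x))) :
    IsTensor2 (fun x u w => σ x u w) where
  left W hW := ⟨fun x u w => by simp, fun x c u => by simp, fun X hX => h X W hX hW⟩
  right W hW := ⟨fun x u w => by simp, fun x c u => by simp, fun X hX => h W X hW hX⟩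

lemma swap_of_alt {V : Type*} [AddCommGroup V] [Module ℝ V] {B : LinearMap.BilinForm ℝ V}
    (h : ∀ u, B u u = 0) (u w : V) : B u w = -B w u := by
  have := h (u + w)
  simp only [map_add, LinearMap.add_apply, h] at this
  linarith

namespace ContactHyperkahler

variable (S : ContactHyperkahler M)

lemma isTensor1_th : IsTensor1 S.th :=
  ⟨fun x u w => by simp [th], fun x c u => by simp [th], S.smooth_θ⟩

lemma isTensor2_al : IsTensor2 S.al := isTensor2_of_bilin S.smooth_α

lemma isTensor2_be : IsTensor2 S.be := isTensor2_of_bilin S.smooth_β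

/-- The algebraic conditions on an ordered pair out of the triple `(ω, α, β)` that make
`a + i b` a `(2, 0)`-form for an almost complex structure on `H`. -/
structure IsPair (a b : Tensor2 M) : Prop where
  tensor_fst : IsTensor2 a
  tensor_snd : IsTensor2 b
  swap_fst : ∀ x u w, a x u w = -a x w u
  swap_snd : ∀ x u w, b x u w = -b x w u
  horizontal_fst : ∀ x w, a x (S.v x) w = 0
  horizontal_snd : ∀ x w, b x (S.v x) w = 0
  sq_fst : ∀ x p q r s, wedge (a x) (a x) p q r s = wedge (S.om x) (S.om x) p q r s
  sq_snd : ∀ x p q r s, wedge (b x) (b x) p q r s = wedge (S.om x) (S.om x) p q r s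
  wedge_eq_zero : ∀ x p q r s, wedge (a x) (b x) p q r s = 0

lemma isPair_al_be : S.IsPair S.al S.be where
  tensor_fst := S.isTensor2_al
  tensor_snd := S.isTensor2_be
  swap_fst x := swap_of_alt (S.alt_α x)
  swap_snd x := swap_of_alt (S.alt_β x)
  horizontal_fst := S.horizontal_α
  horizontal_snd := S.horizontal_β
  sq_fst := S.α_sq
  sq_snd := S.β_sq
  wedge_eq_zero := S.α_wedge_β

variable [T2Space M]

/-- The connection does not enter the statement: it serves to see that `dθ` is tensorial, as the
alternation of `∇θ` up to torsion. The same holds for the lemmas below in which `cov` appears. -/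
lemma isTensor2_om (cov : Connection M) : IsTensor2 S.om := S.isTensor1_th.extD1 cov

lemma isAltForm_om (cov : Connection M) (x : M) : IsAltForm (S.om x) where
  add_left := (S.isTensor2_om cov).add_left x
  smul_left := (S.isTensor2_om cov).smul_left x
  swap := extD1_swap S.isTensor1_th x

/-- Correct a vector `u` with `θ(u) = 1` by the vector of `H` that represents `ω(u, ·)` on `H`. -/
lemma exists_reeb (cov : Connection M) (x : M) : ∃ u, S.θ x u = 1 ∧ ∀ w, S.om x u w = 0 := by
  have hω := S.isAltForm_om cov x
  let K := LinearMap.ker (S.θ x)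
  let Ω : LinearMap.BilinForm ℝ (TangentSpace (𝓡 5) x) :=
    LinearMap.mk₂ ℝ (S.om x) hω.add_left hω.smul_left hω.add_right hω.smul_right
  let Φ : K →ₗ[ℝ] Module.Dual ℝ K := (Ω.domRestrict₁₂ K K)
  have hinj : Function.Injective Φ := by
    rw [← LinearMap.ker_eq_bot, LinearMap.ker_eq_bot']
    rintro ⟨k, hk⟩ h
    refine Subtype.ext (S.contact x k hk fun w hw => ?_)
    exact LinearMap.congr_fun h (⟨w, hw⟩ : K)
  have hsurj : Function.Surjective Φ :=
    (LinearMap.injective_iff_surjective_of_finrank_eq_finrank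
      (Subspace.dual_finrank_eq (K := ℝ) (V := K)).symm).1 hinj
  obtain ⟨u, hu⟩ : ∃ u, S.θ x u = 1 := by
    obtain ⟨u, hu⟩ : ∃ u, S.θ x u ≠ 0 := by
      by_contra! h
      exact S.θ_ne_zero x (LinearMap.ext h)
    exact ⟨(S.θ x u)⁻¹ • u, by simp [hu]⟩
  obtain ⟨k, hk⟩ := hsurj ((Ω u).domRestrict K)
  have hkK : ∀ w, S.θ x w = 0 → S.om x k w = S.om x u w := fun w hw =>
    LinearMap.congr_fun hk (⟨w, hw⟩ : K)
  have hk0 : S.θ x k = 0 := k.2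
  have hneg (w) : S.om x (u - k) w = S.om x u w - S.om x k w :=
    (S.isTensor2_om cov).sub_left x u k w
  refine ⟨u - k, by simp [hu, hk0], fun w => ?_⟩
  have hw : w = (w - S.θ x w • (u - k : TangentSpace (𝓡 5) x))
      + S.θ x w • (u - k : TangentSpace (𝓡 5) x) := by abel
  rw [hw, hω.add_right, hω.smul_right, hω.self, mul_zero, add_zero, hneg, hkK _ (by simp [hu, hk0]),
    sub_self]

lemma reeb_spec (cov : Connection M) (x : M) :
    S.θ x (S.v x) = 1 ∧ ∀ w, S.om x (S.v x) w = 0 :=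
  Classical.epsilon_spec (S.exists_reeb cov x)

/-- A frame of `H` at `x`, completed by the Reeb vector to a frame of the tangent space. -/
lemma exists_frame (cov : Connection M) (x : M) : ∃ f : Fin 4 → TangentSpace (𝓡 5) x,
    (∀ i, S.θ x (f i) = 0) ∧ LinearIndependent ℝ f ∧ ∀ u, ∃ (c : Fin 4 → ℝ) (t : ℝ),
      u = c 0 • f 0 + c 1 • f 1 + c 2 • f 2 + c 3 • f 3 + t • S.v x := by
  have hr : Module.finrank ℝ (LinearMap.ker (S.θ x)) = 4 := by
    have h1 := LinearMap.finrank_range_add_finrank_ker (S.θ x)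
    have h2 : Module.finrank ℝ (LinearMap.range (S.θ x)) = 1 := by
      rw [LinearMap.range_eq_top.2 (LinearMap.surjective (S.θ_ne_zero x))]
      simp
    rw [finrank_tangentSpace, h2] at h1
    omega
  let b := Module.finBasisOfFinrankEq ℝ (LinearMap.ker (S.θ x)) hr
  refine ⟨fun i => b i, fun i => (b i).2, ?_, fun u => ?_⟩
  · exact b.linearIndependent.map' (Submodule.subtype _) (Submodule.ker_subtype _)
  · have hu : S.θ x (u - S.θ x u • S.v x) = 0 := by simp [(S.reeb_spec cov x).1]
    refine ⟨fun i => b.repr ⟨_, hu⟩ i, S.θ x u, ?_⟩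
    have := congrArg Subtype.val (b.sum_repr ⟨_, hu⟩)
    simp only [Fin.sum_univ_four, Submodule.coe_add, Submodule.coe_smul] at this
    rw [this]
    abel

/-- The Reeb field has constant values on the coframe `θ, ω(·, f₁), …, ω(·, f₄)`. -/
lemma smoothField_v (cov : Connection M) : SmoothField S.v := fun x => by
  obtain ⟨f, hf0, -, hf⟩ := S.exists_frame cov x
  have hω := S.isTensor2_om cov
  refine contMDiffAt_of_coframe
    (η := Fin.cons S.th fun j y u => S.om y u (gext (f j) y)) (fun i => ?_) (fun u hu => ?_)
    (fun i => ?_)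
  · refine Fin.cases ?_ (fun j => ?_) i
    · exact S.isTensor1_th
    · exact hω.left _ (smoothField_gext _)
  · have h0 : S.θ x u = 0 := hu 0
    refine S.contact x u h0 fun w _ => ?_
    have h1 (j : Fin 4) : S.om x u (f j) = 0 := by
      have := hu j.succ
      simpa using this
    have := (S.isAltForm_om cov x).ext_frame (fun w => (S.reeb_spec cov x).2 w) hf
      (S.isAltForm_om cov x) (fun w => (S.reeb_spec cov x).2 w) (u := u) (w := u) (k := 0)
      (fun i => by rw [h1]; ring) w
    have h' : S.om x u w = 0 := by simpa using this
    exact h'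
  · refine Fin.cases ?_ (fun j => ?_) i
    · have : (fun y => S.th y (S.v y)) = fun _ => 1 := funext fun y => (S.reeb_spec cov y).1
      simp only [Fin.cons_zero, this]
      exact contMDiffAt_const
    · have : (fun y => S.om y (S.v y) (gext (f j) y)) = fun _ => 0 :=
        funext fun y => (S.reeb_spec cov y).2 _
      simp only [Fin.cons_succ, this]
      exact contMDiffAt_const

lemma isPair_be_om (cov : Connection M) : S.IsPair S.be S.om where
  tensor_fst := S.isTensor2_be
  tensor_snd := S.isTensor2_om cov
  swap_fst x := swap_of_alt (S.alt_β x)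
  swap_snd := extD1_swap S.isTensor1_th
  horizontal_fst := S.horizontal_β
  horizontal_snd x := (S.reeb_spec cov x).2
  sq_fst := S.β_sq
  sq_snd _ _ _ _ _ := rfl
  wedge_eq_zero := S.β_wedge_ω

lemma isPair_om_al (cov : Connection M) : S.IsPair S.om S.al where
  tensor_fst := S.isTensor2_om cov
  tensor_snd := S.isTensor2_al
  swap_fst := extD1_swap S.isTensor1_th
  swap_snd x := swap_of_alt (S.alt_α x)
  horizontal_fst x := (S.reeb_spec cov x).2
  horizontal_snd := S.horizontal_α
  sq_fst _ _ _ _ _ := rfl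
  sq_snd := S.α_sq
  wedge_eq_zero := S.ω_wedge_α

namespace IsPair

variable {S} {a b : Tensor2 M}

lemma alt_fst (h : S.IsPair a b) (x : M) : IsAltForm (a x) :=
  ⟨h.tensor_fst.add_left x, h.tensor_fst.smul_left x, h.swap_fst x⟩

lemma alt_snd (h : S.IsPair a b) (x : M) : IsAltForm (b x) :=
  ⟨h.tensor_snd.add_left x, h.tensor_snd.smul_left x, h.swap_snd x⟩

/-- `ω ∧ ω` does not vanish on frames of `H`. -/
lemma wedge_ne_zero (cov : Connection M) {x : M} {f : Fin 4 → TangentSpace (𝓡 5) x}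
    (hf0 : ∀ i, S.θ x (f i) = 0) (hli : LinearIndependent ℝ f)
    (hf : ∀ u, ∃ (c : Fin 4 → ℝ) (t : ℝ),
      u = c 0 • f 0 + c 1 • f 1 + c 2 • f 2 + c 3 • f 3 + t • S.v x) :
    wedge (S.om x) (S.om x) (f 0) (f 1) (f 2) (f 3) ≠ 0 := by
  have hω := S.isAltForm_om cov x
  refine hω.pfaffian_ne_zero fun c hc => ?_
  have h1 : c 0 • f 0 + c 1 • f 1 + c 2 • f 2 + c 3 • f 3 = 0 := by
    refine S.contact x _ (by simp [hf0]) fun w _ => ?_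
    have := hω.ext_frame (fun w => (S.reeb_spec cov x).2 w) hf
      hω (fun w => (S.reeb_spec cov x).2 w) (w := 0) (k := 0)
      (fun i => by rw [hc]; ring) w
    have h' : S.om x (c 0 • f 0 + c 1 • f 1 + c 2 • f 2 + c 3 • f 3) w = 0 := by simpa using this
    exact h'
  rw [Fintype.linearIndependent_iff] at hli
  exact funext (hli c (by rw [Fin.sum_univ_four, h1]))

/-- The forms of the triple are non-degenerate on `H`. -/
lemma eq_zero (h : S.IsPair a b) (cov : Connection M) {x : M} {u : TangentSpace (𝓡 5) x}
    (hu : S.θ x u = 0) (hau : ∀ z, a x u z = 0) : u = 0 := by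
  obtain ⟨f, hf0, hli, hf⟩ := S.exists_frame cov x
  obtain ⟨c, t, rfl⟩ := hf u
  have ht : t = 0 := by simpa [hf0, (S.reeb_spec cov x).1] using hu
  subst ht
  have := (h.alt_fst x).eq_zero_of_pfaffian_ne_zero (f := f) (c := c)
    (by rw [h.sq_fst]; exact wedge_ne_zero cov hf0 hli hf) (fun i => by simpa using hau (f i))
  simp [this]

/-- The defining property of the almost complex structure of a pair. -/
lemma cplx_spec (h : S.IsPair a b) (cov : Connection M) {x : M} (u : TangentSpace (𝓡 5) x) :
    S.θ x (cplxStr S.th a b u) = 0 ∧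
      ∀ z, a x (cplxStr S.th a b u) z = -b x u z ∧ b x (cplxStr S.th a b u) z = a x u z := by
  obtain ⟨f, hf0, hli, hf⟩ := S.exists_frame cov x
  have hw := wedge_ne_zero cov hf0 hli hf
  obtain ⟨c, hc⟩ := (h.alt_fst x).exists_cplx (h.alt_snd x) (h.horizontal_fst x)
    (h.horizontal_snd x) hf (by rwa [h.sq_fst]) (h.wedge_eq_zero x _ _ _ _)
    (by rw [h.sq_fst, h.sq_snd]) u
  have hex : ∃ w, S.th x w = 0 ∧ ∀ z, S.th x z = 0 → a x w z = -b x u z ∧ b x w z = a x u z :=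
    ⟨_, by simp [th, hf0], fun z _ => hc z⟩
  obtain ⟨h1, h2⟩ := Classical.epsilon_spec hex
  refine ⟨h1, fun z => ?_⟩
  obtain ⟨d, t, rfl⟩ := hf z
  have h3 := h2 (d 0 • f 0 + d 1 • f 1 + d 2 • f 2 + d 3 • f 3) (by simp [th, hf0])
  have za (w) : a x w (S.v x) = 0 := by rw [h.swap_fst, h.horizontal_fst, neg_zero]
  have zb (w) : b x w (S.v x) = 0 := by rw [h.swap_snd, h.horizontal_snd, neg_zero]
  change a x (cplxStr S.th a b u) _ = _ ∧ b x (cplxStr S.th a b u) _ = _ at h3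
  have ea (p D) : a x p (D + t • S.v x) = a x p D := by
    rw [(h.alt_fst x).add_right, (h.alt_fst x).smul_right, za]; ring
  have eb (p D) : b x p (D + t • S.v x) = b x p D := by
    rw [(h.alt_snd x).add_right, (h.alt_snd x).smul_right, zb]; ring
  rw [ea, eb, eb, ea]
  exact h3

lemma eq_of_forall (h : S.IsPair a b) (cov : Connection M) {x : M} {u w : TangentSpace (𝓡 5) x}
    (hu : S.θ x u = 0) (hw : S.θ x w = 0) (hau : ∀ z, a x u z = a x w z) : u = w := by
  rw [← sub_eq_zero]
  exact h.eq_zero cov (by simp [hu, hw]) fun z => by rw [h.tensor_fst.sub_left, hau, sub_self]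

/-- On the coframe `θ, a(·, f₁), …, a(·, f₄)` the field `I X` takes the smooth values
`0, -b(X, f₁), …, -b(X, f₄)`. -/
lemma smoothField_cplx (h : S.IsPair a b) (cov : Connection M) {X : VField M}
    (hX : SmoothField X) : SmoothField (fun y => cplxStr S.th a b (X y)) := fun x => by
  obtain ⟨f, hf0, -, hf⟩ := S.exists_frame cov x
  refine contMDiffAt_of_coframe
    (η := Fin.cons S.th fun j y u => a y u (gext (f j) y)) (fun i => ?_) (fun u hu => ?_)
    (fun i => ?_)
  · refine Fin.cases ?_ (fun j => ?_) i
    · exact S.isTensor1_th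
    · exact h.tensor_fst.left _ (smoothField_gext _)
  · refine h.eq_zero cov (hu 0) fun w => ?_
    have h1 (j : Fin 4) : a x u (f j) = 0 := by
      have := hu j.succ
      simpa using this
    have := (h.alt_fst x).ext_frame (h.horizontal_fst x) hf (h.alt_fst x) (h.horizontal_fst x)
      (w := u) (k := 0) (fun i => by rw [h1]; ring) w
    simpa using this
  · refine Fin.cases ?_ (fun j => ?_) i
    · have : (fun y => S.th y (cplxStr S.th a b (X y))) = fun _ => 0 :=
        funext fun y => (h.cplx_spec cov (X y)).1
      simp only [Fin.cons_zero, this]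
      exact contMDiffAt_const
    · have : (fun y => a y (cplxStr S.th a b (X y)) (gext (f j) y)) =
          fun y => - b y (X y) (gext (f j) y) :=
        funext fun y => ((h.cplx_spec cov (X y)).2 _).1
      simp only [Fin.cons_succ, this]
      exact ((h.tensor_snd.smooth hX (smoothField_gext _)).neg).contMDiffAt

end IsPair

end ContactHyperkahler
end Forms

/-! ### The linear algebra of the structure at a point -/

/-- The linear algebra of a contact hyperkähler structure at one point: a `5`-dimensional space
`V = H ⊕ ℝ v` with `H = ker θ`, a triple of horizontal `2`-forms, and the three almost complex
structures, extended by zero on `v`, that the pairs `(α, β)`, `(β, ω)`, `(ω, α)` define on `H`. -/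
structure HyperkahlerSpace (V : Type*) [AddCommGroup V] [Module ℝ V] where
  th : V →ₗ[ℝ] ℝ
  v : V
  om : V → V → ℝ
  al : V → V → ℝ
  be : V → V → ℝ
  I : V → V
  J : V → V
  K : V → V
  alt_om : IsAltForm om
  alt_al : IsAltForm al
  alt_be : IsAltForm be
  th_v : th v = 1
  om_v : ∀ w, om v w = 0
  al_v : ∀ w, al v w = 0
  be_v : ∀ w, be v w = 0
  th_I : ∀ u, th (I u) = 0
  th_J : ∀ u, th (J u) = 0
  th_K : ∀ u, th (K u) = 0
  al_I : ∀ u z, al (I u) z = -be u z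
  be_I : ∀ u z, be (I u) z = al u z
  be_J : ∀ u z, be (J u) z = -om u z
  om_J : ∀ u z, om (J u) z = be u z
  om_K : ∀ u z, om (K u) z = -al u z
  al_K : ∀ u z, al (K u) z = om u z
  nondeg : ∀ u, th u = 0 → (∀ z, al u z = 0) → u = 0
  pos : ∀ u, th u = 0 → u ≠ 0 → 0 < om u (I u)
  finrank_eq : Module.finrank ℝ V = 5

namespace HyperkahlerSpace

variable {V : Type*} [AddCommGroup V] [Module ℝ V] (Q : HyperkahlerSpace V)

/-- The metric `g_H(u, w) = ω(u, I w)`, extended by zero on `v`. -/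
def gH (u w : V) : ℝ := Q.om u (Q.I w)

/-- The projection to `H` along `v`. -/
def pr (u : V) : V := u - Q.th u • Q.v

@[simp] lemma th_pr (u : V) : Q.th (Q.pr u) = 0 := by simp [pr, Q.th_v]

lemma pr_of_mem {u : V} (h : Q.th u = 0) : Q.pr u = u := by simp [pr, h]

lemma pr_add (u w : V) : Q.pr (u + w) = Q.pr u + Q.pr w := by
  simp only [pr, map_add, add_smul]; abel

lemma pr_smul (c : ℝ) (u : V) : Q.pr (c • u) = c • Q.pr u := by
  simp only [pr, map_smul, smul_sub, smul_smul, smul_eq_mul]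

lemma pr_v : Q.pr Q.v = 0 := by simp [pr, Q.th_v]

lemma pr_add_smul_v (u : V) : u = Q.pr u + Q.th u • Q.v := by simp [pr]

lemma eq_of_al {u w : V} (hu : Q.th u = 0) (hw : Q.th w = 0) (h : ∀ z, Q.al u z = Q.al w z) :
    u = w := by
  rw [← sub_eq_zero]
  refine Q.nondeg _ (by simp [hu, hw]) fun z => ?_
  rw [sub_eq_add_neg, ← neg_one_smul ℝ w, Q.alt_al.add_left, Q.alt_al.smul_left, h]
  ring

lemma al_pr (u z : V) : Q.al (Q.pr u) z = Q.al u z := by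
  rw [pr, sub_eq_add_neg, ← neg_smul, Q.alt_al.add_left, Q.alt_al.smul_left, Q.al_v]
  ring

lemma om_pr (u z : V) : Q.om (Q.pr u) z = Q.om u z := by
  rw [pr, sub_eq_add_neg, ← neg_smul, Q.alt_om.add_left, Q.alt_om.smul_left, Q.om_v]
  ring

lemma be_pr (u z : V) : Q.be (Q.pr u) z = Q.be u z := by
  rw [pr, sub_eq_add_neg, ← neg_smul, Q.alt_be.add_left, Q.alt_be.smul_left, Q.be_v]
  ring

lemma al_neg (u z : V) : Q.al (-u) z = -Q.al u z := by
  rw [← neg_one_smul ℝ, Q.alt_al.smul_left]; ring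

lemma I_I (u : V) : Q.I (Q.I u) = -Q.pr u :=
  Q.eq_of_al (Q.th_I _) (by simp) fun z => by rw [Q.al_I, Q.be_I, al_neg, al_pr]

lemma I_I_of_mem {u : V} (h : Q.th u = 0) : Q.I (Q.I u) = -u := by rw [I_I, Q.pr_of_mem h]

lemma eq_of_be {u w : V} (hu : Q.th u = 0) (hw : Q.th w = 0) (h : ∀ z, Q.be u z = Q.be w z) :
    u = w := by
  have : Q.I u = Q.I w := Q.eq_of_al (Q.th_I _) (Q.th_I _) fun z => by rw [Q.al_I, Q.al_I, h]
  rw [← neg_inj, ← Q.I_I_of_mem hu, this, Q.I_I_of_mem hw]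

lemma eq_of_om {u w : V} (hu : Q.th u = 0) (hw : Q.th w = 0) (h : ∀ z, Q.om u z = Q.om w z) :
    u = w := by
  have : Q.K u = Q.K w := Q.eq_of_al (Q.th_K _) (Q.th_K _) fun z => by rw [Q.al_K, Q.al_K, h]
  exact Q.eq_of_al hu hw fun z => by rw [← neg_inj, ← Q.om_K, this, Q.om_K]

lemma I_J (u : V) : Q.I (Q.J u) = Q.K u :=
  Q.eq_of_al (Q.th_I _) (Q.th_K _) fun z => by rw [Q.al_I, Q.be_J, Q.al_K, neg_neg]

lemma J_K (u : V) : Q.J (Q.K u) = Q.I u :=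
  Q.eq_of_be (Q.th_J _) (Q.th_I _) fun z => by rw [Q.be_J, Q.om_K, Q.be_I, neg_neg]

lemma K_I (u : V) : Q.K (Q.I u) = Q.J u :=
  Q.eq_of_om (Q.th_K _) (Q.th_J _) fun z => by rw [Q.om_K, Q.al_I, Q.om_J, neg_neg]

lemma J_J (u : V) : Q.J (Q.J u) = -Q.pr u :=
  Q.eq_of_be (Q.th_J _) (by simp) fun z => by
    rw [Q.be_J, Q.om_J, ← neg_one_smul ℝ (Q.pr u), Q.alt_be.smul_left, be_pr]; ring

lemma K_K (u : V) : Q.K (Q.K u) = -Q.pr u :=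
  Q.eq_of_om (Q.th_K _) (by simp) fun z => by
    rw [Q.om_K, Q.al_K, ← neg_one_smul ℝ (Q.pr u), Q.alt_om.smul_left, om_pr]; ring

lemma I_K (u : V) : Q.I (Q.K u) = -Q.J u := by rw [← I_J, Q.I_I_of_mem (Q.th_J u)]

lemma J_I (u : V) : Q.J (Q.I u) = -Q.K u := by
  rw [← J_K, J_J, Q.pr_of_mem (Q.th_K u)]

lemma K_J (u : V) : Q.K (Q.J u) = -Q.I u := by
  rw [← K_I, K_K, Q.pr_of_mem (Q.th_I u)]

lemma I_v : Q.I Q.v = 0 :=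
  Q.nondeg _ (Q.th_I _) fun z => by rw [Q.al_I, Q.be_v, neg_zero]

lemma J_v : Q.J Q.v = 0 :=
  Q.eq_of_be (Q.th_J _) (by simp) fun z => by
    rw [Q.be_J, Q.om_v, neg_zero, ← zero_smul ℝ Q.v, Q.alt_be.smul_left, zero_mul]

lemma gH_eq_al (u w : V) : Q.gH u w = -Q.al (Q.J u) w := by
  rw [gH, ← Q.al_K, Q.alt_al.swap, Q.al_I, Q.alt_be.swap, neg_neg, ← I_J, Q.be_I]

lemma gH_I (u w : V) : Q.gH (Q.I u) w = Q.om u w := by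
  rw [gH_eq_al, J_I, al_neg, neg_neg, Q.al_K]

lemma gH_J (u w : V) : Q.gH (Q.J u) w = Q.al u w := by
  rw [gH_eq_al, J_J, al_neg, neg_neg, al_pr]

lemma gH_K (u w : V) : Q.gH (Q.K u) w = Q.be u w := by
  rw [gH_eq_al, J_K, Q.al_I, neg_neg]

lemma gH_comm (u w : V) : Q.gH u w = Q.gH w u := by
  rw [gH_eq_al, gH, Q.alt_om.swap, ← Q.al_K (Q.I u), K_I]

lemma gH_add_left (u u' w : V) : Q.gH (u + u') w = Q.gH u w + Q.gH u' w := Q.alt_om.add_left _ _ _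

lemma gH_smul_left (c : ℝ) (u w : V) : Q.gH (c • u) w = c * Q.gH u w := Q.alt_om.smul_left _ _ _

lemma gH_add_right (u w w' : V) : Q.gH u (w + w') = Q.gH u w + Q.gH u w' := by
  rw [gH_comm, gH_add_left, Q.gH_comm w, Q.gH_comm w']

lemma gH_smul_right (c : ℝ) (u w : V) : Q.gH u (c • w) = c * Q.gH u w := by
  rw [gH_comm, gH_smul_left, Q.gH_comm w]

/-- `g_H` as a bilinear form. -/
def gHForm : LinearMap.BilinForm ℝ V :=
  LinearMap.mk₂ ℝ Q.gH Q.gH_add_left Q.gH_smul_left Q.gH_add_right Q.gH_smul_right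

lemma gHForm_apply (u w : V) : Q.gHForm u w = Q.gH u w := rfl

lemma gH_v_left (w : V) : Q.gH Q.v w = 0 := Q.om_v _

lemma gH_v_right (w : V) : Q.gH w Q.v = 0 := by rw [gH_comm, gH_v_left]

lemma gH_pr_left (u w : V) : Q.gH (Q.pr u) w = Q.gH u w := Q.om_pr _ _

lemma gH_pr_right (u w : V) : Q.gH u (Q.pr w) = Q.gH u w := by rw [gH_comm, gH_pr_left, gH_comm]

lemma eq_of_gH {u w : V} (hu : Q.th u = 0) (hw : Q.th w = 0) (h : ∀ z, Q.gH u z = Q.gH w z) :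
    u = w :=
  Q.eq_of_om hu hw fun z => by
    have h' := h (Q.I (-z))
    have hz : Q.I (Q.I (-z)) = Q.pr z := by
      rw [I_I]; simp only [pr, map_neg, neg_smul]; abel
    rw [gH, gH, hz, Q.alt_om.swap, om_pr, Q.alt_om.swap w, om_pr] at h'
    rw [Q.alt_om.swap u, Q.alt_om.swap w, h']

lemma I_add (u w : V) : Q.I (u + w) = Q.I u + Q.I w :=
  Q.eq_of_gH (Q.th_I _) (by simp [Q.th_I]) fun z => by
    rw [gH_add_left, gH_I, gH_I, gH_I, Q.alt_om.add_left]

lemma J_add (u w : V) : Q.J (u + w) = Q.J u + Q.J w :=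
  Q.eq_of_gH (Q.th_J _) (by simp [Q.th_J]) fun z => by
    rw [gH_add_left, gH_J, gH_J, gH_J, Q.alt_al.add_left]

lemma K_add (u w : V) : Q.K (u + w) = Q.K u + Q.K w :=
  Q.eq_of_gH (Q.th_K _) (by simp [Q.th_K]) fun z => by
    rw [gH_add_left, gH_K, gH_K, gH_K, Q.alt_be.add_left]

lemma I_smul (c : ℝ) (u : V) : Q.I (c • u) = c • Q.I u :=
  Q.eq_of_gH (Q.th_I _) (by simp [Q.th_I]) fun z => by
    rw [gH_smul_left, gH_I, gH_I, Q.alt_om.smul_left]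

lemma J_smul (c : ℝ) (u : V) : Q.J (c • u) = c • Q.J u :=
  Q.eq_of_gH (Q.th_J _) (by simp [Q.th_J]) fun z => by
    rw [gH_smul_left, gH_J, gH_J, Q.alt_al.smul_left]

lemma K_smul (c : ℝ) (u : V) : Q.K (c • u) = c • Q.K u :=
  Q.eq_of_gH (Q.th_K _) (by simp [Q.th_K]) fun z => by
    rw [gH_smul_left, gH_K, gH_K, Q.alt_be.smul_left]

/-- Orthonormal frames of `H`. -/
structure IsFrame (f : Fin 4 → V) : Prop where
  th_eq : ∀ i, Q.th (f i) = 0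
  gH_eq : ∀ i j, Q.gH (f i) (f j) = if i = j then 1 else 0

namespace IsFrame

variable {Q} {f : Fin 4 → V}

lemma linearIndependent (hf : Q.IsFrame f) : LinearIndependent ℝ f := by
  rw [Fintype.linearIndependent_iff]
  intro c hc i
  have h : Q.gHForm (∑ j, c j • f j) (f i) = 0 := by rw [hc]; simp
  simpa [gHForm_apply, hf.gH_eq] using h

/-- The frame as a basis of `H`. -/
def basis (hf : Q.IsFrame f) : Module.Basis (Fin 4) ℝ (LinearMap.ker Q.th) :=
  basisOfLinearIndependentOfCardEqFinrank (b := fun i => ⟨f i, hf.th_eq i⟩)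
    (LinearIndependent.of_comp (Submodule.subtype _) hf.linearIndependent) <| by
      have : FiniteDimensional ℝ V := FiniteDimensional.of_finrank_eq_succ Q.finrank_eq
      have h1 := LinearMap.finrank_range_add_finrank_ker Q.th
      have h2 : Module.finrank ℝ (LinearMap.range Q.th) = 1 := by
        rw [LinearMap.range_eq_top.2 (LinearMap.surjective fun h => by simpa [h] using Q.th_v)]
        simp
      rw [Q.finrank_eq, h2] at h1
      rw [Fintype.card_fin]
      omega

lemma coe_basis (hf : Q.IsFrame f) (i : Fin 4) : (hf.basis i : V) = f i := by
  simp [basis]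

lemma pr_eq (hf : Q.IsFrame f) (u : V) : Q.pr u = ∑ i, Q.gH u (f i) • f i := by
  have h := congrArg Subtype.val (hf.basis.sum_repr ⟨Q.pr u, Q.th_pr u⟩)
  simp only [AddSubmonoidClass.coe_finsetSum, Submodule.coe_smul, coe_basis] at h
  have hc (i) : hf.basis.repr ⟨Q.pr u, Q.th_pr u⟩ i = Q.gH u (f i) := by
    have h' := congrArg (fun z => Q.gHForm z (f i)) h
    simpa [gHForm_apply, hf.gH_eq, gH_pr_left] using h'
  simp only [← hc, h]

lemma sum_pr (hf : Q.IsFrame f) {u : V} (hu : Q.th u = 0) : ∑ i, Q.gH u (f i) • f i = u := by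
  rw [← hf.pr_eq, Q.pr_of_mem hu]

/-- The trace of a bilinear form does not depend on the orthonormal frame. -/
lemma sum_eq {f' : Fin 4 → V} (hf : Q.IsFrame f) (hf' : Q.IsFrame f') (B : V →ₗ[ℝ] V →ₗ[ℝ] ℝ) :
    ∑ i, B (f i) (f i) = ∑ i, B (f' i) (f' i) := by
  calc ∑ i, B (f i) (f i) = ∑ i, B (∑ j, Q.gH (f i) (f' j) • f' j) (f i) := by
        simp only [hf'.sum_pr (hf.th_eq _)]
    _ = ∑ i, ∑ j, B (f' j) (Q.gH (f' j) (f i) • f i) := by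
        simp [Q.gH_comm (f _) (f' _)]
    _ = ∑ j, B (f' j) (∑ i, Q.gH (f' j) (f i) • f i) := by
        rw [Finset.sum_comm]; simp
    _ = _ := by simp only [hf.sum_pr (hf'.th_eq _)]

end IsFrame

/-- The quaternionic frame `(e, I e, J e, K e)`. -/
def quat (e : V) : Fin 4 → V := ![e, Q.I e, Q.J e, Q.K e]

lemma gH_I_self (e : V) : Q.gH (Q.I e) e = 0 := by rw [gH_I, Q.alt_om.self]
lemma gH_J_self (e : V) : Q.gH (Q.J e) e = 0 := by rw [gH_J, Q.alt_al.self]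
lemma gH_K_self (e : V) : Q.gH (Q.K e) e = 0 := by rw [gH_K, Q.alt_be.self]

/-- A unit vector of `H` generates a quaternionic orthonormal frame. -/
lemma isFrame_quat {e : V} (h0 : Q.th e = 0) (h1 : Q.gH e e = 1) : Q.IsFrame (Q.quat e) := by
  have oI (u w) : Q.om u (Q.I w) = Q.gH u w := rfl
  have aJ (u w) : Q.al u (Q.J w) = Q.gH u w := by
    rw [Q.alt_al.swap, ← gH_eq_al, gH_comm]
  have bK (u w) : Q.be u (Q.K w) = Q.gH u w := by
    rw [Q.alt_be.swap, ← I_J, Q.be_I, ← gH_eq_al, gH_comm]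
  have hI := Q.gH_I_self e
  have hJ := Q.gH_J_self e
  have hK := Q.gH_K_self e
  refine ⟨fun i => ?_, fun i j => ?_⟩
  · fin_cases i <;> simp [quat, h0, Q.th_I, Q.th_J, Q.th_K]
  · fin_cases i <;> fin_cases j <;>
      simp [quat, h1, hI, hJ, hK, Q.gH_comm e]
    · rw [gH_I, oI, h1]
    · rw [gH_comm, gH_J, Q.alt_al.swap, Q.al_I, Q.alt_be.self]; simp
    · rw [gH_I, Q.alt_om.swap, Q.om_K, ← gH_J, hJ]; simp
    · rw [gH_J, Q.alt_al.swap, Q.al_I, ← gH_K, hK]; simp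
    · rw [gH_J, aJ, h1]
    · rw [gH_J, Q.alt_al.swap, Q.al_K, ← gH_I, hI]; simp
    · rw [gH_K, Q.alt_be.swap, Q.be_I, ← gH_J, hJ]; simp
    · rw [gH_K, Q.alt_be.swap, Q.be_J, ← gH_I, hI]; simp
    · rw [gH_K, bK, h1]

lemma exists_mem_ne_zero : ∃ e, Q.th e = 0 ∧ e ≠ 0 := by
  have : FiniteDimensional ℝ V := FiniteDimensional.of_finrank_eq_succ Q.finrank_eq
  by_contra! h
  have hk : LinearMap.ker Q.th = ⊥ := (Submodule.eq_bot_iff _).2 fun u hu => h u hu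
  have h1 := LinearMap.finrank_range_add_finrank_ker Q.th
  have h2 := (LinearMap.range Q.th).finrank_le
  rw [hk, Q.finrank_eq, finrank_bot] at h1
  simp at h2
  omega

lemma exists_unit : ∃ e, Q.th e = 0 ∧ Q.gH e e = 1 := by
  obtain ⟨e, he, h⟩ := Q.exists_mem_ne_zero
  have hN : 0 < Q.gH e e := Q.pos e he h
  refine ⟨(√(Q.gH e e))⁻¹ • e, by simp [he], ?_⟩
  rw [gH_smul_left, gH_smul_right, ← mul_assoc, ← mul_inv, Real.mul_self_sqrt hN.le,
    inv_mul_cancel₀ hN.ne']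

lemma quat_smul (c : ℝ) (e : V) (i : Fin 4) : Q.quat (c • e) i = c • Q.quat e i := by
  fin_cases i <;> simp [quat, I_smul, J_smul, K_smul]

lemma quat_add (e e' : V) (i : Fin 4) : Q.quat (e + e') i = Q.quat e i + Q.quat e' i := by
  fin_cases i <;> simp [quat, I_add, J_add, K_add]

/-- Traces in quaternionic frames that are not normalized. -/
lemma sum_quat_eq {f : Fin 4 → V} (hf : Q.IsFrame f) {e : V} (he : Q.th e = 0)
    (B : V →ₗ[ℝ] V →ₗ[ℝ] ℝ) :
    ∑ i, B (Q.quat e i) (Q.quat e i) = Q.gH e e * ∑ i, B (f i) (f i) := by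
  by_cases h : e = 0
  · subst h
    have h1 (i) : Q.quat 0 i = 0 := by simpa using Q.quat_smul 0 0 i
    have h0 : Q.gH 0 0 = 0 := by simpa using Q.gH_smul_left 0 0 0
    simp [h1, h0]
  have hN : 0 < Q.gH e e := Q.pos e he h
  have hs : √(Q.gH e e) ≠ 0 := (Real.sqrt_pos.2 hN).ne'
  have hq := Q.isFrame_quat (e := (√(Q.gH e e))⁻¹ • e) (by simp [he]) (by
    rw [gH_smul_left, gH_smul_right, ← mul_assoc, ← mul_inv, Real.mul_self_sqrt hN.le,
      inv_mul_cancel₀ hN.ne'])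
  rw [hf.sum_eq hq, Finset.mul_sum]
  refine Finset.sum_congr rfl fun i _ => ?_
  rw [quat_smul]
  simp only [map_smul, LinearMap.smul_apply, smul_eq_mul, ← mul_assoc]
  rw [mul_assoc (Q.gH e e), ← mul_inv, Real.mul_self_sqrt hN.le, mul_inv_cancel₀ hN.ne', one_mul]

/-- Polarization of `sum_quat_eq`. -/
lemma sum_quat_polar {f : Fin 4 → V} (hf : Q.IsFrame f) {e e' : V} (he : Q.th e = 0)
    (he' : Q.th e' = 0) (B : V →ₗ[ℝ] V →ₗ[ℝ] ℝ) :
    ∑ i, (B (Q.quat e' i) (Q.quat e i) + B (Q.quat e i) (Q.quat e' i)) =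
      2 * Q.gH e e' * ∑ i, B (f i) (f i) := by
  have h1 := Q.sum_quat_eq hf he B
  have h2 := Q.sum_quat_eq hf he' B
  have h3 := Q.sum_quat_eq hf (e := e + e') (by simp [he, he']) B
  simp only [quat_add, gH_add_left, gH_add_right, map_add, LinearMap.add_apply,
    Finset.sum_add_distrib, Q.gH_comm e' e] at h3 ⊢
  linear_combination h3 - h1 - h2

end HyperkahlerSpace

/-! ### Components in a quaternionic frame -/

section Components

/-- The matrix of an anti-self-dual `2`-form in a frame `(e, I e, J e, K e)`. -/
def asdMatrix (c₁ c₂ c₃ : ℝ) : Fin 4 → Fin 4 → ℝ :=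
  ![![0, c₁, c₂, c₃], ![-c₁, 0, -c₃, c₂], ![-c₂, c₃, 0, -c₁], ![-c₃, -c₂, c₁, 0]]

/-- The matrix of `ω` in a frame `(e, I e, J e, K e)`. -/
def omMatrix : Fin 4 → Fin 4 → ℝ := ![![0, 1, 0, 0], ![-1, 0, 0, 0], ![0, 0, 0, 1], ![0, 0, -1, 0]]

/-- The matrix of the metric in an orthonormal frame. -/
def gMatrix (i j : Fin 4) : ℝ := if i = j then 1 else 0

/-- The Hodge star of the matrix `B` of a `2`-form. -/
def starMatrix (B : Fin 4 → Fin 4 → ℝ) (i j : Fin 4) : ℝ :=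
  (∑ k, ∑ l, B k l * (wedge omMatrix omMatrix k l i j / 2)) / 2

/-- The anti-self-dual part of the matrix `B` of a `2`-form. -/
def asdPartMatrix (B : Fin 4 → Fin 4 → ℝ) (i j : Fin 4) : ℝ := (B i j - starMatrix B i j) / 2

lemma starMatrix_eq (B : Fin 4 → Fin 4 → ℝ) : starMatrix B =
    ![![0, (B 2 3 - B 3 2) / 2, (B 3 1 - B 1 3) / 2, (B 1 2 - B 2 1) / 2],
      ![(B 3 2 - B 2 3) / 2, 0, (B 0 3 - B 3 0) / 2, (B 2 0 - B 0 2) / 2],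
      ![(B 1 3 - B 3 1) / 2, (B 3 0 - B 0 3) / 2, 0, (B 0 1 - B 1 0) / 2],
      ![(B 2 1 - B 1 2) / 2, (B 0 2 - B 2 0) / 2, (B 1 0 - B 0 1) / 2, 0]] := by
  funext i j
  fin_cases i <;> fin_cases j <;>
    simp [starMatrix, wedge, omMatrix, Fin.sum_univ_four] <;> ring

/-- The anti-self-dual component of a `4`-tensor in both pairs of arguments. -/
def asdAsdPart (X : Fin 4 → Fin 4 → Fin 4 → Fin 4 → ℝ) (a b c d : Fin 4) : ℝ :=
  asdPartMatrix (fun a' b' => asdPartMatrix (fun c' d' => X a' b' c' d') c d) a b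

lemma asdPartMatrix_eq (B : Fin 4 → Fin 4 → ℝ) (h : ∀ i j, B i j = -B j i) : asdPartMatrix B =
    asdMatrix ((B 0 1 - B 2 3) / 2) ((B 0 2 + B 1 3) / 2) ((B 0 3 - B 1 2) / 2) := by
  have h0 := h 1 0
  have h1 := h 2 0
  have h2 := h 3 0
  have h3 := h 2 1
  have h4 := h 3 1
  have h5 := h 3 2
  have hd (i) : B i i = 0 := by linarith [h i i]
  funext i j
  rw [asdPartMatrix, starMatrix_eq]
  fin_cases i <;> fin_cases j <;> simp [asdMatrix, h0, h1, h2, h3, h4, h5, hd] <;> ring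

lemma asdMatrix_swap (c₁ c₂ c₃ : ℝ) (i j : Fin 4) :
    asdMatrix c₁ c₂ c₃ i j = -asdMatrix c₁ c₂ c₃ j i := by
  fin_cases i <;> fin_cases j <;> simp [asdMatrix]

/-- The `Λ⁻ ⊗ Λ⁻` component of a tensor that is antisymmetric in both pairs. -/
lemma asdAsdPart_eq (X : Fin 4 → Fin 4 → Fin 4 → Fin 4 → ℝ)
    (h₁ : ∀ a b c d, X a b c d = -X b a c d) (h₂ : ∀ a b c d, X a b c d = -X a b d c)
    (a b c d : Fin 4) : asdAsdPart X a b c d =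
      asdMatrix
        (asdMatrix ((X 0 1 0 1 - X 0 1 2 3 - X 2 3 0 1 + X 2 3 2 3) / 4)
          ((X 0 1 0 2 + X 0 1 1 3 - X 2 3 0 2 - X 2 3 1 3) / 4)
          ((X 0 1 0 3 - X 0 1 1 2 - X 2 3 0 3 + X 2 3 1 2) / 4) c d)
        (asdMatrix ((X 0 2 0 1 - X 0 2 2 3 + X 1 3 0 1 - X 1 3 2 3) / 4)
          ((X 0 2 0 2 + X 0 2 1 3 + X 1 3 0 2 + X 1 3 1 3) / 4)
          ((X 0 2 0 3 - X 0 2 1 2 + X 1 3 0 3 - X 1 3 1 2) / 4) c d)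
        (asdMatrix ((X 0 3 0 1 - X 0 3 2 3 - X 1 2 0 1 + X 1 2 2 3) / 4)
          ((X 0 3 0 2 + X 0 3 1 3 - X 1 2 0 2 - X 1 2 1 3) / 4)
          ((X 0 3 0 3 - X 0 3 1 2 - X 1 2 0 3 + X 1 2 1 2) / 4) c d) a b := by
  have hi (a' b') : asdPartMatrix (fun c' d' => X a' b' c' d') =
      asdMatrix ((X a' b' 0 1 - X a' b' 2 3) / 2) ((X a' b' 0 2 + X a' b' 1 3) / 2)
        ((X a' b' 0 3 - X a' b' 1 2) / 2) := asdPartMatrix_eq _ (h₂ a' b')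
  have ho : ∀ a' b', asdMatrix ((X a' b' 0 1 - X a' b' 2 3) / 2) ((X a' b' 0 2 + X a' b' 1 3) / 2)
        ((X a' b' 0 3 - X a' b' 1 2) / 2) c d = -asdMatrix ((X b' a' 0 1 - X b' a' 2 3) / 2)
          ((X b' a' 0 2 + X b' a' 1 3) / 2) ((X b' a' 0 3 - X b' a' 1 2) / 2) c d := by
    intro a' b'
    rw [h₁ a' b' 0 1, h₁ a' b' 2 3, h₁ a' b' 0 2, h₁ a' b' 1 3, h₁ a' b' 0 3, h₁ a' b' 1 2]
    fin_cases c <;> fin_cases d <;> simp [asdMatrix] <;> ring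
  rw [asdAsdPart]
  simp only [hi]
  rw [asdPartMatrix_eq _ ho]
  congr 1 <;> [skip; skip; skip] <;>
  · fin_cases c <;> fin_cases d <;> simp [asdMatrix] <;> ring

/-- The algebraic curvature part of the `4`-tensor `r`. -/
def algCurvMatrix (r : Fin 4 → Fin 4 → Fin 4 → Fin 4 → ℝ) (a b c d : Fin 4) : ℝ :=
  pairSymm r a b c d - bianchi (pairSymm r) a b c d

/-- The Ricci contraction of the algebraic curvature part of `r`. -/
def ricMatrix (r : Fin 4 → Fin 4 → Fin 4 → Fin 4 → ℝ) (a b : Fin 4) : ℝ :=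
  ∑ i, algCurvMatrix r i a b i

/-- The scalar curvature of the algebraic curvature part of `r`. -/
def scalMatrix (r : Fin 4 → Fin 4 → Fin 4 → Fin 4 → ℝ) : ℝ := ∑ i, ricMatrix r i i

/-- The Weyl part of the algebraic curvature part of `r`. -/
def weylMatrix (r : Fin 4 → Fin 4 → Fin 4 → Fin 4 → ℝ) (a b c d : Fin 4) : ℝ :=
  algCurvMatrix r a b c d - kulkarniNomizu (ricMatrix r) gMatrix a b c d / 2
    + scalMatrix r / 12 * kulkarniNomizu gMatrix gMatrix a b c d

/-- The endomorphism `∑ P_{klmn} ε^k ι^l ε^m ι^n` of `2`-forms, in components. -/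
def actMatrix (P : Fin 4 → Fin 4 → Fin 4 → Fin 4 → ℝ) (s : Fin 4 → Fin 4 → ℝ) (u w : Fin 4) : ℝ :=
  ∑ l, ∑ n, (P u l l n * s n w - P u l w n * s n l - P w l l n * s n u + P w l u n * s n l)

lemma pairSymm_pair (r : Fin 4 → Fin 4 → Fin 4 → Fin 4 → ℝ) (a b c d : Fin 4) :
    pairSymm r a b c d = pairSymm r c d a b := by
  simp only [pairSymm]; ring

section Curvature

variable {r : Fin 4 → Fin 4 → Fin 4 → Fin 4 → ℝ}

lemma pairSymm_swap₁ (h₁ : ∀ a b c d, r a b c d = -r b a c d)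
    (h₂ : ∀ a b c d, r a b c d = -r a b d c) (a b c d : Fin 4) :
    pairSymm r a b c d = -pairSymm r b a c d := by
  simp only [pairSymm]
  rw [h₁ a b, h₂ c d a b]; ring

lemma pairSymm_swap₂ (h₁ : ∀ a b c d, r a b c d = -r b a c d)
    (h₂ : ∀ a b c d, r a b c d = -r a b d c) (a b c d : Fin 4) :
    pairSymm r a b c d = -pairSymm r a b d c := by
  rw [pairSymm_pair, pairSymm_swap₁ h₁ h₂, pairSymm_pair]

lemma algCurvMatrix_swap₁ (h₁ : ∀ a b c d, r a b c d = -r b a c d)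
    (h₂ : ∀ a b c d, r a b c d = -r a b d c) (a b c d : Fin 4) :
    algCurvMatrix r a b c d = -algCurvMatrix r b a c d := by
  have h := pairSymm_swap₁ h₁ h₂
  simp only [algCurvMatrix, bianchi]
  linarith [h a b c d, h b c a d, h c a b d]

lemma algCurvMatrix_swap₂ (h₁ : ∀ a b c d, r a b c d = -r b a c d)
    (h₂ : ∀ a b c d, r a b c d = -r a b d c) (a b c d : Fin 4) :
    algCurvMatrix r a b c d = -algCurvMatrix r a b d c := by
  have h := pairSymm_swap₁ h₁ h₂
  have h' := pairSymm_swap₂ h₁ h₂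
  simp only [algCurvMatrix, bianchi]
  linarith [h' a b c d, h a c b d, h' b c d a, pairSymm_pair r b d a c, pairSymm_pair r d a b c]

lemma weylMatrix_swap₁ (h₁ : ∀ a b c d, r a b c d = -r b a c d)
    (h₂ : ∀ a b c d, r a b c d = -r a b d c) (a b c d : Fin 4) :
    weylMatrix r a b c d = -weylMatrix r b a c d := by
  rw [weylMatrix, algCurvMatrix_swap₁ h₁ h₂]
  simp only [weylMatrix, kulkarniNomizu]
  ring

lemma weylMatrix_swap₂ (h₁ : ∀ a b c d, r a b c d = -r b a c d)
    (h₂ : ∀ a b c d, r a b c d = -r a b d c) (a b c d : Fin 4) :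
    weylMatrix r a b c d = -weylMatrix r a b d c := by
  rw [weylMatrix, algCurvMatrix_swap₂ h₁ h₂]
  simp only [weylMatrix, kulkarniNomizu]
  ring

end Curvature

section Weitzenbock

variable {ρ₁ ρ₂ ρ₃ : Fin 4 → Fin 4 → ℝ}

lemma scalMatrix_eq (h₁ : ∀ i j, ρ₁ i j = -ρ₁ j i) (h₂ : ∀ i j, ρ₂ i j = -ρ₂ j i)
    (h₃ : ∀ i j, ρ₃ i j = -ρ₃ j i) :
    scalMatrix (fun i j => asdMatrix (ρ₁ i j) (ρ₂ i j) (ρ₃ i j)) =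
      -2 * ρ₁ 0 1 - 2 * ρ₂ 0 2 - 2 * ρ₃ 0 3 + 2 * ρ₃ 1 2 - 2 * ρ₂ 1 3 + 2 * ρ₁ 2 3 := by
  have d1 (i) : ρ₁ i i = 0 := by linarith [h₁ i i]
  have d2 (i) : ρ₂ i i = 0 := by linarith [h₂ i i]
  have d3 (i) : ρ₃ i i = 0 := by linarith [h₃ i i]
  simp [scalMatrix, ricMatrix, algCurvMatrix, pairSymm, bianchi, Fin.sum_univ_four, asdMatrix,
    d1, d2, d3, h₁ 1 0, h₁ 2 0, h₁ 3 0, h₁ 2 1, h₁ 3 1, h₁ 3 2, h₂ 1 0, h₂ 2 0, h₂ 3 0, h₂ 2 1,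
    h₂ 3 1, h₂ 3 2, h₃ 1 0, h₃ 2 0, h₃ 3 0, h₃ 2 1, h₃ 3 1, h₃ 3 2]
  ring

lemma ricMatrix_symm {r : Fin 4 → Fin 4 → Fin 4 → Fin 4 → ℝ}
    (h₁ : ∀ a b c d, r a b c d = -r b a c d)
    (h₂ : ∀ a b c d, r a b c d = -r a b d c) (a b : Fin 4) : ricMatrix r a b = ricMatrix r b a := by
  have h := pairSymm_swap₁ h₁ h₂
  have h' := pairSymm_swap₂ h₁ h₂
  refine Finset.sum_congr rfl fun i _ => ?_
  simp only [algCurvMatrix, bianchi]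
  linarith [h' b i a i, h i b a i, h' a i b i, h i a b i, pairSymm_pair r b i a i,
    h' a b i i, h' b a i i, h a b i i]

/-- The `Λ⁻ ⊗ Λ⁻` component of the Weyl part, in terms of the anti-self-dual curvature. -/
lemma asdAsdPart_weylMatrix (h₁ : ∀ i j, ρ₁ i j = -ρ₁ j i) (h₂ : ∀ i j, ρ₂ i j = -ρ₂ j i)
    (h₃ : ∀ i j, ρ₃ i j = -ρ₃ j i) (a b c d : Fin 4) :
    asdAsdPart (weylMatrix fun i j => asdMatrix (ρ₁ i j) (ρ₂ i j) (ρ₃ i j)) a b c d =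
      asdMatrix
        (asdMatrix ((2 * (ρ₁ 0 1 - ρ₁ 2 3) - (ρ₂ 0 2 + ρ₂ 1 3) - (ρ₃ 0 3 - ρ₃ 1 2)) / 6)
          ((ρ₂ 0 1 - ρ₂ 2 3 + (ρ₁ 0 2 + ρ₁ 1 3)) / 4)
          ((ρ₃ 0 1 - ρ₃ 2 3 + (ρ₁ 0 3 - ρ₁ 1 2)) / 4) c d)
        (asdMatrix ((ρ₂ 0 1 - ρ₂ 2 3 + (ρ₁ 0 2 + ρ₁ 1 3)) / 4)
          ((2 * (ρ₂ 0 2 + ρ₂ 1 3) - (ρ₁ 0 1 - ρ₁ 2 3) - (ρ₃ 0 3 - ρ₃ 1 2)) / 6)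
          ((ρ₃ 0 2 + ρ₃ 1 3 + (ρ₂ 0 3 - ρ₂ 1 2)) / 4) c d)
        (asdMatrix ((ρ₃ 0 1 - ρ₃ 2 3 + (ρ₁ 0 3 - ρ₁ 1 2)) / 4)
          ((ρ₃ 0 2 + ρ₃ 1 3 + (ρ₂ 0 3 - ρ₂ 1 2)) / 4)
          ((2 * (ρ₃ 0 3 - ρ₃ 1 2) - (ρ₁ 0 1 - ρ₁ 2 3) - (ρ₂ 0 2 + ρ₂ 1 3)) / 6) c d) a b := by
  have r1 (a b c d : Fin 4) : (fun i j => asdMatrix (ρ₁ i j) (ρ₂ i j) (ρ₃ i j)) a b c d =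
      -(fun i j => asdMatrix (ρ₁ i j) (ρ₂ i j) (ρ₃ i j)) b a c d := by
    simp only [h₁ a b, h₂ a b, h₃ a b]
    fin_cases c <;> fin_cases d <;> simp [asdMatrix]
  have r2 (a b c d : Fin 4) : (fun i j => asdMatrix (ρ₁ i j) (ρ₂ i j) (ρ₃ i j)) a b c d =
      -(fun i j => asdMatrix (ρ₁ i j) (ρ₂ i j) (ρ₃ i j)) a b d c := asdMatrix_swap _ _ _ _ _
  rw [asdAsdPart_eq _ (weylMatrix_swap₁ r1 r2) (weylMatrix_swap₂ r1 r2)]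
  have hS := scalMatrix_eq h₁ h₂ h₃
  rw [scalMatrix, Fin.sum_univ_four] at hS
  have d1 (i) : ρ₁ i i = 0 := by linarith [h₁ i i]
  have d2 (i) : ρ₂ i i = 0 := by linarith [h₂ i i]
  have d3 (i) : ρ₃ i i = 0 := by linarith [h₃ i i]
  have hr := ricMatrix_symm r1 r2
  simp only [weylMatrix, scalMatrix, Fin.sum_univ_four]
  generalize ricMatrix (fun i j => asdMatrix (ρ₁ i j) (ρ₂ i j) (ρ₃ i j)) = ric at hS hr ⊢
  congr 2 <;>
  simp [kulkarniNomizu, gMatrix, algCurvMatrix, pairSymm, bianchi, asdMatrix,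
    d1, d2, d3, h₁ 1 0, h₁ 2 0, h₁ 3 0, h₁ 2 1, h₁ 3 1, h₁ 3 2, h₂ 1 0, h₂ 2 0, h₂ 3 0, h₂ 2 1,
    h₂ 3 1, h₂ 3 2, h₃ 1 0, h₃ 2 0, h₃ 3 0, h₃ 2 1, h₃ 3 1, h₃ 3 2, hr 1 0, hr 2 0, hr 3 0,
    hr 2 1, hr 3 1, hr 3 2] <;>
  linarith

end Weitzenbock

end Components

/-! ### The Weitzenböck formula in components -/

section Weitzenbock

/-- A symmetric element of `Λ⁻ ⊗ Λ⁻` acts on `Λ⁻` through products of imaginary quaternions. -/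
lemma actMatrix_asdMatrix (w₁₁ w₁₂ w₁₃ w₂₂ w₂₃ w₃₃ s₁ s₂ s₃ : ℝ) :
    actMatrix (fun k l m n => asdMatrix (asdMatrix w₁₁ w₁₂ w₁₃ m n) (asdMatrix w₁₂ w₂₂ w₂₃ m n)
      (asdMatrix w₁₃ w₂₃ w₃₃ m n) k l) (asdMatrix s₁ s₂ s₃) =
      asdMatrix (4 * (w₁₂ * s₂ + w₁₃ * s₃ - (w₂₂ + w₃₃) * s₁))
        (4 * (w₁₂ * s₁ + w₂₃ * s₃ - (w₁₁ + w₃₃) * s₂))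
        (4 * (w₁₃ * s₁ + w₂₃ * s₂ - (w₁₁ + w₂₂) * s₃)) := by
  funext i j
  fin_cases i <;> fin_cases j <;>
    simp [actMatrix, Fin.sum_univ_four, asdMatrix] <;> ring

lemma exists_asdMatrix_eq (i j : Fin 4) : ∃ x₁ x₂ x₃ : ℝ, ∀ c₁ c₂ c₃,
    asdMatrix c₁ c₂ c₃ i j = c₁ * x₁ + c₂ * x₂ + c₃ * x₃ := by
  refine ⟨asdMatrix 1 0 0 i j, asdMatrix 0 1 0 i j, asdMatrix 0 0 1 i j, fun c₁ c₂ c₃ => ?_⟩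
  fin_cases i <;> fin_cases j <;> simp [asdMatrix]

/-- The Weitzenböck formula in components. Here `s`, `G k l` and `δ` are the components of a
form `σ`, of its second covariant derivatives `∇²_{kl} σ` and of `∇_v σ`, all of them
anti-self-dual, `ρ₁, ρ₂, ρ₃` are the components of the curvature, which is anti-self-dual in its
second pair of arguments, and `t` is the matrix of `g(T_v ·, ·)`. The hypotheses are the Ricci
identity `hc`, the Bianchi identity `hb` and the invariance `ht₁, ht₂, ht₃` of `ω` under `T_v`. -/
theorem weitzenbock_matrix {ρ₁ ρ₂ ρ₃ g₁ g₂ g₃ t : Fin 4 → Fin 4 → ℝ} {s₁ s₂ s₃ δ₁ δ₂ δ₃ f : ℝ}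
    (h₁ : ∀ i j, ρ₁ i j = -ρ₁ j i) (h₂ : ∀ i j, ρ₂ i j = -ρ₂ j i) (h₃ : ∀ i j, ρ₃ i j = -ρ₃ j i)
    (hc : ∀ i j k l, asdMatrix (g₁ i j) (g₂ i j) (g₃ i j) k l
        - asdMatrix (g₁ j i) (g₂ j i) (g₃ j i) k l =
      -(∑ m, asdMatrix (ρ₁ i j) (ρ₂ i j) (ρ₃ i j) k m * asdMatrix s₁ s₂ s₃ m l)
        - (∑ m, asdMatrix (ρ₁ i j) (ρ₂ i j) (ρ₃ i j) l m * asdMatrix s₁ s₂ s₃ k m)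
        - omMatrix i j * asdMatrix δ₁ δ₂ δ₃ k l)
    (hb : ∀ i j k l, asdMatrix (ρ₁ i j) (ρ₂ i j) (ρ₃ i j) k l
        + asdMatrix (ρ₁ j k) (ρ₂ j k) (ρ₃ j k) i l + asdMatrix (ρ₁ k i) (ρ₂ k i) (ρ₃ k i) j l =
      omMatrix i j * t k l + omMatrix j k * t i l + omMatrix k i * t j l)
    (ht₁ : t 1 1 = -t 0 0) (ht₂ : t 2 1 = t 0 3) (ht₃ : t 3 1 = -t 0 2)
    (hf : f = (t 1 0 - t 0 1 + t 3 2 - t 2 3) / 2) (i j : Fin 4) :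
    2 * asdPartMatrix (fun u w => -(∑ k, asdMatrix (g₁ u k) (g₂ u k) (g₃ u k) k w)
        + ∑ k, asdMatrix (g₁ w k) (g₂ w k) (g₃ w k) k u) i j =
      -(∑ k, asdMatrix (g₁ k k) (g₂ k k) (g₃ k k) i j)
        + actMatrix (asdAsdPart (weylMatrix fun i j => asdMatrix (ρ₁ i j) (ρ₂ i j) (ρ₃ i j)))
            (asdMatrix s₁ s₂ s₃) i j
        + scalMatrix (fun i j => asdMatrix (ρ₁ i j) (ρ₂ i j) (ρ₃ i j)) / 3
            * asdMatrix s₁ s₂ s₃ i j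
        - 2 / 3 * f * asdMatrix s₁ s₂ s₃ i j := by
  rw [asdPartMatrix_eq _ fun u w => by ring,
    show asdAsdPart (weylMatrix fun i j => asdMatrix (ρ₁ i j) (ρ₂ i j) (ρ₃ i j)) = _ from
      funext fun k => funext fun l => funext fun m => funext fun n =>
        asdAsdPart_weylMatrix h₁ h₂ h₃ k l m n, actMatrix_asdMatrix, scalMatrix_eq h₁ h₂ h₃, hf]
  have hc1 (a b) := hc a b 0 1
  have hc2 (a b) := hc a b 0 2
  have hc3 (a b) := hc a b 0 3
  have b1 := hb 0 1 2 1
  have b2 := hb 0 1 2 3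
  have b3 := hb 0 1 3 1
  have b4 := hb 0 1 3 2
  have b5 := hb 0 2 3 1
  have b6 := hb 0 2 3 2
  have b7 := hb 0 2 3 3
  have b8 := hb 1 2 3 0
  have b9 := hb 0 2 3 0
  have b10 := hb 1 2 3 1
  simp only [Fin.sum_univ_four, asdMatrix, Matrix.cons_val] at hc1 hc2 hc3
  simp only [asdMatrix, omMatrix, h₁ 2 0, h₁ 3 0, h₁ 3 1, h₂ 2 0, h₂ 3 0, h₂ 3 1,
    h₃ 2 0, h₃ 3 0, h₃ 3 1, Matrix.cons_val] at b1 b2 b3 b4 b5 b6 b7 b8 b9 b10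
  obtain ⟨x₁, x₂, x₃, hx⟩ := exists_asdMatrix_eq i j
  simp only [hx, Fin.sum_univ_four]
  simp only [asdMatrix, Matrix.cons_val]
  -- Anti-self-dual forms have three coefficients, with weights `x₁, x₂, x₃`. In each of them `hc`
  -- turns commutators of second derivatives into curvature, with the derivative along `v`
  -- cancelling; the Bianchi identities and `ht₁, ht₂, ht₃` then leave the trace of the curvature,
  -- its Weyl part and the function `f`.
  linear_combination (norm := skip)
    x₁ * (-hc3 0 2 + hc2 0 3 - hc2 1 2 - hc3 1 3 - s₃ * b1 + s₁ / 3 * (b2 - b4 + b5 - b8)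
      + s₂ * (b3 + b6) + s₃ * b7 - s₃ * ht₂ + s₂ * ht₃)
    + x₂ * (hc3 0 1 - hc1 0 3 + hc1 1 2 - hc3 2 3 + s₂ / 3 * (b2 - b4 + b5 - b8)
      - s₁ * (b3 + b6) + s₃ * (b9 + b10) + s₃ * ht₁ - s₁ * ht₃)
    + x₃ * (-hc2 0 1 + hc1 0 2 + hc1 1 3 + hc2 2 3 + s₁ * (b1 - b7)
      + s₃ / 3 * (b2 - b4 + b5 - b8) - s₂ * (b9 + b10) - s₂ * ht₁ + s₁ * ht₂)
  simp only [omMatrix, Matrix.cons_val]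
  ring

end Weitzenbock

/-! ### The distinguished connection -/

namespace ContactHyperkahler

variable {M : Type*} [TopologicalSpace M] [ChartedSpace (EuclideanSpace ℝ (Fin 5)) M]
  [IsManifold (𝓡 5) ∞ M] [T2Space M] (S : ContactHyperkahler M) (cov : Connection M)

/-- The linear algebra at the point `x`. The connection only serves to see that `ω` is a tensor. -/
def toSpace (x : M) : HyperkahlerSpace (TangentSpace (𝓡 5) x) where
  th := S.θ x
  v := S.v x
  om := S.om x
  al := S.al x
  be := S.be x
  I := cplxStr S.th S.al S.be
  J := cplxStr S.th S.be S.om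
  K := cplxStr S.th S.om S.al
  alt_om := S.isAltForm_om cov x
  alt_al := S.isPair_al_be.alt_fst x
  alt_be := S.isPair_al_be.alt_snd x
  th_v := (S.reeb_spec cov x).1
  om_v := (S.reeb_spec cov x).2
  al_v := S.horizontal_α x
  be_v := S.horizontal_β x
  th_I u := (S.isPair_al_be.cplx_spec cov u).1
  th_J u := ((S.isPair_be_om cov).cplx_spec cov u).1
  th_K u := ((S.isPair_om_al cov).cplx_spec cov u).1
  al_I u z := ((S.isPair_al_be.cplx_spec cov u).2 z).1
  be_I u z := ((S.isPair_al_be.cplx_spec cov u).2 z).2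
  be_J u z := (((S.isPair_be_om cov).cplx_spec cov u).2 z).1
  om_J u z := (((S.isPair_be_om cov).cplx_spec cov u).2 z).2
  om_K u z := (((S.isPair_om_al cov).cplx_spec cov u).2 z).1
  al_K u z := (((S.isPair_om_al cov).cplx_spec cov u).2 z).2
  nondeg _ hu h := S.isPair_al_be.eq_zero cov hu h
  pos := S.pos x
  finrank_eq := finrank_tangentSpace x

lemma isFrame_frame (x : M) : (S.toSpace cov x).IsFrame (S.frame x) := by
  obtain ⟨e, he, h1⟩ := (S.toSpace cov x).exists_unit
  have hq := (S.toSpace cov x).isFrame_quat he h1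
  obtain ⟨h2, h3⟩ := Classical.epsilon_spec (p := fun e : Fin 4 → TangentSpace (𝓡 5) x =>
    (∀ i, S.θ x (e i) = 0) ∧ ∀ i j, S.gH x (e i) (e j) = if i = j then 1 else 0)
    ⟨_, hq.th_eq, hq.gH_eq⟩
  exact ⟨h2, h3⟩

lemma isTensor2_gH (cov : Connection M) : IsTensor2 S.gH where
  left W hW := (S.isTensor2_om cov).left _ (S.isPair_al_be.smoothField_cplx cov hW)
  right W hW := by
    have : (fun y u => S.gH y (W y) u) = fun y u => S.gH y u (W y) :=
      funext fun y => funext fun u => (S.toSpace cov y).gH_comm _ _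
    rw [this]
    exact (S.isTensor2_om cov).left _ (S.isPair_al_be.smoothField_cplx cov hW)

lemma smoothField_πH (cov : Connection M) {X : VField M} (hX : SmoothField X) :
    SmoothField (fun y => S.πH (X y)) :=
  hX.sub (SmoothField.smul (S.smooth_θ X hX) (S.smoothField_v cov))

variable {S cov}

namespace IsAdapted

/-- The projection to `H` and the form `θ` are parallel. -/
lemma cov_th (h : S.IsAdapted cov) {X : VField M} (hX : SmoothField X) {x : M}
    (u : TangentSpace (𝓡 5) x) :
    cov (fun y => S.πH (X y)) x u = S.πH (cov X x u) ∧
      S.θ x (cov X x u) = dirD (fun y => S.θ y (X y)) u := by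
  have hθ : SmoothFun (fun y => S.θ y (X y)) := S.smooth_θ X hX
  have hπ := S.smoothField_πH cov hX
  have h0 : S.θ x (cov (fun y => S.πH (X y)) x u) = 0 :=
    h.preserves _ x u (hπ.diffAt x) fun y => (S.toSpace cov y).th_pr _
  have hv := S.smoothField_v cov
  have e : cov X x u = cov (fun y => S.πH (X y)) x u
      + dirD (fun y => S.θ y (X y)) u • S.v x := by
    have e1 : X = (fun y => S.πH (X y)) + (fun y => S.θ y (X y)) • S.v :=
      funext fun y => (S.toSpace cov y).pr_add_smul_v _
    conv_lhs => rw [e1]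
    rw [cov.isCovariantDerivativeOnUniv.add (hπ.diffAt x)
        (show DiffFieldAt ((fun y => S.θ y (X y)) • S.v) x from
          (SmoothField.smul hθ hv).diffAt x),
      cov.isCovariantDerivativeOnUniv.leibniz (hv.diffAt x) (hθ.diffAt x)]
    simp [dirD, h.reeb_parallel x u]
  have e2 : S.θ x (cov X x u) = dirD (fun y => S.θ y (X y)) u := by
    rw [e, map_add, h0, map_smul, (S.reeb_spec cov x).1]; simp
  refine ⟨?_, e2⟩
  rw [πH, e2, e]; abel

/-- The almost complex structure of a pair of parallel forms is parallel. -/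
lemma cov_cplx (h : S.IsAdapted cov) {a b : Tensor2 M} (hab : S.IsPair a b)
    (ha : ∀ x u w z, covD2 cov a x u w z = 0) (hb : ∀ x u w z, covD2 cov b x u w z = 0)
    {X : VField M} (hX : SmoothField X) {x : M} (u : TangentSpace (𝓡 5) x) :
    cov (fun y => cplxStr S.th a b (X y)) x u = cplxStr S.th a b (cov X x u) := by
  have hI := hab.smoothField_cplx cov hX
  refine hab.eq_of_forall cov
    (h.preserves _ x u (hI.diffAt x) fun y => (hab.cplx_spec cov _).1) (hab.cplx_spec cov _).1
    fun z => ?_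
  have hZ := smoothField_gext z
  have h1 := hab.tensor_fst.covD2_eq cov u hI hZ
  have h2 := hab.tensor_snd.covD2_eq cov u hX hZ
  have h3 : (fun y => a y (cplxStr S.th a b (X y)) (gext z y)) = fun y => -b y (X y) (gext z y) :=
    funext fun y => ((hab.cplx_spec cov _).2 _).1
  rw [ha, h3, dirD_neg, ((hab.cplx_spec cov _).2 _).1] at h1
  rw [hb] at h2
  rw [((hab.cplx_spec cov _).2 _).1]
  rw [gext_self] at h1 h2
  linarith

end IsAdapted

namespace IsDistinguished

lemma cov_I (h : S.IsDistinguished cov) {X : VField M} (hX : SmoothField X) {x : M}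
    (u : TangentSpace (𝓡 5) x) :
    cov (fun y => (S.toSpace cov y).I (X y)) x u = (S.toSpace cov x).I (cov X x u) :=
  h.toIsAdapted.cov_cplx S.isPair_al_be h.parallel_α h.parallel_β hX u

lemma cov_J (h : S.IsDistinguished cov) {X : VField M} (hX : SmoothField X) {x : M}
    (u : TangentSpace (𝓡 5) x) :
    cov (fun y => (S.toSpace cov y).J (X y)) x u = (S.toSpace cov x).J (cov X x u) :=
  h.toIsAdapted.cov_cplx (S.isPair_be_om cov) h.parallel_β h.parallel_ω hX u

lemma cov_K (h : S.IsDistinguished cov) {X : VField M} (hX : SmoothField X) {x : M}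
    (u : TangentSpace (𝓡 5) x) :
    cov (fun y => (S.toSpace cov y).K (X y)) x u = (S.toSpace cov x).K (cov X x u) :=
  h.toIsAdapted.cov_cplx (S.isPair_om_al cov) h.parallel_ω h.parallel_α hX u

lemma dirD_gH (h : S.IsDistinguished cov) {X Y : VField M} (hX : SmoothField X)
    (hY : SmoothField Y) {x : M} (u : TangentSpace (𝓡 5) x) :
    dirD (fun y => S.gH y (X y) (Y y)) u = S.gH x (cov X x u) (Y x) + S.gH x (X x) (cov Y x u) := by
  have h1 := (S.isTensor2_om cov).covD2_eq cov u hX (S.isPair_al_be.smoothField_cplx cov hY)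
  rw [h.parallel_ω, h.toIsAdapted.cov_cplx S.isPair_al_be h.parallel_α h.parallel_β hY] at h1
  simp only [gH]
  linarith

lemma covD1_th (h : S.IsDistinguished cov) {x : M} (z a : TangentSpace (𝓡 5) x) :
    covD1 cov S.th x z a = 0 := by
  have e := covD1_eq cov S.isTensor1_th z ((smoothField_gext a).diffAt x)
  rw [gext_self] at e
  rw [e]
  exact sub_eq_zero.2 (h.toIsAdapted.cov_th (smoothField_gext a) z).2.symm

lemma th_torsion (h : S.IsDistinguished cov) {x : M} (u w : TangentSpace (𝓡 5) x) :
    S.θ x (torsion cov u w) = S.om x u w := by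
  rw [om, extD1_eq cov S.isTensor1_th, h.covD1_th, h.covD1_th]
  simp [th]

/-- The torsion of two vectors of `H` is vertical, with `ω` as its component. -/
lemma torsion_of_mem (h : S.IsDistinguished cov) {x : M} {u w : TangentSpace (𝓡 5) x}
    (hu : S.θ x u = 0) (hw : S.θ x w = 0) : torsion cov u w = S.om x u w • S.v x := by
  have h1 := h.torsion_H x u w hu hw
  rw [← h.th_torsion]
  exact sub_eq_zero.1 h1

end IsDistinguished

end ContactHyperkahler

/-! ### Hodge stars and anti-self-dual forms -/

section Multilinear

variable {V : Type*} [AddCommGroup V] [Module ℝ V]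

/-- Linear functionals, as functions. -/
structure IsLin (φ : V → ℝ) : Prop where
  add : ∀ u w, φ (u + w) = φ u + φ w
  smul : ∀ (c : ℝ) u, φ (c • u) = c * φ u

/-- Bilinear forms, as functions. -/
structure IsBilin (B : V → V → ℝ) : Prop where
  left : ∀ w, IsLin (fun u => B u w)
  right : ∀ u, IsLin (fun w => B u w)

/-- Trilinear forms, as functions. -/
structure IsTrilin (τ : V → V → V → ℝ) : Prop where
  fst : ∀ w z, IsLin (fun u => τ u w z)
  snd : ∀ u z, IsLin (fun w => τ u w z)
  trd : ∀ u w, IsLin (fun z => τ u w z)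

namespace IsLin

variable {φ ψ : V → ℝ}

lemma zero (h : IsLin φ) : φ 0 = 0 := by simpa using h.smul 0 0

lemma neg (h : IsLin φ) (u : V) : φ (-u) = -φ u := by
  rw [← neg_one_smul ℝ, h.smul]; ring

lemma sum (h : IsLin φ) {ι : Type*} (s : Finset ι) (f : ι → V) :
    φ (∑ i ∈ s, f i) = ∑ i ∈ s, φ (f i) := by
  classical
  induction s using Finset.induction_on with
  | empty => simp [h.zero]
  | insert a s ha ih => rw [Finset.sum_insert ha, Finset.sum_insert ha, h.add, ih]

lemma mul_const (h : IsLin φ) (c : ℝ) : IsLin (fun u => φ u * c) :=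
  ⟨fun u w => by rw [h.add]; ring, fun a u => by rw [h.smul]; ring⟩

lemma const_mul (h : IsLin φ) (c : ℝ) : IsLin (fun u => c * φ u) :=
  ⟨fun u w => by rw [h.add]; ring, fun a u => by rw [h.smul]; ring⟩

lemma add' (h : IsLin φ) (h' : IsLin ψ) : IsLin (fun u => φ u + ψ u) :=
  ⟨fun u w => by rw [h.add, h'.add]; ring, fun a u => by rw [h.smul, h'.smul]; ring⟩

lemma sub' (h : IsLin φ) (h' : IsLin ψ) : IsLin (fun u => φ u - ψ u) :=
  ⟨fun u w => by rw [h.add, h'.add]; ring, fun a u => by rw [h.smul, h'.smul]; ring⟩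

lemma neg' (h : IsLin φ) : IsLin (fun u => -φ u) :=
  ⟨fun u w => by rw [h.add]; ring, fun a u => by rw [h.smul]; ring⟩

lemma sum' {ι : Type*} (s : Finset ι) {φ : ι → V → ℝ} (h : ∀ i, IsLin (φ i)) :
    IsLin (fun u => ∑ i ∈ s, φ i u) :=
  ⟨fun u w => by simp only [(h _).add, Finset.sum_add_distrib],
    fun a u => by simp only [(h _).smul, Finset.mul_sum]⟩

lemma mul (h : IsLin φ) (h' : IsLin ψ) : IsBilin (fun p r => φ p * ψ r) :=
  ⟨fun _ => h.mul_const _, fun _ => h'.const_mul _⟩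

end IsLin

lemma IsAltForm.isBilin {B : V → V → ℝ} (h : IsAltForm B) : IsBilin B :=
  ⟨fun w => ⟨fun u u' => h.add_left u u' w, fun c u => h.smul_left c u w⟩,
    fun w => ⟨h.add_right w, fun c u => h.smul_right c w u⟩⟩

namespace IsBilin

variable {B : V → V → ℝ}

/-- The bundled bilinear map. -/
def toMap (h : IsBilin B) : V →ₗ[ℝ] V →ₗ[ℝ] ℝ :=
  LinearMap.mk₂ ℝ B (fun u u' w => (h.left w).add u u') (fun c u w => (h.left w).smul c u)
    (fun u w w' => (h.right u).add w w') (fun c u w => (h.right u).smul c w)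

end IsBilin

namespace HyperkahlerSpace

variable (Q : HyperkahlerSpace V)

namespace IsFrame

variable {Q} {f f' : Fin 4 → V}

/-- Expansion of a horizontal functional in an orthonormal frame. -/
lemma isLin_expand (hf : Q.IsFrame f) {φ : V → ℝ} (hφ : IsLin φ) (hv : φ Q.v = 0) (u : V) :
    φ u = ∑ i, Q.gH u (f i) * φ (f i) := by
  have h : φ u = φ (Q.pr u) := by
    conv_lhs => rw [Q.pr_add_smul_v u, hφ.add, hφ.smul, hv]
    ring
  rw [h, hf.pr_eq, hφ.sum]
  simp only [hφ.smul]

lemma isLin_ext (hf : Q.IsFrame f) {φ ψ : V → ℝ} (hφ : IsLin φ) (hψ : IsLin ψ) (hv : φ Q.v = 0)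
    (hv' : ψ Q.v = 0) (h : ∀ i, φ (f i) = ψ (f i)) (u : V) : φ u = ψ u := by
  rw [hf.isLin_expand hφ hv, hf.isLin_expand hψ hv']
  simp only [h]

lemma isBilin_ext (hf : Q.IsFrame f) {B B' : V → V → ℝ} (hB : IsBilin B) (hB' : IsBilin B')
    (h₁ : ∀ w, B Q.v w = 0) (h₂ : ∀ w, B w Q.v = 0) (h₁' : ∀ w, B' Q.v w = 0)
    (h₂' : ∀ w, B' w Q.v = 0) (h : ∀ i j, B (f i) (f j) = B' (f i) (f j)) (u w : V) :
    B u w = B' u w :=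
  hf.isLin_ext (hB.left w) (hB'.left w) (h₁ w) (h₁' w)
    (fun i => hf.isLin_ext (hB.right _) (hB'.right _) (h₂ _) (h₂' _) (h i) w) u

lemma trace_eq (hf : Q.IsFrame f) (hf' : Q.IsFrame f') {B : V → V → ℝ} (hB : IsBilin B) :
    ∑ i, B (f i) (f i) = ∑ i, B (f' i) (f' i) := hf.sum_eq hf' hB.toMap

lemma trace₂_eq (hf : Q.IsFrame f) (hf' : Q.IsFrame f') {F : V → V → V → V → ℝ}
    (h₁ : ∀ r r', IsBilin (fun p p' => F p p' r r')) (h₂ : ∀ p p', IsBilin (F p p')) :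
    ∑ i, ∑ j, F (f i) (f i) (f j) (f j) = ∑ i, ∑ j, F (f' i) (f' i) (f' j) (f' j) := by
  simp only [hf.trace_eq hf' (h₂ _ _)]
  rw [Finset.sum_comm, Finset.sum_comm (s := Finset.univ (α := Fin 4))
    (f := fun i j => F (f' i) _ _ _)]
  exact Finset.sum_congr rfl fun j _ => hf.trace_eq hf' (h₁ _ _)

end IsFrame

/-- The volume form `ω ∧ ω / 2`. -/
def vol (a b c d : V) : ℝ := wedge Q.om Q.om a b c d / 2

/-- The Hodge star on `2`-forms, computed in the frame `f`. -/
def star2 (f : Fin 4 → V) (B : V → V → ℝ) (u w : V) : ℝ :=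
  (∑ i, ∑ j, B (f i) (f j) * Q.vol (f i) (f j) u w) / 2

/-- The Hodge star on `3`-forms, computed in the frame `f`. -/
def star3 (f : Fin 4 → V) (τ : V → V → V → ℝ) (u : V) : ℝ :=
  (∑ i, ∑ j, ∑ k, τ (f i) (f j) (f k) * Q.vol (f i) (f j) (f k) u) / 6

lemma vol_lin₁ (b c d : V) : IsLin (fun a => Q.vol a b c d) :=
  ⟨fun u w => by simp only [vol, wedge, Q.alt_om.add_left]; ring,
    fun a u => by simp only [vol, wedge, Q.alt_om.smul_left]; ring⟩

lemma vol_lin₂ (a c d : V) : IsLin (fun b => Q.vol a b c d) :=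
  ⟨fun u w => by simp only [vol, wedge, Q.alt_om.add_left, Q.alt_om.add_right]; ring,
    fun a u => by simp only [vol, wedge, Q.alt_om.smul_left, Q.alt_om.smul_right]; ring⟩

lemma vol_lin₃ (a b d : V) : IsLin (fun c => Q.vol a b c d) :=
  ⟨fun u w => by simp only [vol, wedge, Q.alt_om.add_left, Q.alt_om.add_right]; ring,
    fun a u => by simp only [vol, wedge, Q.alt_om.smul_left, Q.alt_om.smul_right]; ring⟩

lemma vol_lin₄ (a b c : V) : IsLin (fun d => Q.vol a b c d) :=
  ⟨fun u w => by simp only [vol, wedge, Q.alt_om.add_right]; ring,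
    fun a u => by simp only [vol, wedge, Q.alt_om.smul_right]; ring⟩

lemma om_v_right (w : V) : Q.om w Q.v = 0 := by rw [Q.alt_om.swap, Q.om_v, neg_zero]

lemma vol_v₃ (a b d : V) : Q.vol a b Q.v d = 0 := by
  simp [vol, wedge, Q.om_v, Q.om_v_right]

lemma vol_v₄ (a b c : V) : Q.vol a b c Q.v = 0 := by
  simp [vol, wedge, Q.om_v_right]

lemma isBilin_star2 (f : Fin 4 → V) (B : V → V → ℝ) : IsBilin (Q.star2 f B) :=
  ⟨fun w => (IsLin.sum' _ fun i => IsLin.sum' _ fun j =>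
      ((Q.vol_lin₃ _ _ w).const_mul _)).mul_const _ |> fun h => by
        simpa only [star2, div_eq_mul_inv] using h,
    fun w => (IsLin.sum' _ fun i => IsLin.sum' _ fun j =>
      ((Q.vol_lin₄ _ _ w).const_mul _)).mul_const _ |> fun h => by
        simpa only [star2, div_eq_mul_inv] using h⟩

lemma star2_v_left (f : Fin 4 → V) (B : V → V → ℝ) (w : V) : Q.star2 f B Q.v w = 0 := by
  simp [star2, vol_v₃]

lemma star2_v_right (f : Fin 4 → V) (B : V → V → ℝ) (w : V) : Q.star2 f B w Q.v = 0 := by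
  simp [star2, vol_v₄]

lemma isLin_star3 (f : Fin 4 → V) (τ : V → V → V → ℝ) : IsLin (Q.star3 f τ) := by
  have h := (IsLin.sum' (Finset.univ (α := Fin 4)) fun i => IsLin.sum' (Finset.univ (α := Fin 4))
    fun j => IsLin.sum' (Finset.univ (α := Fin 4)) fun k =>
      (Q.vol_lin₄ (f i) (f j) (f k)).const_mul (τ (f i) (f j) (f k))).mul_const 6⁻¹
  have e : Q.star3 f τ = fun u => _ * 6⁻¹ := funext fun u => div_eq_mul_inv _ _
  rw [e]
  exact h

lemma star3_v (f : Fin 4 → V) (τ : V → V → V → ℝ) : Q.star3 f τ Q.v = 0 := by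
  simp [star3, vol_v₄]

variable {Q} {f f' : Fin 4 → V}

/-- The Hodge star does not depend on the orthonormal frame. -/
lemma IsFrame.star2_eq (hf : Q.IsFrame f) (hf' : Q.IsFrame f') {B : V → V → ℝ} (hB : IsBilin B) :
    Q.star2 f B = Q.star2 f' B := by
  funext u w
  rw [star2, star2, hf.trace₂_eq hf' (F := fun p p' r r' => B p r * Q.vol p' r' u w)
    (fun r r' => (hB.left r).mul (Q.vol_lin₁ _ _ _))
    (fun p p' => (hB.right p).mul (Q.vol_lin₂ _ _ _))]

lemma IsFrame.star3_eq (hf : Q.IsFrame f) (hf' : Q.IsFrame f') {τ : V → V → V → ℝ}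
    (hτ : IsTrilin τ) : Q.star3 f τ = Q.star3 f' τ := by
  funext u
  rw [star3, star3]
  congr 1
  have h1 (i : Fin 4) : ∑ j, ∑ k, τ (f i) (f j) (f k) * Q.vol (f i) (f j) (f k) u =
      ∑ j, ∑ k, τ (f i) (f' j) (f' k) * Q.vol (f i) (f' j) (f' k) u :=
    hf.trace₂_eq hf' (F := fun p p' r r' => τ (f i) p r * Q.vol (f i) p' r' u)
      (fun r r' => (hτ.snd _ r).mul (Q.vol_lin₂ _ _ _))
      (fun p p' => (hτ.trd _ p).mul (Q.vol_lin₃ _ _ _))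
  simp only [h1]
  have h2 := hf.trace_eq hf'
    (B := fun p p' => ∑ j, ∑ k, τ p (f' j) (f' k) * Q.vol p' (f' j) (f' k) u)
    ⟨fun w => IsLin.sum' _ fun j => IsLin.sum' _ fun k => (hτ.fst _ _).mul_const _,
      fun w => IsLin.sum' _ fun j => IsLin.sum' _ fun k => (Q.vol_lin₁ _ _ _).const_mul _⟩
  exact h2

/-- Anti-self-dual forms: horizontal `2`-forms `B`, whose endomorphisms of `H` commute with
the almost complex structures. -/
structure IsAsd (Q : HyperkahlerSpace V) (B : V → V → ℝ) : Prop where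
  alt : IsAltForm B
  v_left : ∀ w, B Q.v w = 0
  I_left : ∀ u w, B (Q.I u) w = -B u (Q.I w)
  J_left : ∀ u w, B (Q.J u) w = -B u (Q.J w)

lemma om_quat {e : V} (he : Q.th e = 0) (h1 : Q.gH e e = 1) (i j : Fin 4) :
    Q.om (Q.quat e i) (Q.quat e j) = omMatrix i j := by
  have hf := Q.isFrame_quat he h1
  have hI : ∀ i, Q.I (Q.quat e i) = ∑ k, omMatrix i k • Q.quat e k := by
    intro i
    fin_cases i <;> simp [quat, omMatrix, Fin.sum_univ_four, I_I_of_mem _ he, I_J, I_K]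
  rw [← gH_I, hI]
  have hl : IsLin (fun u => Q.gH u (Q.quat e j)) :=
    ⟨fun u w => Q.gH_add_left u w _, fun c u => Q.gH_smul_left c u _⟩
  rw [hl.sum]
  simp [hl.smul, hf.gH_eq]

namespace IsAsd

variable {B : V → V → ℝ}

lemma v_right (h : Q.IsAsd B) (w : V) : B w Q.v = 0 := by rw [h.alt.swap, h.v_left, neg_zero]

/-- The components of an anti-self-dual form in a quaternionic frame are given by three of them. -/
lemma quat_eq (h : Q.IsAsd B) (e : V) (i j : Fin 4) :
    B (Q.quat e i) (Q.quat e j) =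
      asdMatrix (B e (Q.I e)) (B e (Q.J e)) (B e (Q.K e)) i j := by
  have hn (u w) : B (-u) w = -B u w := (h.alt.isBilin.left w).neg u
  have hn' (u w) : B u (-w) = -B u w := (h.alt.isBilin.right u).neg w
  have e12 : B (Q.I e) (Q.J e) = -B e (Q.K e) := by rw [h.I_left, I_J]
  have e13 : B (Q.I e) (Q.K e) = B e (Q.J e) := by rw [h.I_left, I_K, hn', neg_neg]
  have e23 : B (Q.J e) (Q.K e) = -B e (Q.I e) := by rw [h.J_left, J_K]
  fin_cases i <;> fin_cases j <;>
    simp [quat, asdMatrix, h.alt.self, e12, e13, e23, h.alt.swap _ e, h.alt.swap (Q.J e) (Q.I e),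
      h.alt.swap (Q.K e) (Q.I e), h.alt.swap (Q.K e) (Q.J e)]

lemma neg (h : Q.IsAsd B) : Q.IsAsd (fun u w => -B u w) where
  alt := ⟨fun u u' w => by rw [h.alt.add_left]; ring, fun c u w => by rw [h.alt.smul_left]; ring,
    fun u w => by rw [h.alt.swap]⟩
  v_left w := by rw [h.v_left, neg_zero]
  I_left u w := by rw [h.I_left]
  J_left u w := by rw [h.J_left]

/-- Forms in the `-1` eigenspace of the Hodge star are anti-self-dual. -/
lemma of_star2 (hf : Q.IsFrame f) (hB : IsAltForm B) (hv : ∀ w, B Q.v w = 0)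
    (h : ∀ u w, Q.star2 f B u w = -B u w) : Q.IsAsd B := by
  obtain ⟨e, he, h1⟩ := Q.exists_unit
  have hq := Q.isFrame_quat he h1
  have hs (i j) : starMatrix (fun k l => B (Q.quat e k) (Q.quat e l)) i j =
      -B (Q.quat e i) (Q.quat e j) := by
    rw [← h, hf.star2_eq hq hB.isBilin]
    simp only [starMatrix, star2, vol, wedge, om_quat he h1]
  rw [starMatrix_eq] at hs
  have e12 : B (Q.I e) (Q.J e) = -B e (Q.K e) := by
    have := hs 0 3
    simp [quat, hB.swap (Q.J e) (Q.I e)] at this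
    linarith
  have e13 : B (Q.I e) (Q.K e) = B e (Q.J e) := by
    have := hs 0 2
    simp [quat, hB.swap (Q.K e) (Q.I e)] at this
    linarith
  have e23 : B (Q.J e) (Q.K e) = -B e (Q.I e) := by
    have := hs 0 1
    simp [quat, hB.swap (Q.K e) (Q.J e)] at this
    linarith
  have hn (u w) : B (-u) w = -B u w := (hB.isBilin.left w).neg u
  have hn' (u w) : B u (-w) = -B u w := (hB.isBilin.right u).neg w
  have hvr (u) : B u Q.v = 0 := by rw [hB.swap, hv, neg_zero]
  have h0 (w) : B 0 w = 0 := (hB.isBilin.left w).zero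
  have h0' (w) : B w 0 = 0 := (hB.isBilin.right w).zero
  refine ⟨hB, hv, ?_, ?_⟩
  · refine hq.isBilin_ext (B := fun u w => B (Q.I u) w) (B' := fun u w => -B u (Q.I w))
      ⟨fun w => ⟨fun u u' => ?_, fun c u => ?_⟩, fun u => hB.isBilin.right _⟩
      ⟨fun w => (hB.isBilin.left _).neg', fun u => ⟨fun w w' => ?_, fun c w => ?_⟩⟩
      (fun w => ?_) (fun w => ?_) (fun w => ?_) (fun w => ?_) (fun i j => ?_)
    · rw [Q.I_add, hB.add_left]
    · rw [Q.I_smul, hB.smul_left]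
    · rw [Q.I_add, hB.add_right]; ring
    · rw [Q.I_smul, hB.smul_right]; ring
    · rw [Q.I_v, h0]
    · exact hvr _
    · rw [hv, neg_zero]
    · rw [Q.I_v, h0', neg_zero]
    · fin_cases i <;> fin_cases j <;>
        simp [quat, Q.I_I_of_mem he, Q.I_J, Q.I_K, hn, hn', hB.self, e12, e13, e23,
          hB.swap _ e, hB.swap (Q.J e) (Q.I e), hB.swap (Q.K e) (Q.I e), hB.swap (Q.K e) (Q.J e)]
  · have hJ : Q.J (Q.J e) = -e := by rw [Q.J_J, Q.pr_of_mem he]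
    refine hq.isBilin_ext (B := fun u w => B (Q.J u) w) (B' := fun u w => -B u (Q.J w))
      ⟨fun w => ⟨fun u u' => ?_, fun c u => ?_⟩, fun u => hB.isBilin.right _⟩
      ⟨fun w => (hB.isBilin.left _).neg', fun u => ⟨fun w w' => ?_, fun c w => ?_⟩⟩
      (fun w => ?_) (fun w => ?_) (fun w => ?_) (fun w => ?_) (fun i j => ?_)
    · rw [Q.J_add, hB.add_left]
    · rw [Q.J_smul, hB.smul_left]
    · rw [Q.J_add, hB.add_right]; ring
    · rw [Q.J_smul, hB.smul_right]; ring
    · rw [Q.J_v, h0]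
    · exact hvr _
    · rw [hv, neg_zero]
    · rw [Q.J_v, h0', neg_zero]
    · fin_cases i <;> fin_cases j <;>
        simp [quat, hJ, Q.J_I, Q.J_K, hn, hn', hB.self, e12, e13, e23,
          hB.swap _ e, hB.swap (Q.J e) (Q.I e), hB.swap (Q.K e) (Q.I e), hB.swap (Q.K e) (Q.J e)]

end IsAsd

/-- For a `1`-form `D` with values in anti-self-dual forms, such as `∇σ`, the Hodge star of the
alternation of `D` is the contraction of `D`. -/
lemma IsFrame.star3_alternation (hf : Q.IsFrame f) {D : V → V → V → ℝ}
    (hD : ∀ w z, IsLin (fun u => D u w z)) (hasd : ∀ u, Q.IsAsd (D u)) (u : V) :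
    Q.star3 f (fun u w z => D u w z - D w u z + D z u w) u = -∑ i, D (f i) (f i) u := by
  obtain ⟨e, he, h1⟩ := Q.exists_unit
  have hq := Q.isFrame_quat he h1
  have hl (u z) := (hasd u).alt.isBilin.left z
  have hr (u w) := (hasd u).alt.isBilin.right w
  rw [hf.star3_eq hq ⟨fun w z => ((hD w z).sub' (hl w z)).add' (hl z w),
    fun w z => ((hl w z).sub' (hD w z)).add' (hr z w),
    fun w z => ((hr w z).sub' (hr z w)).add' (hD w z)⟩,
    hf.trace_eq hq (B := fun p r => D p r u) ⟨fun w => hD w u, fun w => hl w u⟩]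
  refine hq.isLin_ext (Q.isLin_star3 _ _) (IsLin.neg' (IsLin.sum' _ fun i => hr _ _))
    (Q.star3_v _ _) (by simp [(hasd _).v_right]) (fun l => ?_) u
  simp only [star3, Fin.sum_univ_four, (hasd _).quat_eq, vol, wedge, om_quat he h1]
  fin_cases l <;> simp [asdMatrix, omMatrix] <;> ring

end HyperkahlerSpace

end Multilinear

/-! ### Covariant derivatives of anti-self-dual forms -/

namespace ContactHyperkahler

variable {M : Type*} [TopologicalSpace M] [ChartedSpace (EuclideanSpace ℝ (Fin 5)) M]
  [IsManifold (𝓡 5) ∞ M] {S : ContactHyperkahler M} {cov : Connection M}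

lemma IsASDForm.isTensor2 {σ : Π x : M, LinearMap.BilinForm ℝ (TangentSpace (𝓡 5) x)}
    (hσ : S.IsASDForm σ) : IsTensor2 (fun x u w => σ x u w) := isTensor2_of_bilin hσ.smooth

lemma covD2_neg (η : Tensor2 M) (x : M) (u w z : TangentSpace (𝓡 5) x) :
    covD2 cov (fun y p r => -η y p r) x u w z = -covD2 cov η x u w z := by
  simp only [covD2, dirD_neg]
  ring

variable [T2Space M]

lemma _root_.ContactGeom.HyperkahlerSpace.IsAsd.sub {V : Type*} [AddCommGroup V] [Module ℝ V]
    {Q : HyperkahlerSpace V} {B C : V → V → ℝ} (hB : Q.IsAsd B) (hC : Q.IsAsd C) :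
    Q.IsAsd (fun u w => B u w - C u w) where
  alt := ⟨fun u u' w => by rw [hB.alt.add_left, hC.alt.add_left]; ring,
    fun c u w => by rw [hB.alt.smul_left, hC.alt.smul_left]; ring,
    fun u w => by rw [hB.alt.swap, hC.alt.swap]; ring⟩
  v_left w := by rw [hB.v_left, hC.v_left, sub_zero]
  I_left u w := by rw [hB.I_left, hC.I_left]; ring
  J_left u w := by rw [hB.J_left, hC.J_left]; ring

lemma IsASDForm.isAsd {σ : Π x : M, LinearMap.BilinForm ℝ (TangentSpace (𝓡 5) x)}
    (hσ : S.IsASDForm σ) (cov : Connection M) (x : M) :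
    (S.toSpace cov x).IsAsd (fun u w => σ x u w) :=
  HyperkahlerSpace.IsAsd.of_star2 (S.isFrame_frame cov x)
    ⟨hσ.isTensor2.add_left x, hσ.isTensor2.smul_left x, swap_of_alt (hσ.alt x)⟩
    (hσ.horizontal x) (hσ.asd x)

section Covariant

variable {η : Tensor2 M} {τ : Tensor3 M}

/-- Covariant derivatives of anti-self-dual forms are anti-self-dual. -/
lemma IsDistinguished.isAsd_covD2 [CovariantDerivative.ContMDiffCovariantDerivative cov ∞]
    (h : S.IsDistinguished cov) (hη : IsTensor2 η)
    (ha : ∀ y, (S.toSpace cov y).IsAsd (η y)) (x : M) (u : TangentSpace (𝓡 5) x) :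
    (S.toSpace cov x).IsAsd (covD2 cov η x u) := by
  have e {W Z : VField M} (hW : SmoothField W) (hZ : SmoothField Z) := hη.covD2_eq cov u hW hZ
  have swap (w z : TangentSpace (𝓡 5) x) : covD2 cov η x u w z = -covD2 cov η x u z w := by
    have h1 := e (smoothField_gext w) (smoothField_gext z)
    have h2 := e (smoothField_gext z) (smoothField_gext w)
    have h3 : (fun y => η y (gext z y) (gext w y)) = fun y => -η y (gext w y) (gext z y) :=
      funext fun y => (ha y).alt.swap _ _
    rw [h3, dirD_neg, (ha x).alt.swap _ (gext w x), (ha x).alt.swap (gext z x)] at h2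
    rw [gext_self, gext_self] at h1 h2
    linarith
  have comm {A : Π y : M, TangentSpace (𝓡 5) y → TangentSpace (𝓡 5) y}
      (hA : ∀ X : VField M, SmoothField X → SmoothField (fun y => A y (X y)))
      (hcov : ∀ X : VField M, SmoothField X → cov (fun y => A y (X y)) x u = A x (cov X x u))
      (hη : ∀ y u w, η y (A y u) w = -η y u (A y w)) (w z : TangentSpace (𝓡 5) x) :
      covD2 cov η x u (A x w) z = -covD2 cov η x u w (A x z) := by
    have hW := smoothField_gext w
    have hZ := smoothField_gext z
    have h1 := e (hA _ hW) hZ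
    have h2 := e hW (hA _ hZ)
    have h3 : (fun y => η y (A y (gext w y)) (gext z y)) =
        fun y => -η y (gext w y) (A y (gext z y)) :=
      funext fun y => hη y _ _
    rw [h3, dirD_neg, hcov _ hW, hη, hη] at h1
    rw [hcov _ hZ] at h2
    simp only [gext_self] at h1 h2
    linarith
  refine ⟨⟨?_, ?_, swap⟩, ?_, ?_, ?_⟩
  · exact (hη.covD2 cov).add_snd x u
  · exact fun c w z => (hη.covD2 cov).smul_snd x c u w z
  · intro w
    change covD2 cov η x u (S.v x) w = 0
    have h1 := e (S.smoothField_v cov) (smoothField_gext w)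
    have h3 : (fun y => η y (S.v y) (gext w y)) = fun y => 0 := funext fun y => (ha y).v_left _
    have h0 : η x 0 (gext w x) = 0 := by simpa using hη.smul_left x 0 0 (gext w x)
    have h4 : η x (S.v x) (cov (gext w) x u) = 0 := (ha x).v_left _
    rw [h3, dirD_const, h.reeb_parallel, h0, h4, gext_self] at h1
    simpa using h1
  · exact comm (A := fun y => (S.toSpace cov y).I)
      (fun X hX => S.isPair_al_be.smoothField_cplx cov hX) (fun X hX => h.cov_I hX u)
      (fun y => (ha y).I_left)
  · exact comm (A := fun y => (S.toSpace cov y).J)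
      (fun X hX => (S.isPair_be_om cov).smoothField_cplx cov hX) (fun X hX => h.cov_J hX u)
      (fun y => (ha y).J_left)

/-- Second covariant derivatives of anti-self-dual forms are anti-self-dual. -/
lemma IsDistinguished.isAsd_covD3 [CovariantDerivative.ContMDiffCovariantDerivative cov ∞]
    (h : S.IsDistinguished cov) (hτ : IsTensor3 τ) (ha : ∀ y u, (S.toSpace cov y).IsAsd (τ y u))
    (x : M) (u a : TangentSpace (𝓡 5) x) : (S.toSpace cov x).IsAsd (covD3 cov τ x u a) := by
  have hA := smoothField_gext a
  have hη : IsTensor2 (fun y w z => τ y (gext a y) w z) :=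
    ⟨fun Z hZ => hτ.snd _ Z hA hZ, fun W hW => hτ.trd _ W hA hW⟩
  have e : covD3 cov τ x u a = fun w z => covD2 cov (fun y w z => τ y (gext a y) w z) x u w z
      - τ x (cov (gext a) x u) w z := by
    funext w z
    have h1 := hτ.covD3_eq cov u hA (smoothField_gext w) (smoothField_gext z)
    have h2 := hη.covD2_eq cov u (smoothField_gext w) (smoothField_gext z)
    simp only [gext_self] at h1 h2
    rw [h1, h2]
    ring
  rw [e]
  exact (h.isAsd_covD2 hη (fun y => ha y _) x u).sub (ha x _)

end Covariant

section Divergence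

variable [CovariantDerivative.ContMDiffCovariantDerivative cov ∞]

/-- The adjoint `d_H^*` of an anti-self-dual form is minus its divergence. -/
lemma IsDistinguished.dHadj_eq (h : S.IsDistinguished cov) {η : Tensor2 M} (hη : IsTensor2 η)
    (ha : ∀ y, (S.toSpace cov y).IsAsd (η y))
    (hs : ∀ y u w, S.star2 y (η y) u w = -η y u w) (x : M) {f : Fin 4 → TangentSpace (𝓡 5) x}
    (hf : (S.toSpace cov x).IsFrame f) (u : TangentSpace (𝓡 5) x) :
    S.dHadj η x u = -∑ i, covD2 cov η x (f i) (f i) u := by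
  have hF := S.isFrame_frame cov x
  have hη' : IsTensor2 (fun y u w => -η y u w) := by
    refine ⟨fun W hW => ?_, fun W hW => ?_⟩
    · have h1 := hη.left W hW
      exact ⟨fun x u w => by rw [h1.add]; ring, fun x c u => by rw [h1.smul]; ring,
        fun X hX => (h1.smooth X hX).neg⟩
    · have h1 := hη.right W hW
      exact ⟨fun x u w => by rw [h1.add]; ring, fun x c u => by rw [h1.smul]; ring,
        fun X hX => (h1.smooth X hX).neg⟩
  have ha' (y) : (S.toSpace cov y).IsAsd (fun u w => -η y u w) := (ha y).neg
  have hstar : (fun y => S.star2 y (η y)) = fun y u w => -η y u w :=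
    funext fun y => funext fun u => funext fun w => hs y u w
  have hT {p r : TangentSpace (𝓡 5) x} (hp : S.θ x p = 0) (hr : S.θ x r = 0)
      (z : TangentSpace (𝓡 5) x) : -η x (torsion cov p r) z = 0 := by
    rw [h.torsion_of_mem hp hr, hη.smul_left]
    have : η x (S.v x) z = 0 := (ha x).v_left z
    rw [this]; ring
  have hd (i j k : Fin 4) : S.dH2 (fun y u w => -η y u w) x (S.frame x i) (S.frame x j)
      (S.frame x k) = covD2 cov (fun y u w => -η y u w) x (S.frame x i) (S.frame x j) (S.frame x k)
      - covD2 cov (fun y u w => -η y u w) x (S.frame x j) (S.frame x i) (S.frame x k)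
      + covD2 cov (fun y u w => -η y u w) x (S.frame x k) (S.frame x i) (S.frame x j) := by
    have hp (i : Fin 4) : S.πH (S.frame x i) = S.frame x i :=
      (S.toSpace cov x).pr_of_mem (hF.th_eq i)
    rw [dH2, hp, hp, hp, extD2_eq cov hη' (fun y => (ha' y).alt.swap),
      hT (hF.th_eq i) (hF.th_eq j), hT (hF.th_eq i) (hF.th_eq k), hT (hF.th_eq j) (hF.th_eq k)]
    ring
  have h1 := hF.star3_alternation (D := covD2 cov (fun y u w => -η y u w) x)
    (fun w z => ⟨fun u u' => (hη'.covD2 cov).add_fst x u u' w z,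
      fun c u => (hη'.covD2 cov).smul_fst x c u w z⟩) (fun u => h.isAsd_covD2 hη' ha' x u) u
  rw [dHadj, hstar, star3]
  simp only [hd]
  have h2 : (S.toSpace cov x).star3 (S.frame x) (fun u w z =>
      covD2 cov (fun y u w => -η y u w) x u w z - covD2 cov (fun y u w => -η y u w) x w u z
        + covD2 cov (fun y u w => -η y u w) x z u w) u = _ := h1
  rw [HyperkahlerSpace.star3] at h2
  simp only [HyperkahlerSpace.vol] at h2
  simp only [vol]
  have h3 := hF.trace_eq hf (B := fun p r => covD2 cov η x p r u)
    ⟨fun w => ⟨fun p p' => (hη.covD2 cov).add_fst x p p' w u,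
      fun c p => (hη.covD2 cov).smul_fst x c p w u⟩,
      fun p => ((h.isAsd_covD2 hη ha x p).alt.isBilin.left u)⟩
  rw [← h3]
  simp only [covD2_neg, Finset.sum_neg_distrib, neg_neg] at h2 ⊢
  exact congrArg Neg.neg h2

end Divergence

end ContactHyperkahler

/-! ### Covariant derivatives and contractions -/

namespace ContactHyperkahler

variable {M : Type*} [TopologicalSpace M] [ChartedSpace (EuclideanSpace ℝ (Fin 5)) M]
  [IsManifold (𝓡 5) ∞ M] [T2Space M] {S : ContactHyperkahler M} {cov : Connection M}

lemma smoothField_quat (cov : Connection M) {X : VField M} (hX : SmoothField X) (i : Fin 4) :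
    SmoothField (fun y => (S.toSpace cov y).quat (X y) i) := by
  fin_cases i
  · exact hX
  · exact S.isPair_al_be.smoothField_cplx cov hX
  · exact (S.isPair_be_om cov).smoothField_cplx cov hX
  · exact (S.isPair_om_al cov).smoothField_cplx cov hX

lemma IsDistinguished.cov_quat (h : S.IsDistinguished cov) {X : VField M} (hX : SmoothField X)
    (i : Fin 4) {x : M} (u : TangentSpace (𝓡 5) x) :
    cov (fun y => (S.toSpace cov y).quat (X y) i) x u =
      (S.toSpace cov x).quat (cov X x u) i := by
  fin_cases i
  · rfl
  · exact h.cov_I hX u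
  · exact h.cov_J hX u
  · exact h.cov_K hX u

/-- A horizontal vector field extending a horizontal unit vector. -/
lemma exists_unit_field (cov : Connection M) (x : M) : ∃ X : VField M, SmoothField X ∧
    (∀ y, S.θ y (X y) = 0) ∧ S.gH x (X x) (X x) = 1 := by
  obtain ⟨e, he, h1⟩ := (S.toSpace cov x).exists_unit
  refine ⟨fun y => S.πH (gext e y), S.smoothField_πH cov (smoothField_gext e),
    fun y => (S.toSpace cov y).th_pr _, ?_⟩
  have : S.πH e = e := (S.toSpace cov x).pr_of_mem he
  simp only [gext_self, this]
  exact h1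

section Contraction

variable {D : Tensor3 M} {δ : Tensor1 M}

/-- The metric contraction of a smooth tensor in its first two slots, evaluated in
quaternionic frames that are not normalized. -/
lemma contraction_quat (hD : IsTensor3 D)
    (hδ : ∀ x u, δ x u = ∑ i, D x (S.frame x i) (S.frame x i) u) {x : M}
    {e : TangentSpace (𝓡 5) x} (he : S.θ x e = 0) (u : TangentSpace (𝓡 5) x) :
    ∑ i, D x ((S.toSpace cov x).quat e i) ((S.toSpace cov x).quat e i) u =
      S.gH x e e * δ x u := by
  have hB : IsBilin (fun p r => D x p r u) :=
    ⟨fun w => ⟨fun p p' => hD.add_fst x p p' w u, fun c p => hD.smul_fst x c p w u⟩,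
      fun w => ⟨fun p p' => hD.add_snd x w p p' u, fun c p => hD.smul_snd x c w p u⟩⟩
  rw [hδ]
  exact (S.toSpace cov x).sum_quat_eq (S.isFrame_frame cov x) he hB.toMap

/-- Contractions of smooth tensors are smooth. The frame `S.frame` has no regularity; near a point
it is replaced by the quaternionic frame of a horizontal vector field that need not be
normalized. -/
lemma isTensor1_contraction (cov : Connection M) (hD : IsTensor3 D)
    (hδ : ∀ x u, δ x u = ∑ i, D x (S.frame x i) (S.frame x i) u) : IsTensor1 δ where
  add x u w := by simp only [hδ, hD.add_trd, Finset.sum_add_distrib]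
  smul x c u := by simp only [hδ, hD.smul_trd, Finset.mul_sum]
  smooth Y hY := fun x => by
    obtain ⟨X, hX, hX0, hX1⟩ := S.exists_unit_field cov x
    have hN : SmoothFun (fun y => S.gH y (X y) (X y)) := (S.isTensor2_gH cov).smooth hX hX
    have hnum : SmoothFun (fun y => ∑ i, D y ((S.toSpace cov y).quat (X y) i)
        ((S.toSpace cov y).quat (X y) i) (Y y)) := by
      have h1 (i : Fin 4) : SmoothFun (fun y => D y ((S.toSpace cov y).quat (X y) i)
        ((S.toSpace cov y).quat (X y) i) (Y y)) :=
        (hD.trd _ _ (smoothField_quat cov hX i) (smoothField_quat cov hX i)).smooth Y hY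
      exact ContMDiff.sum fun i _ => h1 i
    have hne : ∀ᶠ y in 𝓝 x, S.gH y (X y) (X y) ≠ 0 :=
      (hN x).continuousAt.eventually_ne (by rw [hX1]; exact one_ne_zero)
    refine ((hnum x).div₀ (hN x) (by rw [hX1]; exact one_ne_zero)).congr_of_eventuallyEq ?_
    filter_upwards [hne] with y hy
    simp only [Pi.div_apply]
    rw [contraction_quat (cov := cov) hD hδ (hX0 y), mul_div_cancel_left₀ _ hy]

/-- Covariant derivatives commute with metric contractions. -/
lemma IsDistinguished.covD1_contraction (h : S.IsDistinguished cov) (hD : IsTensor3 D)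
    (hδ : ∀ x u, δ x u = ∑ i, D x (S.frame x i) (S.frame x i) u) {x : M}
    {f : Fin 4 → TangentSpace (𝓡 5) x} (hf : (S.toSpace cov x).IsFrame f)
    (u w : TangentSpace (𝓡 5) x) :
    covD1 cov δ x u w = ∑ i, covD3 cov D x u (f i) (f i) w := by
  have hδ1 := S.isTensor1_contraction cov hD hδ
  obtain ⟨X, hX, hX0, hX1⟩ := S.exists_unit_field cov x
  have hW := smoothField_gext w
  have hq (i) := S.smoothField_quat cov hX i
  have e1 := covD1_eq cov hδ1 u (hW.diffAt x)
  have hN : SmoothFun (fun y => S.gH y (X y) (X y)) := (S.isTensor2_gH cov).smooth hX hX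
  have e2 : (fun y => S.gH y (X y) (X y) * δ y (gext w y)) = fun y =>
      ∑ i, D y ((S.toSpace cov y).quat (X y) i) ((S.toSpace cov y).quat (X y) i) (gext w y) :=
    funext fun y => (contraction_quat hD hδ (hX0 y) _).symm
  have hs (i : Fin 4) : SmoothFun (fun y => D y ((S.toSpace cov y).quat (X y) i)
      ((S.toSpace cov y).quat (X y) i) (gext w y)) :=
    (hD.trd _ _ (hq i) (hq i)).smooth _ hW
  have e3 := congrArg (fun k => dirD k u) e2
  rw [dirD_mul u (hN.diffAt x) ((hδ1.smooth _ hW).diffAt x),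
    dirD_sum _ _ fun i _ => (hs i).diffAt x,
    h.dirD_gH hX hX] at e3
  have hc := h.preserves X x u (hX.diffAt x) hX0
  have e4 (i : Fin 4) := hD.covD3_eq cov u (hq i) (hq i) hW
  simp only [h.cov_quat hX] at e4
  have hB : IsBilin (fun p r => D x p r w) :=
    ⟨fun z => ⟨fun p p' => hD.add_fst x p p' z w, fun c p => hD.smul_fst x c p z w⟩,
      fun z => ⟨fun p p' => hD.add_snd x z p p' w, fun c p => hD.smul_snd x c z p w⟩⟩
  have e5 : ∑ i, (D x ((S.toSpace cov x).quat (cov X x u) i) ((S.toSpace cov x).quat (X x) i) w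
      + D x ((S.toSpace cov x).quat (X x) i) ((S.toSpace cov x).quat (cov X x u) i) w) =
      2 * S.gH x (X x) (cov X x u) * ∑ i, D x (f i) (f i) w :=
    (S.toSpace cov x).sum_quat_polar hf (hX0 x) hc hB.toMap
  have e6 : δ x w = ∑ i, D x (f i) (f i) w := by
    rw [hδ]; exact (S.isFrame_frame cov x).trace_eq hf hB
  have hB' : IsBilin (fun p r => covD3 cov D x u p r w) :=
    ⟨fun z => ⟨fun p p' => hD.covD3_add_fst cov u p p' z w,
        fun c p => hD.covD3_smul_fst cov c u p z w⟩,
      fun z => ⟨fun p p' => hD.covD3_add_snd cov u z p p' w,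
        fun c p => hD.covD3_smul_snd cov c u z p w⟩⟩
  have e7 := ((S.toSpace cov x).isFrame_quat (hX0 x) hX1).trace_eq hf hB'
  have e8 := contraction_quat (cov := cov) hD hδ (hX0 x) (cov (gext w) x u)
  have e9 : S.gH x (cov X x u) (X x) = S.gH x (X x) (cov X x u) := (S.toSpace cov x).gH_comm _ _
  rw [← e7]
  rw [gext_self] at e1 e3
  simp only [gext_self] at e4
  simp only [e4, Finset.sum_sub_distrib]
  rw [Finset.sum_add_distrib] at e5
  rw [hX1] at e3 e8
  rw [e9] at e3
  rw [e1, e8]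
  rw [← e6] at e5
  linarith

end Contraction

section SecondOrder

variable [CovariantDerivative.ContMDiffCovariantDerivative cov ∞] {η : Tensor2 M}

/-- The operator `d_H d_H^*` on anti-self-dual forms, as a second covariant derivative. -/
lemma IsDistinguished.dH1_dHadj (h : S.IsDistinguished cov) (hη : IsTensor2 η)
    (ha : ∀ y, (S.toSpace cov y).IsAsd (η y))
    (hs : ∀ y u w, S.star2 y (η y) u w = -η y u w) (x : M) {f : Fin 4 → TangentSpace (𝓡 5) x}
    (hf : (S.toSpace cov x).IsFrame f) (u w : TangentSpace (𝓡 5) x) :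
    S.dH1 (S.dHadj η) x u w =
      -(∑ i, covD3 cov (covD2 cov η) x (S.πH u) (f i) (f i) (S.πH w))
        + ∑ i, covD3 cov (covD2 cov η) x (S.πH w) (f i) (f i) (S.πH u) := by
  have hD := hη.covD2 cov
  have hδ : ∀ x u, -S.dHadj η x u = ∑ i, covD2 cov η x (S.frame x i) (S.frame x i) u := by
    intro x u
    rw [h.dHadj_eq hη ha hs x (S.isFrame_frame cov x), neg_neg]
  have h1 := S.isTensor1_contraction cov hD hδ
  have hc := h.covD1_contraction hD hδ hf
  have h2 : IsTensor1 (S.dHadj η) :=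
    ⟨fun x u w => by linarith [h1.add x u w], fun x c u => by linarith [h1.smul x c u],
      fun X hX => by simpa using (h1.smooth X hX).neg⟩
  have h3 (u w : TangentSpace (𝓡 5) x) :
      covD1 cov (fun y u => -S.dHadj η y u) x u w = -covD1 cov (S.dHadj η) x u w := by
    simp only [covD1, dirD_neg]
    ring
  have hp (u : TangentSpace (𝓡 5) x) : S.θ x (S.πH u) = 0 := (S.toSpace cov x).th_pr u
  have h4 : S.dHadj η x (S.v x) = 0 := by
    have e (i) : covD2 cov η x (S.frame x i) (S.frame x i) (S.v x) = 0 :=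
      (h.isAsd_covD2 hη ha x _).v_right _
    have e' := hδ x (S.v x)
    simp only [e, Finset.sum_const_zero] at e'
    linarith
  rw [dH1, extD1_eq cov h2, h.torsion_of_mem (hp u) (hp w), h2.smul, h4, ← hc, ← hc, h3, h3]
  ring

/-- The rough Laplacian `∇_H^* ∇_H` as a second covariant derivative. -/
lemma IsDistinguished.nablaHadj_nablaH (h : S.IsDistinguished cov) (hη : IsTensor2 η)
    (x : M) (w z : TangentSpace (𝓡 5) x) :
    S.nablaHadj cov (S.nablaH cov η) x w z =
      -∑ i, covD3 cov (covD2 cov η) x (S.frame x i) (S.frame x i) w z := by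
  have hD := hη.covD2 cov
  have hN : IsTensor3 (S.nablaH cov η) := by
    have hadd (y : M) (u u' : TangentSpace (𝓡 5) y) : S.πH (u + u') = S.πH u + S.πH u' :=
      (S.toSpace cov y).pr_add u u'
    have hsmul (y : M) (c : ℝ) (u : TangentSpace (𝓡 5) y) : S.πH (c • u) = c • S.πH u :=
      (S.toSpace cov y).pr_smul c u
    refine ⟨fun W Z hW hZ => ?_, fun A Z hA hZ => hD.snd _ Z (S.smoothField_πH cov hA) hZ,
      fun A W hA hW => hD.trd _ W (S.smoothField_πH cov hA) hW⟩
    have h1 := hD.fst W Z hW hZ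
    exact ⟨fun y u u' => by rw [nablaH, hadd, h1.add]; rfl,
      fun y c u => by rw [nablaH, hsmul, h1.smul]; rfl,
      fun X hX => h1.smooth _ (S.smoothField_πH cov hX)⟩
  rw [nablaHadj]
  congr 1
  refine Finset.sum_congr rfl fun i _ => ?_
  have hA := smoothField_gext (S.frame x i)
  have hW := smoothField_gext w
  have hZ := smoothField_gext z
  have hp : S.πH (S.frame x i) = S.frame x i :=
    (S.toSpace cov x).pr_of_mem ((S.isFrame_frame cov x).th_eq i)
  have e1 := hN.covD3_eq cov (S.frame x i) hA hW hZ
  have e2 := hD.covD3_eq cov (S.frame x i) (S.smoothField_πH cov hA) hW hZ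
  simp only [nablaH, gext_self, hp, (h.toIsAdapted.cov_th hA _).1] at e1 e2
  rw [e2, ← e1]

end SecondOrder

end ContactHyperkahler

/-! ### Torsion, curvature and the first Bianchi identity -/

section Curvature

variable {M : Type*} [TopologicalSpace M] [ChartedSpace (EuclideanSpace ℝ (Fin 5)) M]

lemma bracket_swap (X Y : VField M) (x : M) : bracket X Y x = -bracket Y X x :=
  mlieBracket_swap_apply

variable [IsManifold (𝓡 5) ∞ M] (cov : Connection M) {x : M}

lemma torsion_add_left (u u' w : TangentSpace (𝓡 5) x) :
    torsion cov (u + u') w = torsion cov u w + torsion cov u' w := by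
  simp [torsion_eq]

lemma torsion_smul_left (c : ℝ) (u w : TangentSpace (𝓡 5) x) :
    torsion cov (c • u) w = c • torsion cov u w := by
  simp [torsion_eq]

lemma torsion_add_right (u w w' : TangentSpace (𝓡 5) x) :
    torsion cov u (w + w') = torsion cov u w + torsion cov u w' := by
  simp [torsion_eq]

lemma torsion_smul_right (c : ℝ) (u w : TangentSpace (𝓡 5) x) :
    torsion cov u (c • w) = c • torsion cov u w := by
  simp [torsion_eq]

lemma torsion_swap (u w : TangentSpace (𝓡 5) x) : torsion cov u w = -torsion cov w u := by
  rw [torsion, torsion, bracket_swap]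
  abel

lemma cov_add_field {X Y : VField M} (hX : SmoothField X) (hY : SmoothField Y) :
    cov (fun y => X y + Y y) x = cov X x + cov Y x :=
  cov.isCovariantDerivativeOnUniv.add (hX.diffAt x) (hY.diffAt x)

lemma cov_smul_field {h : M → ℝ} {X : VField M} (hh : SmoothFun h) (hX : SmoothField X)
    (u : TangentSpace (𝓡 5) x) :
    cov (fun y => h y • X y) x u = h x • cov X x u + dirD h u • X x := by
  have e := cov.isCovariantDerivativeOnUniv.leibniz (hX.diffAt x) (hh.diffAt x)
  have e' : cov (fun y => h y • X y) x = _ := e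
  rw [e']
  simp [dirD]

lemma cov_neg_field {X : VField M} (hX : SmoothField X) (u : TangentSpace (𝓡 5) x) :
    cov (fun y => -X y) x u = -cov X x u := by
  have h : SmoothFun (fun _ : M => (-1 : ℝ)) := contMDiff_const
  have e := cov_smul_field cov h hX u
  simpa [dirD_const] using e

lemma cov_const_smul_field (c : ℝ) {X : VField M} (hX : SmoothField X)
    (u : TangentSpace (𝓡 5) x) : cov (fun y => c • X y) x u = c • cov X x u := by
  have h : SmoothFun (fun _ : M => c) := contMDiff_const
  have e := cov_smul_field cov h hX u
  simpa [dirD_const] using e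

lemma cov_sub_field {X Y : VField M} (hX : SmoothField X) (hY : SmoothField Y)
    (u : TangentSpace (𝓡 5) x) :
    cov (fun y => X y - Y y) x u = cov X x u - cov Y x u := by
  have hY' : SmoothField (fun y => -Y y) := by
    simpa using SmoothField.smul (contMDiff_const : SmoothFun (fun _ : M => (-1 : ℝ))) hY
  simp only [sub_eq_add_neg]
  rw [cov_add_field cov hX hY', add_apply, cov_neg_field cov hY]

lemma curvature_swap (u w z : TangentSpace (𝓡 5) x) :
    curvature cov u w z = -curvature cov w u z := by
  rw [curvature, curvature, bracket_swap, map_neg]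
  abel

/-- The Jacobi identity, in Leibniz form. -/
lemma bracket_leibniz {X Y Z : VField M} (hX : SmoothField X) (hY : SmoothField Y)
    (hZ : SmoothField Z) (x : M) : bracket X (bracket Y Z) x =
      bracket (bracket X Y) Z x + bracket Y (bracket X Z) x := by
  have h2 : minSmoothness ℝ 2 ≤ (∞ : ℕ∞ω) := by
    simpa using ENat.LEInfty.out (m := (2 : ℕ∞ω))
  exact leibniz_identity_mlieBracket_apply ((hX x).of_le h2) ((hY x).of_le h2) ((hZ x).of_le h2)

/-- The Jacobi identity. -/
lemma bracket_jacobi {X Y Z : VField M} (hX : SmoothField X) (hY : SmoothField Y)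
    (hZ : SmoothField Z) (x : M) : bracket X (bracket Y Z) x + bracket Y (bracket Z X) x
      + bracket Z (bracket X Y) x = 0 := by
  have e : bracket Y (bracket Z X) x = -bracket Y (bracket X Z) x := by
    have : bracket Z X = -bracket X Z := funext fun y => bracket_swap Z X y
    rw [this, bracket_swap, bracket_swap Y]
    congr 1
    have e' := mlieBracket_const_smul_left (I := 𝓡 5) (W := Y) (c := (-1 : ℝ))
      ((hX.bracket hZ).diffAt x)
    simpa [bracket] using e'
  rw [bracket_leibniz hX hY hZ, e, bracket_swap (bracket X Y)]
  abel

variable [T2Space M] [CovariantDerivative.ContMDiffCovariantDerivative cov ∞]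

lemma curvature_add_left (u u' w z : TangentSpace (𝓡 5) x) :
    curvature cov (u + u') w z = curvature cov u w z + curvature cov u' w z := by
  have hg {x : M} (w : TangentSpace (𝓡 5) x) := smoothField_gext w
  have hb (a b : TangentSpace (𝓡 5) x) := bracket_eq cov ((hg a).diffAt x) ((hg b).diffAt x)
  have e1 : (fun y => cov (gext z) y (gext (u + u') y)) =
      fun y => cov (gext z) y (gext u y) + cov (gext z) y (gext u' y) := by
    funext y
    rw [gext_add]
    exact map_add _ _ _
  have e2 : cov (gext (u + u')) x = cov (gext u) x + cov (gext u') x := by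
    rw [gext_add]; exact cov_add_field cov (hg u) (hg u')
  simp only [curvature_eq, e1, hb, e2]
  rw [cov_add_field cov ((hg u).cov (hg z)) ((hg u').cov (hg z))]
  simp only [gext_self, torsion_add_left, map_add, map_sub, add_apply]
  abel

lemma curvature_smul_left (c : ℝ) (u w z : TangentSpace (𝓡 5) x) :
    curvature cov (c • u) w z = c • curvature cov u w z := by
  have hg {x : M} (w : TangentSpace (𝓡 5) x) := smoothField_gext w
  have hb (a b : TangentSpace (𝓡 5) x) := bracket_eq cov ((hg a).diffAt x) ((hg b).diffAt x)
  have e1 : (fun y => cov (gext z) y (gext (c • u) y)) =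
      fun y => c • cov (gext z) y (gext u y) := by
    funext y
    rw [gext_smul, map_smul]
  have e2 (a) : cov (gext (c • u)) x a = c • cov (gext u) x a := by
    rw [gext_smul, cov_const_smul_field cov c (hg u)]
  simp only [curvature_eq, e1, hb, e2]
  rw [cov_const_smul_field cov c ((hg u).cov (hg z))]
  simp only [gext_self, torsion_smul_left, map_smul, map_sub]
  module

lemma curvature_add_right (u w z z' : TangentSpace (𝓡 5) x) :
    curvature cov u w (z + z') = curvature cov u w z + curvature cov u w z' := by
  have hg {x : M} (w : TangentSpace (𝓡 5) x) := smoothField_gext w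
  have e1 (y : M) : cov (gext (z + z')) y = cov (gext z) y + cov (gext z') y := by
    rw [gext_add]; exact cov_add_field cov (hg z) (hg z')
  simp only [curvature_eq, e1, add_apply]
  rw [cov_add_field cov ((hg w).cov (hg z)) ((hg w).cov (hg z')),
    cov_add_field cov ((hg u).cov (hg z)) ((hg u).cov (hg z'))]
  simp only [add_apply]
  abel

lemma curvature_smul_right (c : ℝ) (u w z : TangentSpace (𝓡 5) x) :
    curvature cov u w (c • z) = c • curvature cov u w z := by
  have hg {x : M} (w : TangentSpace (𝓡 5) x) := smoothField_gext w
  have e1 (y : M) (a : TangentSpace (𝓡 5) y) : cov (gext (c • z)) y a = c • cov (gext z) y a := by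
    rw [gext_smul, cov_const_smul_field cov c (hg z)]
  simp only [curvature_eq, e1]
  rw [cov_const_smul_field cov c ((hg w).cov (hg z)),
    cov_const_smul_field cov c ((hg u).cov (hg z))]
  module

/-- The first Bianchi identity of a connection with torsion. -/
lemma bianchi_identity (u w z : TangentSpace (𝓡 5) x) :
    curvature cov u w z + curvature cov w z u + curvature cov z u w =
      (cov (fun y => torsion cov (gext w y) (gext z y)) x u
          + torsion cov u (bracket (gext w) (gext z) x))
      + (cov (fun y => torsion cov (gext z y) (gext u y)) x w
          + torsion cov w (bracket (gext z) (gext u) x))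
      + (cov (fun y => torsion cov (gext u y) (gext w y)) x z
          + torsion cov z (bracket (gext u) (gext w) x)) := by
  have hg {x : M} (w : TangentSpace (𝓡 5) x) := smoothField_gext w
  have key (u w z : TangentSpace (𝓡 5) x) :
      cov (fun y => torsion cov (gext w y) (gext z y)) x u
        + torsion cov u (bracket (gext w) (gext z) x) =
      cov (fun y => cov (gext z) y (gext w y)) x u - cov (fun y => cov (gext w) y (gext z y)) x u
        - cov (gext u) x (bracket (gext w) (gext z) x)
        - bracket (gext u) (bracket (gext w) (gext z)) x := by
    have hB := (hg w).bracket (hg z)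
    have e1 : (fun y => torsion cov (gext w y) (gext z y)) = fun y =>
        cov (gext z) y (gext w y) - cov (gext w) y (gext z y) - bracket (gext w) (gext z) y := by
      funext y
      rw [bracket_eq cov ((hg w).diffAt y) ((hg z).diffAt y)]
      abel
    rw [e1, cov_sub_field cov (((hg w).cov (hg z)).sub ((hg z).cov (hg w))) hB,
      cov_sub_field cov ((hg w).cov (hg z)) ((hg z).cov (hg w)),
      bracket_eq cov ((hg u).diffAt x) (hB.diffAt x), gext_self]
    abel
  rw [key, key, key, curvature_eq, curvature_eq, curvature_eq, ← sub_eq_zero,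
    ← bracket_jacobi (hg u) (hg w) (hg z) x]
  abel

end Curvature

/-! ### The torsion of the distinguished connection -/

/-- An endomorphism that is skew for the three forms of the triple corresponds under `g_H`
to an anti-self-dual form. -/
lemma HyperkahlerSpace.IsAsd.of_skew {V : Type*} [AddCommGroup V] [Module ℝ V]
    {Q : HyperkahlerSpace V} {ρ : V → V} (hadd : ∀ z z', ρ (z + z') = ρ z + ρ z')
    (hsmul : ∀ (c : ℝ) z, ρ (c • z) = c • ρ z) (hom : ∀ z t, Q.om (ρ z) t + Q.om z (ρ t) = 0)
    (hal : ∀ z t, Q.al (ρ z) t + Q.al z (ρ t) = 0)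
    (hbe : ∀ z t, Q.be (ρ z) t + Q.be z (ρ t) = 0) : Q.IsAsd (fun z t => Q.gH (ρ z) t) := by
  have hI (z) : Q.pr (ρ (Q.I z)) = Q.I (ρ z) :=
    Q.eq_of_be (Q.th_pr _) (Q.th_I _) fun t => by
      have h1 := hbe (Q.I z) t
      have h2 := hal z t
      rw [Q.be_I] at h1
      rw [Q.be_pr, Q.be_I]
      linarith
  have hJ (z) : Q.pr (ρ (Q.J z)) = Q.J (ρ z) :=
    Q.eq_of_om (Q.th_pr _) (Q.th_J _) fun t => by
      have h1 := hom (Q.J z) t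
      have h2 := hbe z t
      rw [Q.om_J] at h1
      rw [Q.om_pr, Q.om_J]
      linarith
  have hswap (z t) : Q.gH (ρ z) t = -Q.gH (ρ t) z := by
    have h1 := hom z (Q.I t)
    have h2 : Q.om z (ρ (Q.I t)) = Q.gH z (ρ t) := by
      rw [Q.alt_om.swap, ← Q.om_pr, hI, ← Q.alt_om.swap]; rfl
    rw [h2, Q.gH_comm] at h1
    have h3 : Q.om (ρ z) (Q.I t) = Q.gH (ρ z) t := rfl
    linarith
  refine ⟨⟨fun z z' t => ?_, fun c z t => ?_, hswap⟩, fun t => ?_, fun z t => ?_, fun z t => ?_⟩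
  · rw [hadd, Q.gH_add_left]
  · rw [hsmul, Q.gH_smul_left]
  · rw [hswap, Q.gH_v_right, neg_zero]
  · rw [← Q.gH_pr_left, hI, Q.gH_I, HyperkahlerSpace.gH, Q.I_I, (Q.alt_om.isBilin.right _).neg,
      Q.alt_om.swap _ (Q.pr t), Q.om_pr, ← Q.alt_om.swap, neg_neg]
  · rw [← Q.gH_pr_left, hJ, Q.gH_J, Q.gH_comm (ρ z), Q.gH_J, Q.alt_al.swap]

namespace ContactHyperkahler

variable {M : Type*} [TopologicalSpace M] [ChartedSpace (EuclideanSpace ℝ (Fin 5)) M]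
  [IsManifold (𝓡 5) ∞ M] [T2Space M] {S : ContactHyperkahler M} {cov : Connection M} {x : M}

namespace IsDistinguished

/-- The torsion is determined by `ω` and the endomorphism `T_v`. -/
lemma torsion_eq (h : S.IsDistinguished cov) (u w : TangentSpace (𝓡 5) x) :
    torsion cov u w = S.om x u w • S.v x + S.θ x u • torsion cov (S.v x) w
      - S.θ x w • torsion cov (S.v x) u := by
  have hp (u : TangentSpace (𝓡 5) x) : S.θ x (S.πH u) = 0 := (S.toSpace cov x).th_pr u
  have h1 := h.torsion_of_mem (hp u) (hp w)
  have h2 : S.om x (S.πH u) (S.πH w) = S.om x u w := by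
    have e : S.om x (S.πH u) (S.πH w) = S.om x u (S.πH w) := (S.toSpace cov x).om_pr _ _
    have e' : S.om x (S.πH w) u = S.om x w u := (S.toSpace cov x).om_pr _ _
    rw [e, (S.isAltForm_om cov x).swap, e', ← (S.isAltForm_om cov x).swap]
  rw [h2] at h1
  have hv0 : torsion cov (S.v x) (S.v x) = 0 := by
    rw [torsion, sub_self, zero_sub, bracket, mlieBracket_self]
    simp
  have hu : u = S.πH u + S.θ x u • S.v x := (S.toSpace cov x).pr_add_smul_v u
  have hw : w = S.πH w + S.θ x w • S.v x := (S.toSpace cov x).pr_add_smul_v w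
  have e1 : torsion cov u w = torsion cov (S.πH u) (S.πH w)
      + S.θ x u • torsion cov (S.v x) (S.πH w) + S.θ x w • torsion cov (S.πH u) (S.v x) := by
    conv_lhs => rw [hu, hw]
    simp only [torsion_add_left, torsion_add_right, torsion_smul_left, torsion_smul_right, hv0]
    module
  have e2 (u : TangentSpace (𝓡 5) x) :
      torsion cov (S.v x) u = torsion cov (S.v x) (S.πH u) := by
    conv_lhs => rw [(S.toSpace cov x).pr_add_smul_v u]
    change torsion cov (S.v x) (S.πH u + S.θ x u • S.v x) = _
    rw [torsion_add_right, torsion_smul_right, hv0, smul_zero, add_zero]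
  rw [e1, h1, e2 w, e2 u, torsion_swap cov (S.πH u)]
  module

/-- Parallel transport preserves `ω` and `dω = 0`, so that `T_v` is skew for `ω`. -/
lemma om_torsion_v (h : S.IsDistinguished cov) (u w : TangentSpace (𝓡 5) x) :
    S.om x (torsion cov (S.v x) u) w + S.om x u (torsion cov (S.v x) w) = 0 := by
  have hX := smoothField_gext u
  have hY := smoothField_gext w
  have hv := S.smoothField_v cov
  set X := gext u with hXu
  set Y := gext w with hYw
  have hθ {Z : VField M} (hZ : SmoothField Z) : SmoothFun (fun y => S.th y (Z y)) :=
    S.smooth_θ Z hZ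
  have h1 (Z W : VField M) (hZ : SmoothField Z) (hW : SmoothField W) (y : M) :
      S.om y (Z y) (W y) = dirD (fun y => S.th y (W y)) (Z y) - dirD (fun y => S.th y (Z y)) (W y)
        - S.th y (bracket Z W y) := extD1_apply cov S.isTensor1_th hZ hW y
  have hone : (fun y => S.th y (S.v y)) = fun _ => 1 := funext fun y => (S.reeb_spec cov y).1
  have hvb {Z : VField M} (hZ : SmoothField Z) : (fun y => S.th y (bracket S.v Z y)) =
      fun y => dirD (fun y => S.th y (Z y)) (S.v y) := by
    funext y
    have e := h1 _ _ hv hZ y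
    rw [(S.reeb_spec cov y).2, hone, dirD_const] at e
    linarith
  -- the invariance of `ω = dθ` under the flow of `v`
  have hLie : dirD (fun y => S.om y (X y) (Y y)) (S.v x) =
      S.om x (bracket S.v X x) (Y x) + S.om x (X x) (bracket S.v Y x) := by
    have e1 := h1 _ _ (hv.bracket hX) hY x
    have e2 := h1 _ _ hX (hv.bracket hY) x
    rw [hvb hX] at e1
    rw [hvb hY] at e2
    have e3 : (fun y => S.om y (X y) (Y y)) = fun y => dirD (fun y => S.th y (Y y)) (X y)
        - dirD (fun y => S.th y (X y)) (Y y) - S.th y (bracket X Y y) := funext (h1 _ _ hX hY)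
    have d1 := smoothFun_dirD (hθ hY) hX
    have d2 := smoothFun_dirD (hθ hX) hY
    have d3 := hθ (hX.bracket hY)
    rw [e3, dirD_sub _ (SmoothFun.diffAt (d1.sub d2) x) (d3.diffAt x),
      dirD_sub _ (d1.diffAt x) (d2.diffAt x), e1, e2,
      dirD_bracket hv hX (hθ hY), dirD_bracket hv hY (hθ hX)]
    have e4 := congrFun (hvb (hX.bracket hY)) x
    have e5 := congrArg (S.θ x) (bracket_leibniz hv hX hY x)
    rw [map_add] at e5
    simp only [th] at e4 ⊢
    linarith
  have h2 := (S.isTensor2_om cov).covD2_eq cov (S.v x) hX hY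
  rw [h.parallel_ω, hLie, bracket_eq cov (hv.diffAt x) (hX.diffAt x),
    bracket_eq cov (hv.diffAt x) (hY.diffAt x), h.reeb_parallel, h.reeb_parallel] at h2
  simp only [sub_zero, (S.isTensor2_om cov).sub_left, (S.isTensor2_om cov).sub_right, hXu, hYw,
    gext_self] at h2
  linarith

end IsDistinguished

end ContactHyperkahler

/-! ### The function `f` -/

/-- The matrix of `β` in a frame `(e, I e, J e, K e)`. -/
def betaMatrix : Fin 4 → Fin 4 → ℝ :=
  ![![0, 0, 0, 1], ![0, 0, 1, 0], ![0, -1, 0, 0], ![-1, 0, 0, 0]]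

section TopForms

variable {V : Type*} [AddCommGroup V] [Module ℝ V]

/-- The wedge product of two `2`-forms as an alternating map. -/
def wedgeAlt {A B : V → V → ℝ} (hA : IsAltForm A) (hB : IsAltForm B) : V [⋀^Fin 4]→ₗ[ℝ] ℝ where
  toFun m := wedge A B (m 0) (m 1) (m 2) (m 3)
  map_update_add' := by
    intro inst m i u w
    obtain rfl : inst = instDecidableEqFin 4 := Subsingleton.elim _ _
    fin_cases i <;> simp [Function.update, wedge, hA.add_left, hA.add_right, hB.add_left,
      hB.add_right] <;> ring
  map_update_smul' := by
    intro inst m i c u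
    obtain rfl : inst = instDecidableEqFin 4 := Subsingleton.elim _ _
    fin_cases i <;> simp [Function.update, wedge, hA.smul_left, hA.smul_right, hB.smul_left,
      hB.smul_right] <;> ring
  map_eq_zero_of_eq' m i j h hij := by
    have sA (a b : Fin 4) := hA.swap (m a) (m b)
    have sB (a b : Fin 4) := hB.swap (m a) (m b)
    fin_cases i <;> fin_cases j <;> simp at hij h <;>
      simp only [wedge, h, hA.self, hB.self, sA 1 0, sA 2 0, sA 2 1, sA 3 1, sA 3 2,
        sB 1 0, sB 2 0, sB 2 1, sB 3 1, sB 3 2] <;>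
      ring

lemma IsAltForm.comp {W : Type*} [AddCommGroup W] [Module ℝ W] {A : V → V → ℝ} (hA : IsAltForm A)
    (g : W →ₗ[ℝ] V) : IsAltForm (fun u w => A (g u) (g w)) :=
  ⟨fun u u' w => by rw [map_add, hA.add_left], fun c u w => by rw [map_smul, hA.smul_left],
    fun u w => hA.swap _ _⟩

lemma HyperkahlerSpace.be_quat (Q : HyperkahlerSpace V) {e : V} (he : Q.th e = 0)
    (h1 : Q.gH e e = 1) (i j : Fin 4) : Q.be (Q.quat e i) (Q.quat e j) = betaMatrix i j := by
  have hf := Q.isFrame_quat he h1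
  have hKK : Q.K (Q.K e) = -e := by rw [Q.K_K, Q.pr_of_mem he]
  have hK : ∀ i, Q.K (Q.quat e i) = ∑ k, betaMatrix i k • Q.quat e k := by
    intro i
    fin_cases i <;> simp [quat, betaMatrix, Fin.sum_univ_four, K_I, K_J, hKK]
  rw [← gH_K, hK]
  have hl : IsLin (fun u => Q.gH u (Q.quat e j)) :=
    ⟨fun u w => Q.gH_add_left u w _, fun c u => Q.gH_smul_left c u _⟩
  rw [hl.sum]
  simp [hl.smul, hf.gH_eq]

/-- The ratio of a `4`-form `A ∧ B` and the volume form on `H` does not depend on the frame in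
which it is computed. -/
lemma HyperkahlerSpace.IsFrame.wedge_div_eq {Q : HyperkahlerSpace V} {f : Fin 4 → V}
    (hf : Q.IsFrame f) {e : V} (he : Q.th e = 0) (h1 : Q.gH e e = 1) {A B : V → V → ℝ}
    (hA : IsAltForm A) (hB : IsAltForm B) :
    wedge A B (f 0) (f 1) (f 2) (f 3) / wedge Q.om Q.om (f 0) (f 1) (f 2) (f 3) =
      wedge (fun i j => A (Q.quat e i) (Q.quat e j)) (fun i j => B (Q.quat e i) (Q.quat e j))
        0 1 2 3 / 2 := by
  have hq := Q.isFrame_quat he h1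
  have key {A B : V → V → ℝ} (hA : IsAltForm A) (hB : IsAltForm B) :
      wedge A B (f 0) (f 1) (f 2) (f 3) =
        wedge (fun i j => A (Q.quat e i) (Q.quat e j)) (fun i j => B (Q.quat e i) (Q.quat e j))
          0 1 2 3 * hq.basis.det hf.basis := by
    have h2 := (wedgeAlt (hA.comp (LinearMap.ker Q.th).subtype)
      (hB.comp (LinearMap.ker Q.th).subtype)).eq_smul_basis_det hq.basis
    have h3 := congrArg (fun m => m hf.basis) h2
    simpa [wedgeAlt, wedge, IsFrame.coe_basis] using h3
  have hdet : hq.basis.det hf.basis ≠ 0 := (hq.basis.isUnit_det hf.basis).ne_zero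
  rw [key hA hB, key Q.alt_om Q.alt_om, mul_div_mul_right _ _ hdet]
  congr 1
  simp only [om_quat he h1]
  simp [wedge, omMatrix]
  norm_num

end TopForms

namespace ContactHyperkahler

variable {M : Type*} [TopologicalSpace M] [ChartedSpace (EuclideanSpace ℝ (Fin 5)) M]
  [IsManifold (𝓡 5) ∞ M] [T2Space M] {S : ContactHyperkahler M} {cov : Connection M} {x : M}

namespace IsDistinguished

/-- The function `f` in terms of the endomorphism `T_v`. -/
lemma f_eq (h : S.IsDistinguished cov) {e : TangentSpace (𝓡 5) x} (he : S.θ x e = 0)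
    (h1 : S.gH x e e = 1) :
    S.f x = (S.gH x (torsion cov (S.v x) ((S.toSpace cov x).quat e 1)) ((S.toSpace cov x).quat e 0)
      - S.gH x (torsion cov (S.v x) ((S.toSpace cov x).quat e 0)) ((S.toSpace cov x).quat e 1)
      + S.gH x (torsion cov (S.v x) ((S.toSpace cov x).quat e 3)) ((S.toSpace cov x).quat e 2)
      - S.gH x (torsion cov (S.v x) ((S.toSpace cov x).quat e 2))
          ((S.toSpace cov x).quat e 3)) / 2 := by
  set Q := S.toSpace cov x with hQ
  have hL : lieD S.v S.al x = fun u w =>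
      Q.al (torsion cov (S.v x) u) w + Q.al u (torsion cov (S.v x) w) := by
    funext u w
    rw [lieD_eq cov S.isTensor2_al (S.smoothField_v cov) (h.reeb_parallel x),
      h.parallel_α, zero_add]
    rfl
  have hLalt : IsAltForm (fun u w =>
      Q.al (torsion cov (S.v x) u) w + Q.al u (torsion cov (S.v x) w)) :=
    ⟨fun u u' w => by rw [torsion_add_right, Q.alt_al.add_left, Q.alt_al.add_left]; ring,
      fun c u w => by rw [torsion_smul_right, Q.alt_al.smul_left, Q.alt_al.smul_left]; ring,
      fun u w => by rw [Q.alt_al.swap, Q.alt_al.swap u]; ring⟩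
  have hF : Q.IsFrame (S.frame x) := S.isFrame_frame cov x
  have e1 := hF.wedge_div_eq he h1 hLalt Q.alt_be
  rw [f, hL]
  refine Eq.trans e1 ?_
  have hJI : Q.J (Q.I e) = -Q.K e := Q.J_I e
  have hJJ : Q.J (Q.J e) = -e := by rw [Q.J_J, Q.pr_of_mem he]
  have hal (t : TangentSpace (𝓡 5) x) (i) : Q.al (Q.quat e i) t = Q.gH t
      ((![Q.J e, -Q.K e, -e, Q.I e] : Fin 4 → TangentSpace (𝓡 5) x) i) := by
    rw [← Q.gH_J, Q.gH_comm]
    congr 1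
    fin_cases i <;> simp [HyperkahlerSpace.quat, hJI, hJJ, Q.J_K]
  have hal' (t : TangentSpace (𝓡 5) x) (i) : Q.al t (Q.quat e i) = -Q.gH t
      ((![Q.J e, -Q.K e, -e, Q.I e] : Fin 4 → TangentSpace (𝓡 5) x) i) := by
    rw [Q.alt_al.swap, hal]
  have hn (u w : TangentSpace (𝓡 5) x) : Q.gH u (-w) = -Q.gH u w := by
    rw [← neg_one_smul ℝ, Q.gH_smul_right]; ring
  have hg (u w : TangentSpace (𝓡 5) x) : S.gH x u w = Q.gH u w := rfl
  simp only [wedge, Q.be_quat he h1, hal, hal', hg]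
  simp [betaMatrix, hn, HyperkahlerSpace.quat]
  ring

end IsDistinguished

end ContactHyperkahler

/-! ### The curvature of the distinguished connection -/

namespace ContactHyperkahler

variable {M : Type*} [TopologicalSpace M] [ChartedSpace (EuclideanSpace ℝ (Fin 5)) M]
  [IsManifold (𝓡 5) ∞ M] [T2Space M] {S : ContactHyperkahler M} {cov : Connection M} {x : M}

lemma smoothField_torsion_v (h : S.IsDistinguished cov)
    [CovariantDerivative.ContMDiffCovariantDerivative cov ∞] {X : VField M} (hX : SmoothField X) :
    SmoothField (fun y => torsion cov (S.v y) (X y)) := by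
  have hv := S.smoothField_v cov
  have e : (fun y => torsion cov (S.v y) (X y)) = fun y => cov X y (S.v y) - bracket S.v X y := by
    funext y
    rw [bracket_eq cov (hv.diffAt y) (hX.diffAt y), h.reeb_parallel]
    abel
  rw [e]
  exact (hv.cov hX).sub (hv.bracket hX)

variable [CovariantDerivative.ContMDiffCovariantDerivative cov ∞]

/-- The curvature endomorphisms annihilate the parallel triple, so that they are
anti-self-dual. -/
lemma IsDistinguished.isAsd_curvature (h : S.IsDistinguished cov) (u w : TangentSpace (𝓡 5) x) :
    (S.toSpace cov x).IsAsd (fun z t => S.gH x (curvature cov u w z) t) :=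
  HyperkahlerSpace.IsAsd.of_skew (ρ := curvature cov u w) (curvature_add_right cov u w)
    (fun c z => curvature_smul_right cov c u w z)
    (curvature_parallel cov (S.isTensor2_om cov) h.parallel_ω u w)
    (curvature_parallel cov S.isTensor2_al h.parallel_α u w)
    (curvature_parallel cov S.isTensor2_be h.parallel_β u w)

/-- The curvature is horizontal in the second pair of arguments, where the projections in the
definition of `R^H` may be dropped. -/
lemma IsDistinguished.RH_eq (h : S.IsDistinguished cov) (u w z t : TangentSpace (𝓡 5) x) :
    S.RH cov x u w z t = S.gH x (curvature cov (S.πH u) (S.πH w) z) t := by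
  have ha := h.isAsd_curvature (S.πH u) (S.πH w)
  have h1 : S.θ x (S.πH t) = 0 := (S.toSpace cov x).th_pr t
  have h2 : S.gH x (curvature cov (S.πH u) (S.πH w) (S.πH z)) (S.πH t) =
    S.gH x (curvature cov (S.πH u) (S.πH w) (S.πH z)) t := (S.toSpace cov x).gH_pr_right _ _
  have h3 : z = S.πH z + S.θ x z • S.v x := (S.toSpace cov x).pr_add_smul_v z
  have h4 : S.gH x (curvature cov (S.πH u) (S.πH w) (S.v x)) t = 0 := ha.v_left t
  have h5 := ha.alt.add_left (S.πH z) (S.θ x z • S.v x) t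
  have h6 := ha.alt.smul_left (S.θ x z) (S.v x) t
  rw [← h3] at h5
  rw [RH, g, h1, h2]
  rw [h5, h6, h4]
  ring

/-- The first Bianchi identity on `H`. -/
lemma IsDistinguished.bianchi_H (h : S.IsDistinguished cov) {u w z : TangentSpace (𝓡 5) x}
    (hu : S.θ x u = 0) (hw : S.θ x w = 0) (hz : S.θ x z = 0) (t : TangentSpace (𝓡 5) x) :
    S.gH x (curvature cov u w z) t + S.gH x (curvature cov w z u) t
        + S.gH x (curvature cov z u w) t =
      S.om x u w * S.gH x (torsion cov (S.v x) z) t + S.om x w z * S.gH x (torsion cov (S.v x) u) t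
        + S.om x z u * S.gH x (torsion cov (S.v x) w) t := by
  have hg {x : M} (w : TangentSpace (𝓡 5) x) := smoothField_gext w
  set Q := S.toSpace cov x with hQ
  have ga (p r) : S.gH x (p + r) t = S.gH x p t + S.gH x r t := Q.gH_add_left p r t
  have gs (c p) : S.gH x (c • p) t = c * S.gH x p t := Q.gH_smul_left c p t
  have gsub (p r) : S.gH x (p - r) t = S.gH x p t - S.gH x r t := by
    rw [sub_eq_add_neg, ← neg_one_smul ℝ r, ga, gs]; ring
  have gv : S.gH x (S.v x) t = 0 := Q.gH_v_left t
  -- The terms that depend on the extension of the vectors cancel in the cyclic sum.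
  have key {u w z : TangentSpace (𝓡 5) x} (hu : S.θ x u = 0) (hw : S.θ x w = 0)
      (hz : S.θ x z = 0) :
      S.gH x (cov (fun y => torsion cov (gext w y) (gext z y)) x u
        + torsion cov u (bracket (gext w) (gext z) x)) t =
      S.θ x (cov (gext w) x u) * S.gH x (torsion cov (S.v x) z) t
        - S.θ x (cov (gext z) x u) * S.gH x (torsion cov (S.v x) w) t
        - (S.θ x (cov (gext z) x w) - S.θ x (cov (gext w) x z) - S.om x w z)
          * S.gH x (torsion cov (S.v x) u) t := by
    have e1 : (fun y => torsion cov (gext w y) (gext z y)) = fun y =>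
        (S.om y (gext w y) (gext z y) • S.v y + S.θ y (gext w y) • torsion cov (S.v y) (gext z y))
          - S.θ y (gext z y) • torsion cov (S.v y) (gext w y) := funext fun y => h.torsion_eq _ _
    have s1 : SmoothFun (fun y => S.om y (gext w y) (gext z y)) :=
      (S.isTensor2_om cov).smooth (hg w) (hg z)
    have s2 (w : TangentSpace (𝓡 5) x) : SmoothFun (fun y => S.θ y (gext w y)) :=
      S.smooth_θ _ (hg w)
    have s3 := S.smoothField_v cov
    have s4 (w : TangentSpace (𝓡 5) x) := smoothField_torsion_v h (hg w)
    have e2 : S.θ x (bracket (gext w) (gext z) x) =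
        S.θ x (cov (gext z) x w) - S.θ x (cov (gext w) x z) - S.om x w z := by
      rw [bracket_eq cov ((hg w).diffAt x) ((hg z).diffAt x), map_sub, map_sub, gext_self,
        gext_self, h.th_torsion]
    rw [e1, cov_sub_field cov ((SmoothField.smul s1 s3).add (SmoothField.smul (s2 w) (s4 z)))
        (SmoothField.smul (s2 z) (s4 w)),
      cov_add_field cov (SmoothField.smul s1 s3) (SmoothField.smul (s2 w) (s4 z)), add_apply,
      cov_smul_field cov s1 s3, cov_smul_field cov (s2 w) (s4 z), cov_smul_field cov (s2 z) (s4 w),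
      h.torsion_eq u, e2, ← (h.toIsAdapted.cov_th (hg w) u).2, ← (h.toIsAdapted.cov_th (hg z) u).2]
    simp only [gext_self, hu, hw, hz, ga, gs, gsub, gv, h.reeb_parallel]
    have g0 : S.gH x 0 t = 0 := by simpa using gs 0 0
    rw [g0]
    ring
  have e := congrArg (fun p => S.gH x p t) (bianchi_identity cov u w z)
  simp only [ga] at e
  rw [e]
  have k1 := key hu hw hz
  have k2 := key hw hz hu
  have k3 := key hz hu hw
  rw [ga] at k1 k2 k3
  rw [k1, k2, k3]
  ring

end ContactHyperkahler

/-! ### Horizontal tensors and their contractions -/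

namespace HyperkahlerSpace

variable {V : Type*} [AddCommGroup V] [Module ℝ V] (Q : HyperkahlerSpace V)

/-- Linear functionals on `H`, extended by zero on the vertical vector `v`. -/
structure IsHor (φ : V → ℝ) : Prop extends IsLin φ where
  v : φ Q.v = 0

/-- Bilinear forms on `H`, extended by zero on the vertical vector `v`. -/
structure IsHor2 (B : V → V → ℝ) : Prop where
  fst : ∀ b, Q.IsHor (fun a => B a b)
  snd : ∀ a, Q.IsHor (fun b => B a b)

/-- Covariant `4`-tensors on `H`, extended by zero on the vertical vector `v`. -/
structure IsHor4 (R : V → V → V → V → ℝ) : Prop where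
  fst : ∀ b c d, Q.IsHor (fun a => R a b c d)
  snd : ∀ a c d, Q.IsHor (fun b => R a b c d)
  trd : ∀ a b d, Q.IsHor (fun c => R a b c d)
  fth : ∀ a b c, Q.IsHor (fun d => R a b c d)

variable {Q}

namespace IsHor

variable {φ ψ : V → ℝ}

lemma add' (h : Q.IsHor φ) (h' : Q.IsHor ψ) : Q.IsHor (fun u => φ u + ψ u) :=
  ⟨h.toIsLin.add' h'.toIsLin, by rw [h.v, h'.v, add_zero]⟩

lemma sub (h : Q.IsHor φ) (h' : Q.IsHor ψ) : Q.IsHor (fun u => φ u - ψ u) :=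
  ⟨h.toIsLin.sub' h'.toIsLin, by rw [h.v, h'.v, sub_zero]⟩

lemma neg (h : Q.IsHor φ) : Q.IsHor (fun u => -φ u) :=
  ⟨h.toIsLin.neg', by rw [h.v, neg_zero]⟩

lemma mul_const (h : Q.IsHor φ) (c : ℝ) : Q.IsHor (fun u => φ u * c) :=
  ⟨h.toIsLin.mul_const c, by rw [h.v, zero_mul]⟩

lemma const_mul (h : Q.IsHor φ) (c : ℝ) : Q.IsHor (fun u => c * φ u) :=
  ⟨h.toIsLin.const_mul c, by rw [h.v, mul_zero]⟩

lemma div_const (h : Q.IsHor φ) (c : ℝ) : Q.IsHor (fun u => φ u / c) := by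
  simpa only [div_eq_mul_inv] using h.mul_const c⁻¹

lemma sum {ι : Type*} (s : Finset ι) {φ : ι → V → ℝ} (h : ∀ i, Q.IsHor (φ i)) :
    Q.IsHor (fun u => ∑ i ∈ s, φ i u) :=
  ⟨IsLin.sum' s fun i => (h i).toIsLin, by simp only [(h _).v, Finset.sum_const_zero]⟩

end IsHor

lemma IsHor2.isBilin {B : V → V → ℝ} (h : Q.IsHor2 B) : IsBilin B :=
  ⟨fun w => (h.fst w).toIsLin, fun u => (h.snd u).toIsLin⟩

lemma IsHor2.ext {q : Fin 4 → V} (hq : Q.IsFrame q) {B B' : V → V → ℝ} (h : Q.IsHor2 B)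
    (h' : Q.IsHor2 B') (e : ∀ i j, B (q i) (q j) = B' (q i) (q j)) (u w : V) : B u w = B' u w :=
  hq.isBilin_ext h.isBilin h'.isBilin (fun w => (h.fst w).v) (fun w => (h.snd w).v)
    (fun w => (h'.fst w).v) (fun w => (h'.snd w).v) e u w

lemma isHor2_gH : Q.IsHor2 Q.gH :=
  ⟨fun w => ⟨⟨fun u u' => Q.gH_add_left u u' w, fun c u => Q.gH_smul_left c u w⟩, Q.gH_v_left w⟩,
    fun w => ⟨⟨Q.gH_add_right w, fun c u => Q.gH_smul_right c w u⟩, Q.gH_v_right w⟩⟩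

lemma IsAsd.isHor2 {B : V → V → ℝ} (h : Q.IsAsd B) : Q.IsHor2 B :=
  ⟨fun w => ⟨h.alt.isBilin.left w, h.v_left w⟩, fun u => ⟨h.alt.isBilin.right u, h.v_right u⟩⟩

lemma isHor2_star2 (f : Fin 4 → V) (B : V → V → ℝ) : Q.IsHor2 (Q.star2 f B) :=
  ⟨fun w => ⟨(Q.isBilin_star2 f B).left w, Q.star2_v_left f B w⟩,
    fun w => ⟨(Q.isBilin_star2 f B).right w, Q.star2_v_right f B w⟩⟩

/-- The anti-self-dual part of a `2`-form, with the Hodge star computed in the frame `f`. -/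
def asdPart (Q : HyperkahlerSpace V) (f : Fin 4 → V) (B : V → V → ℝ) (u w : V) : ℝ :=
  (B u w - Q.star2 f B u w) / 2

lemma IsHor2.asdPart {B : V → V → ℝ} (h : Q.IsHor2 B) (f : Fin 4 → V) :
    Q.IsHor2 (Q.asdPart f B) :=
  ⟨fun w => ((h.fst w).sub ((isHor2_star2 f B).fst w)).div_const 2,
    fun w => ((h.snd w).sub ((isHor2_star2 f B).snd w)).div_const 2⟩

/-- The curvature tensor part `R_s - b(R_s)` of `R`, with `R_s` the symmetrization of `R` under
exchange of pairs. -/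
def algCurv (R : V → V → V → V → ℝ) (a b c d : V) : ℝ :=
  pairSymm R a b c d - bianchi (pairSymm R) a b c d

/-- The Ricci contraction of the curvature tensor part of `R`, computed in the frame `f`. -/
def ric (f : Fin 4 → V) (R : V → V → V → V → ℝ) (a b : V) : ℝ := ∑ i, algCurv R (f i) a b (f i)

/-- The scalar curvature of the curvature tensor part of `R`, computed in the frame `f`. -/
def scal (f : Fin 4 → V) (R : V → V → V → V → ℝ) : ℝ := ∑ i, ric f R (f i) (f i)

/-- The Weyl part of the curvature tensor part of `R`, computed in the frame `f`. -/
def weyl (Q : HyperkahlerSpace V) (f : Fin 4 → V) (R : V → V → V → V → ℝ) (a b c d : V) : ℝ :=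
  algCurv R a b c d - kulkarniNomizu (ric f R) Q.gH a b c d / 2
    + scal f R / 12 * kulkarniNomizu Q.gH Q.gH a b c d

/-- The anti-self-dual component of the Weyl part of `R`, computed in the frame `f`. -/
def weylAsd (Q : HyperkahlerSpace V) (f : Fin 4 → V) (R : V → V → V → V → ℝ) (a b c d : V) : ℝ :=
  Q.asdPart f (fun a' b' => Q.asdPart f (fun c' d' => Q.weyl f R a' b' c' d') c d) a b

/-- The operator `ε^m ι^n` in the frame `f`. -/
def epsIota (Q : HyperkahlerSpace V) (f : Fin 4 → V) (m n : Fin 4) (B : V → V → ℝ) (u w : V) : ℝ :=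
  Q.gH (f m) u * B (f n) w - Q.gH (f m) w * B (f n) u

/-- The endomorphism `∑ P_{klmn} ε^k ι^l ε^m ι^n`, computed in the frame `f`. -/
def act (Q : HyperkahlerSpace V) (f : Fin 4 → V) (P : V → V → V → V → ℝ) (B : V → V → ℝ)
    (u w : V) : ℝ :=
  ∑ k, ∑ l, ∑ m, ∑ n, P (f k) (f l) (f m) (f n) * Q.epsIota f k l (Q.epsIota f m n B) u w

section Tensors

variable {R P : V → V → V → V → ℝ} {f q : Fin 4 → V}

namespace IsHor4

lemma pairSymm (h : Q.IsHor4 R) : Q.IsHor4 (pairSymm R) :=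
  ⟨fun b c d => ((h.fst b c d).add' (h.trd c d b)).div_const 2,
    fun a c d => ((h.snd a c d).add' (h.fth c d a)).div_const 2,
    fun a b d => ((h.trd a b d).add' (h.fst d a b)).div_const 2,
    fun a b c => ((h.fth a b c).add' (h.snd c a b)).div_const 2⟩

lemma bianchi (h : Q.IsHor4 R) : Q.IsHor4 (bianchi R) :=
  ⟨fun b c d => (((h.fst b c d).add' (h.trd b c d)).add' (h.snd c b d)).div_const 3,
    fun a c d => (((h.snd a c d).add' (h.fst c a d)).add' (h.trd c a d)).div_const 3,
    fun a b d => (((h.trd a b d).add' (h.snd b a d)).add' (h.fst a b d)).div_const 3,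
    fun a b c => (((h.fth a b c).add' (h.fth b c a)).add' (h.fth c a b)).div_const 3⟩

lemma sub (h : Q.IsHor4 R) (h' : Q.IsHor4 P) : Q.IsHor4 (fun a b c d => R a b c d - P a b c d) :=
  ⟨fun b c d => (h.fst b c d).sub (h'.fst b c d), fun a c d => (h.snd a c d).sub (h'.snd a c d),
    fun a b d => (h.trd a b d).sub (h'.trd a b d), fun a b c => (h.fth a b c).sub (h'.fth a b c)⟩

lemma add (h : Q.IsHor4 R) (h' : Q.IsHor4 P) : Q.IsHor4 (fun a b c d => R a b c d + P a b c d) :=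
  ⟨fun b c d => (h.fst b c d).add' (h'.fst b c d), fun a c d => (h.snd a c d).add' (h'.snd a c d),
    fun a b d => (h.trd a b d).add' (h'.trd a b d), fun a b c => (h.fth a b c).add' (h'.fth a b c)⟩

lemma const_mul (h : Q.IsHor4 R) (k : ℝ) : Q.IsHor4 (fun a b c d => k * R a b c d) :=
  ⟨fun b c d => (h.fst b c d).const_mul k, fun a c d => (h.snd a c d).const_mul k,
    fun a b d => (h.trd a b d).const_mul k, fun a b c => (h.fth a b c).const_mul k⟩

lemma div_const (h : Q.IsHor4 R) (k : ℝ) : Q.IsHor4 (fun a b c d => R a b c d / k) :=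
  ⟨fun b c d => (h.fst b c d).div_const k, fun a c d => (h.snd a c d).div_const k,
    fun a b d => (h.trd a b d).div_const k, fun a b c => (h.fth a b c).div_const k⟩

lemma algCurv (h : Q.IsHor4 R) : Q.IsHor4 (algCurv R) := h.pairSymm.sub h.pairSymm.bianchi

end IsHor4

lemma IsHor2.kulkarniNomizu {A B : V → V → ℝ} (hA : Q.IsHor2 A) (hB : Q.IsHor2 B) :
    Q.IsHor4 (kulkarniNomizu A B) :=
  ⟨fun _ c d => ((((hA.fst d).mul_const _).add' ((hB.fst d).const_mul _)).sub
      ((hA.fst c).mul_const _)).sub ((hB.fst c).const_mul _),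
    fun _ c d => ((((hB.fst c).const_mul _).add' ((hA.fst c).mul_const _)).sub
      ((hB.fst d).const_mul _)).sub ((hA.fst d).mul_const _),
    fun a b _ => ((((hB.snd b).const_mul _).add' ((hA.snd b).mul_const _)).sub
      ((hA.snd a).mul_const _)).sub ((hB.snd a).const_mul _),
    fun a b _ => ((((hA.snd a).mul_const _).add' ((hB.snd a).const_mul _)).sub
      ((hB.snd b).const_mul _)).sub ((hA.snd b).mul_const _)⟩

lemma IsHor4.ric (h : Q.IsHor4 R) (f : Fin 4 → V) : Q.IsHor2 (ric f R) :=
  ⟨fun b => IsHor.sum _ fun _ => h.algCurv.snd _ b _,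
    fun a => IsHor.sum _ fun _ => h.algCurv.trd _ a _⟩

lemma IsHor4.weyl (h : Q.IsHor4 R) (f : Fin 4 → V) : Q.IsHor4 (Q.weyl f R) :=
  (h.algCurv.sub (((h.ric f).kulkarniNomizu isHor2_gH).div_const 2)).add
    ((isHor2_gH.kulkarniNomizu isHor2_gH).const_mul _)

lemma IsHor4.asdPart (h : Q.IsHor4 R) (f : Fin 4 → V) :
    Q.IsHor4 (fun a b c d => Q.asdPart f (fun c' d' => R a b c' d') c d) := by
  have h2 (a b) : Q.IsHor2 (R a b) := ⟨h.trd a b, h.fth a b⟩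
  exact ⟨fun b c d => ((h.fst b c d).sub ((IsHor.sum _ fun _ => IsHor.sum _ fun _ =>
      (h.fst _ _ _).mul_const _).div_const 2)).div_const 2,
    fun a c d => ((h.snd a c d).sub ((IsHor.sum _ fun _ => IsHor.sum _ fun _ =>
      (h.snd _ _ _).mul_const _).div_const 2)).div_const 2,
    fun a b => ((h2 a b).asdPart f).fst, fun a b => ((h2 a b).asdPart f).snd⟩

lemma IsHor4.weylAsd (h : Q.IsHor4 R) (f : Fin 4 → V) : Q.IsHor4 (Q.weylAsd f R) := by
  have h1 := (h.weyl f).asdPart f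
  have h2 : Q.IsHor4 (fun c d a b => Q.asdPart f (fun c' d' => Q.weyl f R a b c' d') c d) :=
    ⟨fun d a b => h1.trd a b d, fun c a b => h1.fth a b c, fun c d b => h1.fst b c d,
      fun c d a => h1.snd a c d⟩
  have h3 := h2.asdPart f
  exact ⟨fun b c d => h3.trd c d b, fun a c d => h3.fth c d a, fun a b d => h3.fst d a b,
    fun a b c => h3.snd c a b⟩

lemma IsFrame.ric_eq (hf : Q.IsFrame f) (hq : Q.IsFrame q) (h : Q.IsHor4 R) :
    ric f R = ric q R :=
  funext fun a => funext fun b => hf.trace_eq hq (B := fun p r => algCurv R p a b r)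
    ⟨fun w => (h.algCurv.fst a b w).toIsLin, fun w => (h.algCurv.fth w a b).toIsLin⟩

lemma IsFrame.scal_eq (hf : Q.IsFrame f) (hq : Q.IsFrame q) (h : Q.IsHor4 R) :
    scal f R = scal q R := by
  rw [scal, hf.ric_eq hq h]
  exact hf.trace_eq hq (h.ric q).isBilin

/-- The components of the Weyl part do not depend on the frame used for contractions. -/
lemma IsFrame.weyl_eq (hf : Q.IsFrame f) (hq : Q.IsFrame q) (h : Q.IsHor4 R) (a b c d : Fin 4) :
    Q.weyl f R (q a) (q b) (q c) (q d) =
      weylMatrix (fun i j k l => R (q i) (q j) (q k) (q l)) a b c d := by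
  rw [weyl, hf.ric_eq hq h, hf.scal_eq hq h]
  simp only [kulkarniNomizu, hq.gH_eq]
  rfl

lemma asdPart_quat {e : V} (he : Q.th e = 0) (h1 : Q.gH e e = 1) (hf : Q.IsFrame f)
    {B : V → V → ℝ} (hB : IsBilin B) (i j : Fin 4) :
    Q.asdPart f B (Q.quat e i) (Q.quat e j) =
      asdPartMatrix (fun k l => B (Q.quat e k) (Q.quat e l)) i j := by
  rw [asdPart, hf.star2_eq (Q.isFrame_quat he h1) hB]
  simp only [asdPartMatrix, starMatrix, star2, vol, wedge, om_quat he h1]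

lemma weylAsd_quat {e : V} (he : Q.th e = 0) (h1 : Q.gH e e = 1) (hf : Q.IsFrame f)
    (h : Q.IsHor4 R) (a b c d : Fin 4) :
    Q.weylAsd f R (Q.quat e a) (Q.quat e b) (Q.quat e c) (Q.quat e d) = asdAsdPart (weylMatrix
      fun i j k l => R (Q.quat e i) (Q.quat e j) (Q.quat e k) (Q.quat e l)) a b c d := by
  have hw := h.weyl f
  have ha := hw.asdPart f
  rw [weylAsd, asdPart_quat he h1 hf
    ⟨fun w => (ha.fst w _ _).toIsLin, fun w => (ha.snd w _ _).toIsLin⟩, asdAsdPart]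
  congr 1
  funext a' b'
  rw [asdPart_quat he h1 hf
    ⟨fun w => (hw.trd _ _ w).toIsLin, fun w => (hw.fth _ _ w).toIsLin⟩]
  simp only [hf.weyl_eq (Q.isFrame_quat he h1) h]

/-- The sums over `k` and `m` are evaluated, since `e^k` and `e^m` are dual to the frame. -/
lemma IsFrame.act_eq (hf : Q.IsFrame f) (hP : Q.IsHor4 P) (B : V → V → ℝ) (u w : V) :
    Q.act f P B u w = ∑ l, ∑ n, (P u (f l) (f l) (f n) * B (f n) w
      - P u (f l) w (f n) * B (f n) (f l)
      - P w (f l) (f l) (f n) * B (f n) u + P w (f l) u (f n) * B (f n) (f l)) := by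
  have hg (u) (b c d) : ∑ k, P (f k) b c d * Q.gH (f k) u = P u b c d := by
    rw [hf.isLin_expand (hP.fst b c d).toIsLin (hP.fst b c d).v u]
    exact Finset.sum_congr rfl fun k _ => by rw [Q.gH_comm]; ring
  have hg' (u) (a b d) : ∑ m, P a b (f m) d * Q.gH (f m) u = P a b u d := by
    rw [hf.isLin_expand (hP.trd a b d).toIsLin (hP.trd a b d).v u]
    exact Finset.sum_congr rfl fun k _ => by rw [Q.gH_comm]; ring
  have e1 (k l : Fin 4) (u w : V) : ∑ m, ∑ n, P (f k) (f l) (f m) (f n) *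
      (Q.gH (f m) (f l) * B (f n) w - Q.gH (f m) w * B (f n) (f l)) =
      ∑ n, (P (f k) (f l) (f l) (f n) * B (f n) w - P (f k) (f l) w (f n) * B (f n) (f l)) := by
    rw [Finset.sum_comm]
    refine Finset.sum_congr rfl fun n _ => ?_
    rw [← hg' (f l), ← hg' w, Finset.sum_mul, Finset.sum_mul, ← Finset.sum_sub_distrib]
    exact Finset.sum_congr rfl fun m _ => by ring
  have e2 (k l : Fin 4) : ∑ m, ∑ n, P (f k) (f l) (f m) (f n) *
      Q.epsIota f k l (Q.epsIota f m n B) u w =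
      Q.gH (f k) u * ∑ n,
        (P (f k) (f l) (f l) (f n) * B (f n) w - P (f k) (f l) w (f n) * B (f n) (f l))
      - Q.gH (f k) w *
        ∑ n, (P (f k) (f l) (f l) (f n) * B (f n) u - P (f k) (f l) u (f n) * B (f n) (f l)) := by
    rw [← e1 k l u w, ← e1 k l w u]
    simp only [Finset.mul_sum, ← Finset.sum_sub_distrib]
    refine Finset.sum_congr rfl fun m _ => Finset.sum_congr rfl fun n _ => ?_
    simp only [epsIota]
    ring
  rw [act]
  simp only [e2]
  rw [Finset.sum_comm]
  refine Finset.sum_congr rfl fun l _ => ?_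
  simp only [Finset.mul_sum, ← Finset.sum_sub_distrib]
  rw [Finset.sum_comm]
  refine Finset.sum_congr rfl fun n _ => ?_
  rw [← hg u (f l) (f l) (f n), ← hg u (f l) w (f n), ← hg w (f l) (f l) (f n),
    ← hg w (f l) u (f n)]
  simp only [Finset.sum_mul, ← Finset.sum_sub_distrib, ← Finset.sum_add_distrib]
  exact Finset.sum_congr rfl fun k _ => by ring

lemma IsHor2.act {B : V → V → ℝ} (hf : Q.IsFrame f) (hP : Q.IsHor4 P) (hB : Q.IsHor2 B) :
    Q.IsHor2 (Q.act f P B) := by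
  have e : Q.act f P B = _ := funext fun u => funext fun w => hf.act_eq hP B u w
  rw [e]
  exact ⟨fun w => IsHor.sum _ fun _ => IsHor.sum _ fun _ =>
      ((((hP.fst _ _ _).mul_const _).sub ((hP.fst _ _ _).mul_const _)).sub
        ((hB.snd _).const_mul _)).add' ((hP.trd _ _ _).mul_const _),
    fun w => IsHor.sum _ fun _ => IsHor.sum _ fun _ =>
      ((((hB.snd _).const_mul _).sub ((hP.trd _ _ _).mul_const _)).sub
        ((hP.fst _ _ _).mul_const _)).add' ((hP.fst _ _ _).mul_const _)⟩

lemma IsFrame.act_frame (hf : Q.IsFrame f) (hq : Q.IsFrame q) (hP : Q.IsHor4 P) {B : V → V → ℝ}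
    (hB : Q.IsHor2 B) (i j : Fin 4) : Q.act f P B (q i) (q j) =
      actMatrix (fun a b c d => P (q a) (q b) (q c) (q d)) (fun a b => B (q a) (q b)) i j := by
  rw [hf.act_eq hP, hf.trace₂_eq hq (F := fun p p' r r' => P (q i) p p' r * B r' (q j)
    - P (q i) p (q j) r * B r' p' - P (q j) p p' r * B r' (q i) + P (q j) p (q i) r * B r' p')]
  · rfl
  · exact fun r r' => ⟨fun w => ((((hP.snd _ _ _).mul_const _).sub ((hP.snd _ _ _).mul_const _)).sub
        ((hP.snd _ _ _).mul_const _)).add' ((hP.snd _ _ _).mul_const _) |>.toIsLin,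
      fun w => ((((hP.trd _ _ _).mul_const _).sub ((hB.snd _).const_mul _)).sub
        ((hP.trd _ _ _).mul_const _)).add' ((hB.snd _).const_mul _) |>.toIsLin⟩
  · exact fun r r' => ⟨fun w => ((((hP.fth _ _ _).mul_const _).sub ((hP.fth _ _ _).mul_const _)).sub
        ((hP.fth _ _ _).mul_const _)).add' ((hP.fth _ _ _).mul_const _) |>.toIsLin,
      fun w => ((((hB.fst _).const_mul _).sub ((hB.fst _).const_mul _)).sub
        ((hB.fst _).const_mul _)).add' ((hB.fst _).const_mul _) |>.toIsLin⟩

end Tensors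

end HyperkahlerSpace

/-! ### The Weitzenböck formula -/

open HyperkahlerSpace

namespace ContactHyperkahler

variable {M : Type*} [TopologicalSpace M] [ChartedSpace (EuclideanSpace ℝ (Fin 5)) M]
  [IsManifold (𝓡 5) ∞ M] [T2Space M] {S : ContactHyperkahler M} {cov : Connection M} {x : M}

namespace IsDistinguished

/-- The components of `T_v` along the imaginary units are determined by the other ones, since
`T_v` is skew for `ω`. -/
lemma torsion_v_quat (h : S.IsDistinguished cov) {e : TangentSpace (𝓡 5) x} (he : S.θ x e = 0)
    {t : Fin 4 → Fin 4 → ℝ} (ht : ∀ k l, t k l = S.gH x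
      (torsion cov (S.v x) ((S.toSpace cov x).quat e k)) ((S.toSpace cov x).quat e l)) :
    t 1 1 = -t 0 0 ∧ t 2 1 = t 0 3 ∧ t 3 1 = -t 0 2 := by
  set Q := S.toSpace cov x with hQ
  have hn (u w : TangentSpace (𝓡 5) x) : Q.gH u (-w) = -Q.gH u w :=
    (HyperkahlerSpace.isHor2_gH.snd u).toIsLin.neg w
  have hI (u w : TangentSpace (𝓡 5) x) : Q.om u w = -Q.gH u (Q.I w) := by
    rw [HyperkahlerSpace.gH, Q.I_I, (Q.alt_om.isBilin.right u).neg,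
      Q.alt_om.swap u (Q.pr w), Q.om_pr, ← Q.alt_om.swap, neg_neg]
  have key (u w : TangentSpace (𝓡 5) x) : Q.gH (torsion cov (S.v x) w) (Q.I u) =
      Q.gH (torsion cov (S.v x) u) (Q.I w) := by
    have h1 : Q.om (torsion cov (S.v x) u) w + Q.om u (torsion cov (S.v x) w) = 0 :=
      h.om_torsion_v u w
    rw [Q.alt_om.swap u, hI, hI] at h1
    linarith
  have ht' (k l) : t k l = Q.gH (torsion cov (S.v x) (Q.quat e k)) (Q.quat e l) := ht k l
  simp only [ht']
  have k1 := key e (Q.I e)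
  have k2 := key e (Q.J e)
  have k3 := key e (Q.K e)
  rw [Q.I_I_of_mem he, hn] at k1
  rw [Q.I_J] at k2
  rw [Q.I_K, hn] at k3
  exact ⟨k1, k2, k3⟩

variable [CovariantDerivative.ContMDiffCovariantDerivative cov ∞]

lemma isHor4_RH (h : S.IsDistinguished cov) : (S.toSpace cov x).IsHor4 (S.RH cov x) := by
  set Q := S.toSpace cov x with hQ
  have e : S.RH cov x = fun u w z t => Q.gH (curvature cov (Q.pr u) (Q.pr w) z) t :=
    funext fun u => funext fun w => funext fun z => funext fun t => h.RH_eq u w z t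
  have h0 (w z) : curvature cov (0 : TangentSpace (𝓡 5) x) w z = 0 := by
    simpa using curvature_smul_left cov (0 : ℝ) 0 w z
  have hg0 (t) : Q.gH 0 t = 0 := by simpa using Q.gH_smul_left 0 0 t
  have h1 (w z t) : Q.IsHor (fun u => Q.gH (curvature cov (Q.pr u) (Q.pr w) z) t) :=
    ⟨⟨fun u u' => by rw [Q.pr_add, curvature_add_left, Q.gH_add_left],
      fun c u => by rw [Q.pr_smul, curvature_smul_left, Q.gH_smul_left]⟩, by rw [Q.pr_v, h0, hg0]⟩
  rw [e]
  refine ⟨h1, fun u z t => ?_, fun u w => (h.isAsd_curvature (Q.pr u) (Q.pr w)).isHor2.fst,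
    fun u w => (h.isAsd_curvature (Q.pr u) (Q.pr w)).isHor2.snd⟩
  have e1 : (fun w => Q.gH (curvature cov (Q.pr u) (Q.pr w) z) t) =
      fun w => -Q.gH (curvature cov (Q.pr w) (Q.pr u) z) t := funext fun w => by
    rw [curvature_swap]; exact (HyperkahlerSpace.isHor2_gH.fst t).toIsLin.neg _
  rw [e1]
  exact (h1 u z t).neg

/-- The components of the curvature in quaternionic frames. -/
lemma RH_quat (h : S.IsDistinguished cov) {e : TangentSpace (𝓡 5) x} (he : S.θ x e = 0)
    (h1 : S.gH x e e = 1) (i j k l : Fin 4) :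
    S.RH cov x ((S.toSpace cov x).quat e i) ((S.toSpace cov x).quat e j)
      ((S.toSpace cov x).quat e k) ((S.toSpace cov x).quat e l) =
    S.gH x (curvature cov ((S.toSpace cov x).quat e i) ((S.toSpace cov x).quat e j)
      ((S.toSpace cov x).quat e k)) ((S.toSpace cov x).quat e l) := by
  have hp (i) : S.πH ((S.toSpace cov x).quat e i) = (S.toSpace cov x).quat e i :=
    (S.toSpace cov x).pr_of_mem (((S.toSpace cov x).isFrame_quat he h1).th_eq i)
  rw [h.RH_eq, hp, hp]

/-- The Ricci identity for horizontal `2`-forms, in components. -/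
lemma ricci_frame (h : S.IsDistinguished cov) {η : Tensor2 M} (hη : IsTensor2 η)
    (ha : (S.toSpace cov x).IsAsd (η x)) {q : Fin 4 → TangentSpace (𝓡 5) x}
    (hq : (S.toSpace cov x).IsFrame q) (i j k l : Fin 4) :
    covD3 cov (covD2 cov η) x (q i) (q j) (q k) (q l)
        - covD3 cov (covD2 cov η) x (q j) (q i) (q k) (q l) =
      -(∑ m, S.gH x (curvature cov (q i) (q j) (q k)) (q m) * η x (q m) (q l))
        - (∑ m, S.gH x (curvature cov (q i) (q j) (q l)) (q m) * η x (q k) (q m))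
        - S.om x (q i) (q j) * covD2 cov η x (S.v x) (q k) (q l) := by
  rw [ricci_identity cov hη, h.torsion_of_mem (hq.th_eq i) (hq.th_eq j), (hη.covD2 cov).smul_fst,
    hq.isLin_expand (ha.isHor2.fst (q l)).toIsLin (ha.isHor2.fst (q l)).v,
    hq.isLin_expand (ha.isHor2.snd (q k)).toIsLin (ha.isHor2.snd (q k)).v]
  rfl

variable {η : Tensor2 M}

lemma isHor2_dH1_dHadj (h : S.IsDistinguished cov) (hη : IsTensor2 η)
    (ha : ∀ y, (S.toSpace cov y).IsAsd (η y)) (hs : ∀ y u w, S.star2 y (η y) u w = -η y u w) :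
    (S.toSpace cov x).IsHor2 (S.dH1 (S.dHadj η) x) := by
  set Q := S.toSpace cov x with hQ
  have hF := S.isFrame_frame cov x
  have hD := hη.covD2 cov
  have hpr {φ : TangentSpace (𝓡 5) x → ℝ} (hφ : IsLin φ) : Q.IsHor (fun u => φ (Q.pr u)) :=
    ⟨⟨fun u w => by rw [Q.pr_add, hφ.add], fun c u => by rw [Q.pr_smul, hφ.smul]⟩,
      by rw [Q.pr_v, hφ.zero]⟩
  have e : S.dH1 (S.dHadj η) x = fun u w =>
      -(∑ i, covD3 cov (covD2 cov η) x (Q.pr u) (S.frame x i) (S.frame x i) (Q.pr w))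
        + ∑ i, covD3 cov (covD2 cov η) x (Q.pr w) (S.frame x i) (S.frame x i) (Q.pr u) :=
    funext fun u => funext fun w => h.dH1_dHadj hη ha hs x hF u w
  have l1 (w) (i : Fin 4) : Q.IsHor (fun u =>
      covD3 cov (covD2 cov η) x (Q.pr u) (S.frame x i) (S.frame x i) w) :=
    hpr (φ := fun u => covD3 cov (covD2 cov η) x u (S.frame x i) (S.frame x i) w)
      ⟨fun u u' => hD.covD3_add_vec cov u u' _ _ _, fun c u => hD.covD3_smul_vec cov c u _ _ _⟩
  have l2 (u) (i : Fin 4) : Q.IsHor (fun w =>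
      covD3 cov (covD2 cov η) x u (S.frame x i) (S.frame x i) (Q.pr w)) :=
    hpr (φ := fun w => covD3 cov (covD2 cov η) x u (S.frame x i) (S.frame x i) w)
      ⟨fun w w' => hD.covD3_add_trd cov u _ _ w w', fun c w => hD.covD3_smul_trd cov c u _ _ w⟩
  rw [e]
  exact ⟨fun w => (HyperkahlerSpace.IsHor.sum _ fun i => l1 _ i).neg.add'
      (HyperkahlerSpace.IsHor.sum _ fun i => l2 _ i),
    fun u => (HyperkahlerSpace.IsHor.sum _ fun i => l2 _ i).neg.add'
      (HyperkahlerSpace.IsHor.sum _ fun i => l1 _ i)⟩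

/-- The Weitzenböck formula for `□_H`. Both sides are horizontal and bilinear in `z₁, z₂`, and
none of the contractions depends on the frame, so that it suffices to compare the components in a
quaternionic frame. -/
theorem weitzenbock (hcov : S.IsDistinguished cov)
    {σ : Π x : M, LinearMap.BilinForm ℝ (TangentSpace (𝓡 5) x)} (hσ : S.IsASDForm σ)
    (x : M) (z₁ z₂ : TangentSpace (𝓡 5) x) :
    2 * S.box (fun y u w => σ y u w) x z₁ z₂ =
      S.nablaHadj cov (S.nablaH cov (fun y u w => σ y u w)) x z₁ z₂
        + S.curvAction (S.WHminus cov) (fun y u w => σ y u w) x z₁ z₂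
        + S.scalH cov x / 3 * σ x z₁ z₂
        - 2 / 3 * S.f x * σ x z₁ z₂ := by
  set η : Tensor2 M := fun y u w => σ y u w with hη'
  have hη : IsTensor2 η := hσ.isTensor2
  have ha (y) : (S.toSpace cov y).IsAsd (η y) := hσ.isAsd cov y
  have hs (y) (u w : TangentSpace (𝓡 5) y) : S.star2 y (η y) u w = -η y u w := hσ.asd y u w
  set Q := S.toSpace cov x with hQ
  have hF : Q.IsFrame (S.frame x) := S.isFrame_frame cov x
  have hR : Q.IsHor4 (S.RH cov x) := hcov.isHor4_RH
  have hD := hη.covD2 cov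
  have hA (u w) : Q.IsAsd (covD3 cov (covD2 cov η) x u w) :=
    hcov.isAsd_covD3 hD (fun y u => hcov.isAsd_covD2 hη ha y u) x u w
  obtain ⟨e, he, h1⟩ := Q.exists_unit
  set q := Q.quat e with hqe
  have hq : Q.IsFrame q := Q.isFrame_quat he h1
  have hpr (i) : S.πH (q i) = q i := Q.pr_of_mem (hq.th_eq i)
  have hT : Q.IsHor2 (fun u w => -∑ i, covD3 cov (covD2 cov η) x (q i) (q i) u w) :=
    ⟨fun w => (IsHor.sum _ fun i => (hA _ _).isHor2.fst w).neg,
      fun w => (IsHor.sum _ fun i => (hA _ _).isHor2.snd w).neg⟩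
  have hN (u w) : S.nablaHadj cov (S.nablaH cov η) x u w =
      -∑ i, covD3 cov (covD2 cov η) x (q i) (q i) u w := by
    rw [hcov.nablaHadj_nablaH hη, hF.trace_eq hq
      (B := fun p r => covD3 cov (covD2 cov η) x p r u w)
      ⟨fun _ => ⟨fun _ _ => hD.covD3_add_vec cov _ _ _ _ _,
          fun _ _ => hD.covD3_smul_vec cov _ _ _ _ _⟩,
        fun _ => ⟨fun _ _ => hD.covD3_add_fst cov _ _ _ _ _,
          fun _ _ => hD.covD3_smul_fst cov _ _ _ _ _⟩⟩]
  have hE := hcov.isHor2_dH1_dHadj (x := x) hη ha hs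
  have hP := hR.weylAsd (S.frame x)
  have hB := (ha x).isHor2
  have key (i j : Fin 4) : 2 * Q.asdPart (S.frame x) (S.dH1 (S.dHadj η) x) (q i) (q j) =
      -∑ k, covD3 cov (covD2 cov η) x (q k) (q k) (q i) (q j)
        + Q.act (S.frame x) (Q.weylAsd (S.frame x) (S.RH cov x)) (η x) (q i) (q j)
        + scal (S.frame x) (S.RH cov x) / 3 * η x (q i) (q j)
        - 2 / 3 * S.f x * η x (q i) (q j) := by
    have hC (i j k l : Fin 4) : S.gH x (curvature cov (q i) (q j) (q k)) (q l) =
        asdMatrix (S.gH x (curvature cov (q i) (q j) e) (Q.I e))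
          (S.gH x (curvature cov (q i) (q j) e) (Q.J e))
          (S.gH x (curvature cov (q i) (q j) e) (Q.K e)) k l :=
      (hcov.isAsd_curvature (q i) (q j)).quat_eq e k l
    have hK (i j k l : Fin 4) : S.RH cov x (q i) (q j) (q k) (q l) =
        S.gH x (curvature cov (q i) (q j) (q k)) (q l) := hcov.RH_quat he h1 i j k l
    have hG (i j k l : Fin 4) : covD3 cov (covD2 cov η) x (q i) (q j) (q k) (q l) =
        asdMatrix (covD3 cov (covD2 cov η) x (q i) (q j) e (Q.I e))
          (covD3 cov (covD2 cov η) x (q i) (q j) e (Q.J e))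
          (covD3 cov (covD2 cov η) x (q i) (q j) e (Q.K e)) k l := (hA (q i) (q j)).quat_eq e k l
    have hS (k l : Fin 4) : η x (q k) (q l) =
        asdMatrix (η x e (Q.I e)) (η x e (Q.J e)) (η x e (Q.K e)) k l := (ha x).quat_eq e k l
    have hδ (k l : Fin 4) : covD2 cov η x (S.v x) (q k) (q l) =
        asdMatrix (covD2 cov η x (S.v x) e (Q.I e)) (covD2 cov η x (S.v x) e (Q.J e))
          (covD2 cov η x (S.v x) e (Q.K e)) k l :=
      (hcov.isAsd_covD2 hη ha x (S.v x)).quat_eq e k l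
    obtain ⟨t₁, t₂, t₃⟩ := hcov.torsion_v_quat (t := fun k l => S.gH x
      (torsion cov (S.v x) (q k)) (q l)) he fun _ _ => rfl
    have hsw (i j : Fin 4) (z t : TangentSpace (𝓡 5) x) :
        S.gH x (curvature cov (q i) (q j) z) t = -S.gH x (curvature cov (q j) (q i) z) t := by
      rw [curvature_swap]; exact (isHor2_gH.fst (Q := Q) t).toIsLin.neg _
    have hom (i j : Fin 4) : S.om x (q i) (q j) = omMatrix i j := om_quat he h1 i j
    have hd (u w : Fin 4) : S.dH1 (S.dHadj η) x (q u) (q w) = _ :=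
      hcov.dH1_dHadj hη ha hs x hq (q u) (q w)
    have main := weitzenbock_matrix
      (ρ₁ := fun i j => S.gH x (curvature cov (q i) (q j) e) (Q.I e))
      (ρ₂ := fun i j => S.gH x (curvature cov (q i) (q j) e) (Q.J e))
      (ρ₃ := fun i j => S.gH x (curvature cov (q i) (q j) e) (Q.K e))
      (g₁ := fun i j => covD3 cov (covD2 cov η) x (q i) (q j) e (Q.I e))
      (g₂ := fun i j => covD3 cov (covD2 cov η) x (q i) (q j) e (Q.J e))
      (g₃ := fun i j => covD3 cov (covD2 cov η) x (q i) (q j) e (Q.K e))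
      (t := fun k l => S.gH x (torsion cov (S.v x) (q k)) (q l))
      (s₁ := η x e (Q.I e)) (s₂ := η x e (Q.J e)) (s₃ := η x e (Q.K e))
      (δ₁ := covD2 cov η x (S.v x) e (Q.I e)) (δ₂ := covD2 cov η x (S.v x) e (Q.J e))
      (δ₃ := covD2 cov η x (S.v x) e (Q.K e)) (f := S.f x)
      (fun i j => hsw i j _ _) (fun i j => hsw i j _ _) (fun i j => hsw i j _ _)
      (fun i j k l => by
        have h2 := hcov.ricci_frame hη (ha x) hq i j k l
        simp only [hom, hC, hG, hS, hδ] at h2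
        exact h2)
      (fun i j k l => by
        have h2 := hcov.bianchi_H (hq.th_eq i) (hq.th_eq j) (hq.th_eq k) (q l)
        simp only [hom, hC] at h2
        exact h2) t₁ t₂ t₃ (hcov.f_eq he h1) i j
    rw [asdPart_quat he h1 hF hE.isBilin, hF.act_frame hq hP hB, hF.scal_eq hq hR]
    simp only [hqe, weylAsd_quat he h1 hF hR]
    have hscal : scal q (S.RH cov x) =
        scalMatrix (fun i j k l => S.RH cov x (q i) (q j) (q k) (q l)) := rfl
    simp only [← hqe, hscal, hd, hpr, hG, hK, hC, hS]
    exact main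
  have h2 := IsHor2.ext hq (B := fun u w => 2 * Q.asdPart (S.frame x) (S.dH1 (S.dHadj η) x) u w)
    (B' := fun u w => -∑ k, covD3 cov (covD2 cov η) x (q k) (q k) u w
        + Q.act (S.frame x) (Q.weylAsd (S.frame x) (S.RH cov x)) (η x) u w
        + scal (S.frame x) (S.RH cov x) / 3 * η x u w - 2 / 3 * S.f x * η x u w)
    ⟨fun w => ((hE.asdPart _).fst w).const_mul 2, fun w => ((hE.asdPart _).snd w).const_mul 2⟩
    ⟨fun w => (((hT.fst w).add' ((hB.act hF hP).fst w)).add' ((hB.fst w).const_mul _)).sub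
        ((hB.fst w).const_mul _),
      fun w => (((hT.snd w).add' ((hB.act hF hP).snd w)).add' ((hB.snd w).const_mul _)).sub
        ((hB.snd w).const_mul _)⟩ key z₁ z₂
  rw [hN]
  exact h2

end IsDistinguished

end ContactHyperkahler

end ContactGeom

end

theorem mainTheorem7 {M : Type*} [TopologicalSpace M] [T2Space M]
    [ChartedSpace (EuclideanSpace ℝ (Fin 5)) M] [IsManifold (𝓡 5) ∞ M]
    (S : ContactGeom.ContactHyperkahler M)
    (cov : ContactGeom.Connection M) [CovariantDerivative.ContMDiffCovariantDerivative cov ∞]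
    (hcov : S.IsDistinguished cov)
    (σ : Π x : M, LinearMap.BilinForm ℝ (TangentSpace (𝓡 5) x)) (hσ : S.IsASDForm σ)
    (x : M) (z₁ z₂ : TangentSpace (𝓡 5) x) :
    2 * S.box (fun y u w => σ y u w) x z₁ z₂ =
      S.nablaHadj cov (S.nablaH cov (fun y u w => σ y u w)) x z₁ z₂
        + S.curvAction (S.WHminus cov) (fun y u w => σ y u w) x z₁ z₂
        + S.scalH cov x / 3 * σ x z₁ z₂
        - 2 / 3 * S.f x * σ x z₁ z₂ :=
  hcov.weitzenbock hσ x z₁ z₂
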